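/- Let $B_4=\langle a,b,c\mid aba=bab,\ bcb=cbc,\ ac=ca\rangle$ be the braid group on four strands, $Z$ its center, and $G_0=B_4/Z$. In $G_0$ put $e=a^{-1}ba$, $f=c^{-1}bc$, $d=(ac)^{-1}b(ac)$, $x=bac$, $y=xc$, so that $ba=ae=eb$, $de=ec=cd$, $bc=cf=fb$, $df=fa=ad$, $ca=ac$, $ef=fe$. Let $G_1=\langle a,y\rangle\le G_0$. Let $X_0$ be the Brady complex: its vertices are the left cosets $g\langle x\rangle$ of $\langle x\rangle$ in $G_0$, and its triangles are the triples $\{g\langle x\rangle, gu\langle x\rangle, guv\langle x\rangle\}$ with $g\in G_0$ and $uv$ one of the sixteen words of length two in the relations listed above (its edges are the sides of these triangles). Let $G_0$, and hence $G_1$, act on $X_0$ by left multiplication. Let $\overline Y_1$ be the complex with one vertex, four oriented loops $a,e,b,t$ and three triangles with boundaries $ae=t$, $eb=t$, $ba=t$. Let $\overline Y_2$ and $\overline Y_3$ be the analogous complexes for the conjugates of $(a,e,b)$ by $y$ and by $y^2$. Glue $\overline Y_1,\overline Y_2,\overline Y_3$ along their common loops: with $\hat b=yey^{-1}$ (so that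 $yay^{-1}=e$ and $y\hat by^{-1}=a$), the loop $e$ lies in $\overline Y_1\cap\overline Y_2$, the loop $\hat b$ in $\overline Y_2\cap\overline Y_3$, and the loop $a$ in $\overline Y_3\cap\overline Y_1$. Let $X_1$ be the universal cover of the resulting complex. The group $G_1$ acts on $X_1$ as follows: $a$ acts as the deck transformation given by the loop $a$, and $y$ acts as the lift, fixing the base vertex, of the symmetry $\overline Y_1\to\overline Y_2\to\overline Y_3\to\overline Y_1$ of order three. Equip $X_0$ and $X_1$ with the length metrics for which every triangle is a Euclidean equilateral triangle with sides of length one. Then there is no $G_1$-equivariant map $f\colon X_0\to X_1$ that is locally injective and that is, up to a constant scaling of the metrics, locally isometric on the complement of the $0$-skeleton of $X_0$; that is, for which there is a constant $\lambda>0$ such that every point of $X_0$ which is not a vertex has a neighbourhood $U$ with $d(f(q),f(r))=\lambda\, d(q,r)$ for all $q,r\in U$. -/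

import Mathlib

open scoped ENNReal NNReal Topology

namespace BradyRigidity

/-! ## The braid group on four strands -/

/-- The three standard generators of the braid group on four strands. -/
inductive Gen
  | a
  | b
  | c

/-- The relators of `aba = bab`, `bcb = cbc`, `ac = ca`. -/
def b4Rels : Set (FreeGroup Gen) :=
  {FreeGroup.of Gen.a * FreeGroup.of Gen.b * FreeGroup.of Gen.a *
      (FreeGroup.of Gen.b * FreeGroup.of Gen.a * FreeGroup.of Gen.b)⁻¹,
   FreeGroup.of Gen.b * FreeGroup.of Gen.c * FreeGroup.of Gen.b *
      (FreeGroup.of Gen.c * FreeGroup.of Gen.b * FreeGroup.of Gen.c)⁻¹,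
   FreeGroup.of Gen.a * FreeGroup.of Gen.c * (FreeGroup.of Gen.c * FreeGroup.of Gen.a)⁻¹}

/-- The braid group `B₄ = ⟨a, b, c ∣ aba = bab, bcb = cbc, ac = ca⟩`. -/
abbrev B4 : Type := PresentedGroup b4Rels

def B4.a : B4 := PresentedGroup.of Gen.a
def B4.b : B4 := PresentedGroup.of Gen.b
def B4.c : B4 := PresentedGroup.of Gen.c

theorem B4.aba : B4.a * B4.b * B4.a = B4.b * B4.a * B4.b := by
  have h : PresentedGroup.mk b4Rels _ = 1 := PresentedGroup.one_of_mem (rels := b4Rels) (Or.inl rfl)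
  exact mul_inv_eq_one.mp h

theorem B4.bcb : B4.b * B4.c * B4.b = B4.c * B4.b * B4.c := by
  have h : PresentedGroup.mk b4Rels _ = 1 :=
    PresentedGroup.one_of_mem (rels := b4Rels) (Or.inr (Or.inl rfl))
  exact mul_inv_eq_one.mp h

theorem B4.ac : B4.a * B4.c = B4.c * B4.a := by
  have h : PresentedGroup.mk b4Rels _ = 1 :=
    PresentedGroup.one_of_mem (rels := b4Rels) (Or.inr (Or.inr rfl))
  exact mul_inv_eq_one.mp h

theorem b4_lift {G : Type*} [Group G] (f : Gen → G) (h1 : f .a * f .b * f .a = f .b * f .a * f .b)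
    (h2 : f .b * f .c * f .b = f .c * f .b * f .c) (h3 : f .a * f .c = f .c * f .a) :
    ∀ r ∈ b4Rels, FreeGroup.lift f r = 1 := by
  rintro r (rfl | rfl | rfl)
  · simp [-mul_inv_rev, h1]
  · simp [-mul_inv_rev, h2]
  · simp [-mul_inv_rev, h3]

/-- The group `G₀ = B₄ / Z`, where `Z` is the center of `B₄`. -/
abbrev G0 : Type := B4 ⧸ Subgroup.center B4

namespace G0

def a : G0 := QuotientGroup.mk B4.a
def b : G0 := QuotientGroup.mk B4.b
def c : G0 := QuotientGroup.mk B4.c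

/-- `d = (ac)⁻¹ b ac`. -/
def d : G0 := (a * c)⁻¹ * b * (a * c)

/-- `e` is determined by the relation `ba = ae`. -/
def e : G0 := a⁻¹ * b * a

/-- `f` is determined by the relation `bc = cf`. -/
def f : G0 := c⁻¹ * b * c

def x : G0 := b * a * c
def y : G0 := x * c

end G0

/-- The subgroup `G₁ = ⟨a, y⟩` of `G₀`. -/
def G1 : Subgroup G0 := Subgroup.closure {G0.a, G0.y}

/-- `a`, as an element of `G₁`. -/
def G1.a : G1 := ⟨G0.a, Subgroup.subset_closure (by simp)⟩

/-- `y`, as an element of `G₁`. -/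
def G1.y : G1 := ⟨G0.y, Subgroup.subset_closure (by simp)⟩

/-! ## Simplicial complexes with regular simplices of side one, as metric spaces -/

section Realization

variable {V : Type}

/-- The abstract simplicial complex whose simplices are the nonempty finite subsets of the members
of a family `T` of subsets that covers the vertex set. -/
def spannedBy (T : Set (Set V)) (hT : ∀ v, ∃ t ∈ T, v ∈ t) : AbstractSimplicialComplex V where
  faces := {s | s.Nonempty ∧ ∃ t ∈ T, (s : Set V) ⊆ t}
  isRelLowerSet_faces := by
    rintro s ⟨hs, t, ht, hst⟩
    exact ⟨hs, fun r hr hne => ⟨hne, t, ht, (Finset.coe_subset.mpr hr).trans hst⟩⟩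
  singleton_mem v := by
    obtain ⟨t, ht, hv⟩ := hT v
    exact ⟨Finset.singleton_nonempty v, t, ht, by simpa using hv⟩

/-- The geometric realization of a simplicial complex, in barycentric coordinates. -/
@[ext]
structure Realization (K : AbstractSimplicialComplex V) where
  /-- the barycentric coordinates of the point -/
  weight : V →₀ ℝ
  nonneg : ∀ v, 0 ≤ weight v
  sum_eq_one : (weight.sum fun _ t => t) = 1
  support_mem : weight.support ∈ K.faces

namespace Realization

variable {K : AbstractSimplicialComplex V}

/-- The distance between two points of a common simplex, when every simplex is a regular Euclidean
simplex of side length one: with barycentric coordinates `p` and `q`, the square of this distance is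
`(∑ v, (p v - q v) ^ 2) / 2`. It is `⊤` when no simplex contains both points. -/
noncomputable def simplexDist (p q : Realization K) : ℝ≥0∞ :=
  open Classical in
  if ∃ s ∈ K.faces, p.weight.support ⊆ s ∧ q.weight.support ⊆ s then
    ENNReal.ofReal (√(((p.weight - q.weight).sum fun _ t => t ^ 2) / 2))
  else ⊤

/-- The length of the piecewise linear path from `p` to `q` through the points of a list. -/
noncomputable def chainLength (p : Realization K) : List (Realization K) → Realization K → ℝ≥0∞
  | [], q => simplexDist p q
  | r :: l, q => simplexDist p r + chainLength r l q

theorem simplexDist_self (p : Realization K) : simplexDist p p = 0 := by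
  have h : ∃ s ∈ K.faces, p.weight.support ⊆ s ∧ p.weight.support ⊆ s :=
    ⟨_, p.support_mem, subset_rfl, subset_rfl⟩
  rw [simplexDist, if_pos h]; simp

theorem simplexDist_comm (p q : Realization K) : simplexDist p q = simplexDist q p := by
  have h : ((p.weight - q.weight).sum fun _ t => t ^ 2) =
      (q.weight - p.weight).sum fun _ t => t ^ 2 := by
    rw [← neg_sub q.weight p.weight, Finsupp.sum_neg_index (by simp)]
    simp
  simp only [simplexDist, h]
  congr 1
  exact propext (exists_congr fun s => and_congr_right fun _ => and_comm)

theorem chainLength_append (p : Realization K) (l : List (Realization K)) (r : Realization K)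
    (m : List (Realization K)) (q : Realization K) :
    chainLength p (l ++ r :: m) q = chainLength p l r + chainLength r m q := by
  induction l generalizing p with
  | nil => rfl
  | cons s l ih => simp [chainLength, ih, add_assoc]

theorem chainLength_reverse (p : Realization K) (l : List (Realization K)) (q : Realization K) :
    chainLength q l.reverse p = chainLength p l q := by
  induction l generalizing p with
  | nil => exact simplexDist_comm q p
  | cons s l ih =>
    rw [List.reverse_cons, chainLength_append, ih, add_comm]
    simp [chainLength, simplexDist_comm s p]

/-- The length metric: the infimum of the lengths of the piecewise linear paths. -/
noncomputable instance : PseudoEMetricSpace (Realization K) where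
  edist p q := ⨅ l : List (Realization K), chainLength p l q
  edist_self p := le_antisymm ((iInf_le _ []).trans_eq (simplexDist_self p)) bot_le
  edist_comm p q := by
    apply le_antisymm
    · exact le_iInf fun l => (iInf_le _ l.reverse).trans_eq (chainLength_reverse q l p)
    · exact le_iInf fun l => (iInf_le _ l.reverse).trans_eq (chainLength_reverse p l q)
  edist_triangle p r q := by
    simp_rw [ENNReal.iInf_add, ENNReal.add_iInf]
    exact le_iInf fun l => le_iInf fun m =>
      (iInf_le _ (l ++ r :: m)).trans_eq (chainLength_append p l r m q)

/-- The set of vertices. -/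
def zeroSkeleton (K : AbstractSimplicialComplex V) : Set (Realization K) :=
  {p | ∃ v, p.weight = Finsupp.single v 1}

end Realization

/-- The action of `G` on the vertices sends simplices to simplices. -/
class SimplicialAction (G : Type) [Group G] [MulAction G V] (K : AbstractSimplicialComplex V) :
    Prop where
  smul_mem (g : G) (s : Finset V) (hs : s ∈ K.faces) :
    s.map (MulAction.toPerm g : Equiv.Perm V).toEmbedding ∈ K.faces

/-- The induced action on the realization, affine on every simplex. -/
noncomputable instance {G : Type} [Group G] [MulAction G V] {K : AbstractSimplicialComplex V}
    [SimplicialAction G K] : MulAction G (Realization K) where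
  smul g p :=
    { weight := p.weight.embDomain (MulAction.toPerm g : Equiv.Perm V).toEmbedding
      nonneg := fun v => by
        obtain ⟨w, rfl⟩ := (MulAction.toPerm g : Equiv.Perm V).surjective v
        exact (p.nonneg w).trans_eq (Finsupp.embDomain_apply_self _ _ _).symm
      sum_eq_one := by rw [Finsupp.embDomain_eq_mapDomain,
        Finsupp.sum_mapDomain_index (by simp) (by simp), p.sum_eq_one]
      support_mem := by
        rw [Finsupp.support_embDomain]
        exact SimplicialAction.smul_mem g _ p.support_mem }
  one_smul p := by
    apply Realization.ext
    change Finsupp.embDomain _ _ = _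
    rw [Finsupp.embDomain_eq_mapDomain]
    have : (((MulAction.toPerm (1 : G) : Equiv.Perm V).toEmbedding : V ↪ V) : V → V) = id := by
      ext v; simp
    rw [this, Finsupp.mapDomain_id]
  mul_smul g h p := by
    apply Realization.ext
    change Finsupp.embDomain _ _ = Finsupp.embDomain _ (Finsupp.embDomain _ _)
    simp only [Finsupp.embDomain_eq_mapDomain, ← Finsupp.mapDomain_comp]
    congr 1
    ext v; simp [mul_smul]

end Realization

/-! ## The Brady complex -/

namespace X0

/-- The pairs `(u, v)` for which `uv` occurs in the relations `ba = ae = eb`, `de = ec = cd`,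
`bc = cf = fb`, `df = fa = ad`, `ca = ac`, `ef = fe`. -/
def pairs : Set (G0 × G0) :=
  {(G0.b, G0.a), (G0.a, G0.e), (G0.e, G0.b), (G0.d, G0.e), (G0.e, G0.c), (G0.c, G0.d),
   (G0.b, G0.c), (G0.c, G0.f), (G0.f, G0.b), (G0.d, G0.f), (G0.f, G0.a), (G0.a, G0.d),
   (G0.c, G0.a), (G0.a, G0.c), (G0.e, G0.f), (G0.f, G0.e)}

/-- The vertices: the left cosets of `⟨x⟩` in `G₀`. -/
abbrev Vertex : Type := G0 ⧸ Subgroup.zpowers G0.x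

/-- The vertex `g⟨x⟩`. -/
def vertex (g : G0) : Vertex := QuotientGroup.mk g

/-- The vertex sets `{g⟨x⟩, gu⟨x⟩, guv⟨x⟩}` of the triangles. Their sides are labelled by `u`, `v` and
`w`, where `uvw = x`. -/
def triangles : Set (Set Vertex) :=
  {t | ∃ g : G0, ∃ p ∈ pairs, t = {vertex g, vertex (g * p.1), vertex (g * p.1 * p.2)}}

/-- The Brady complex. -/
def complex : AbstractSimplicialComplex Vertex :=
  spannedBy triangles fun v => by
    obtain ⟨g, rfl⟩ := QuotientGroup.mk_surjective v
    exact ⟨_, ⟨g, (G0.b, G0.a), by simp [pairs], rfl⟩, by simp [vertex]⟩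

/-- `G₀` acts on the left cosets of `⟨x⟩` by left multiplication. -/
instance : SimplicialAction G0 complex where
  smul_mem h s := by
    rintro ⟨hs, t, ⟨g, p, hp, rfl⟩, hst⟩
    refine ⟨by simpa using hs, _, ⟨h * g, p, hp, rfl⟩, ?_⟩
    intro v hv
    obtain ⟨w, hw, rfl⟩ := by simpa using hv
    have := hst hw
    simp only [Set.mem_insert_iff, Set.mem_singleton_iff] at this ⊢
    rcases this with rfl | rfl | rfl
    · exact Or.inl rfl
    · exact Or.inr (Or.inl (by simp [vertex, mul_assoc]))
    · exact Or.inr (Or.inr (by simp [vertex, mul_assoc]))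

/-- The metric space `X₀`. -/
abbrev Space : Type := Realization complex

end X0

/-! ## The center of the braid group

We show that every central element of `B₄` is a power of `(bac)⁴`. This is needed below for the action
of `G₁` on `X₁`. -/

section Center

abbrev F2 := FreeGroup Bool
def U : F2 := FreeGroup.of false
def V : F2 := FreeGroup.of true

theorem F2.ext {M : Type*} [Monoid M] {f g : F2 →* M} (h0 : f U = g U) (h1 : f V = g V) : f = g := by
  ext x; cases x
  · exact h0
  · exact h1

def psiA : MulAut F2 := MonoidHom.toMulEquiv
  (FreeGroup.lift fun x => cond x (U⁻¹ * V) U) (FreeGroup.lift fun x => cond x (U * V) U)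
  (F2.ext (by simp [U]) (by simp [U, V])) (F2.ext (by simp [U]) (by simp [U, V]))
def psiB : MulAut F2 := MonoidHom.toMulEquiv
  (FreeGroup.lift fun x => cond x (V * U⁻¹ * V) V)
  (FreeGroup.lift fun x => cond x U (U * V⁻¹ * U))
  (F2.ext (by simp [U, V, mul_assoc]) (by simp [U, V, mul_assoc]))
  (F2.ext (by simp [U, V, mul_assoc]) (by simp [U, V, mul_assoc]))
theorem psiA_U : psiA U = U := by simp [psiA, U]
theorem psiA_V : psiA V = U⁻¹ * V := by simp [psiA, V]
theorem psiB_U : psiB U = V := by simp [psiB, U]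
theorem psiB_V : psiB V = V * U⁻¹ * V := by simp [psiB, V]

theorem MulAut_F2.ext {f g : MulAut F2} (h0 : f U = g U) (h1 : f V = g V) : f = g := by
  have : f.toMonoidHom = g.toMonoidHom := F2.ext h0 h1
  ext w; exact DFunLike.congr_fun this w

def psiG : Gen → MulAut F2
  | .a => psiA | .b => psiB | .c => MulAut.conj U * psiA

def psi : B4 →* MulAut F2 := PresentedGroup.toGroup (b4_lift psiG
  (MulAut_F2.ext (by simp [psiG, psiA_U, psiA_V, psiB_U, psiB_V, mul_assoc])
    (by simp [psiG, psiA_U, psiA_V, psiB_U, psiB_V, mul_assoc]))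
  (MulAut_F2.ext (by simp [psiG, psiA_U, psiA_V, psiB_U, psiB_V, mul_assoc])
    (by simp [psiG, psiA_U, psiA_V, psiB_U, psiB_V, mul_assoc]))
  (MulAut_F2.ext (by simp [psiG, psiA_U, psiA_V, psiB_U, psiB_V, mul_assoc])
    (by simp [psiG, psiA_U, psiA_V, psiB_U, psiB_V, mul_assoc])))
theorem psi_a : psi B4.a = psiA := PresentedGroup.toGroup.of _
theorem psi_b : psi B4.b = psiB := PresentedGroup.toGroup.of _
theorem psi_c : psi B4.c = MulAut.conj U * psiA := PresentedGroup.toGroup.of _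

theorem psi_x4 : psi ((B4.b * B4.a * B4.c) ^ 4) = 1 := by
  simp only [map_pow, map_mul, psi_a, psi_b, psi_c]
  have h1 : (psiB * psiA * (MulAut.conj U * psiA)) U = V := by
    simp [psiA_U, psiA_V, psiB_U, psiB_V, mul_assoc]
  have h2 : (psiB * psiA * (MulAut.conj U * psiA)) V = U⁻¹ := by
    simp [psiA_U, psiA_V, psiB_U, psiB_V, mul_assoc]
  generalize psiB * psiA * (MulAut.conj U * psiA) = f at *
  apply MulAut_F2.ext <;> simp [pow_succ, h1, h2]

/-- A subgroup of `B₄` that contains the generators is the whole group. -/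
theorem b4_ind (H : Subgroup B4) (ha : B4.a ∈ H) (hb : B4.b ∈ H) (hc : B4.c ∈ H) (g : B4) : g ∈ H :=
  PresentedGroup.generated_by _ H (by rintro (_ | _ | _) <;> assumption) g

def iota : F2 →* B4 := FreeGroup.lift fun x => cond x (B4.b * (B4.c * B4.a⁻¹) * B4.b⁻¹) (B4.c * B4.a⁻¹)
theorem iota_U : iota U = B4.c * B4.a⁻¹ := by simp [iota, U]
theorem iota_V : iota V = B4.b * (B4.c * B4.a⁻¹) * B4.b⁻¹ := by simp [iota, V]

theorem iota_psi (g : B4) (w : F2) : g * iota w * g⁻¹ = iota (psi g w) := by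
  let H : Subgroup B4 :=
    { carrier := {g | ∀ w, g * iota w * g⁻¹ = iota (psi g w)}
      one_mem' := by intro w; simp
      mul_mem' := by
        intro g h hg hh w
        rw [map_mul, MulAut.mul_apply, ← hg, ← hh]; group
      inv_mem' := by
        intro g hg w
        have := hg (psi g⁻¹ w)
        rw [map_inv, MulAut.apply_inv_self] at this
        rw [← this, map_inv]; group }
  have key : ∀ g : B4, g * iota U * g⁻¹ = iota (psi g U) → g * iota V * g⁻¹ = iota (psi g V) →
      g ∈ H := by
    intro g h1 h2 w
    have : (MulAut.conj g).toMonoidHom.comp iota = iota.comp (psi g).toMonoidHom :=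
      F2.ext (by simpa using h1) (by simpa using h2)
    simpa using DFunLike.congr_fun this w
  have hac := B4.ac
  have haba := B4.aba
  have hbcb := B4.bcb
  have ha : B4.a ∈ H := by
    apply key
    · rw [psi_a, psiA_U, iota_U, ← mul_assoc, hac]; group
    · rw [psi_a, psiA_V, map_mul, map_inv, iota_U, iota_V]
      calc _ = B4.a * B4.b * B4.c * (B4.a * B4.b * B4.a)⁻¹ := by group
        _ = B4.a * B4.b * B4.c * (B4.b * B4.a * B4.b)⁻¹ := by rw [haba]
        _ = B4.a * B4.c⁻¹ * (B4.c * B4.b * B4.c) * (B4.b * B4.a * B4.b)⁻¹ := by group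
        _ = B4.a * B4.c⁻¹ * (B4.b * B4.c * B4.b) * (B4.b * B4.a * B4.b)⁻¹ := by rw [hbcb]
        _ = _ := by group
  have hb : B4.b ∈ H := by
    apply key
    · rw [psi_b, psiB_U, iota_U, iota_V]
    · rw [psi_b, psiB_V, map_mul, map_mul, map_inv, iota_U, iota_V]
      have e1 : B4.a⁻¹ * B4.b⁻¹ * B4.a = B4.b * B4.a⁻¹ * B4.b⁻¹ := calc
        _ = B4.a⁻¹ * B4.b⁻¹ * (B4.a * B4.b * B4.a) * B4.a⁻¹ * B4.b⁻¹ := by group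
        _ = B4.a⁻¹ * B4.b⁻¹ * (B4.b * B4.a * B4.b) * B4.a⁻¹ * B4.b⁻¹ := by rw [haba]
        _ = _ := by group
      have e2 : B4.c⁻¹ * B4.b * B4.c = B4.b * B4.c * B4.b⁻¹ := calc
        _ = B4.c⁻¹ * (B4.b * B4.c * B4.b) * B4.b⁻¹ := by group
        _ = B4.c⁻¹ * (B4.c * B4.b * B4.c) * B4.b⁻¹ := by rw [hbcb]
        _ = _ := by group
      have e3 : B4.a⁻¹ * B4.c = B4.c * B4.a⁻¹ := calc
        _ = B4.a⁻¹ * (B4.c * B4.a) * B4.a⁻¹ := by group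
        _ = B4.a⁻¹ * (B4.a * B4.c) * B4.a⁻¹ := by rw [hac]
        _ = _ := by group
      symm
      calc _ = B4.b * B4.c * (B4.a⁻¹ * B4.b⁻¹ * B4.a) * (B4.c⁻¹ * B4.b * B4.c) * B4.a⁻¹ * B4.b⁻¹ := by group
        _ = B4.b * B4.c * B4.b * (B4.a⁻¹ * B4.c) * B4.b⁻¹ * B4.a⁻¹ * B4.b⁻¹ := by rw [e1, e2]; group
        _ = B4.b * (B4.c * B4.b * B4.c) * B4.a⁻¹ * (B4.b * B4.a * B4.b)⁻¹ := by rw [e3]; group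
        _ = B4.b * (B4.b * B4.c * B4.b) * B4.a⁻¹ * (B4.b * B4.a * B4.b)⁻¹ := by rw [hbcb]
        _ = B4.b * B4.b * B4.c * B4.b * (B4.a * B4.b * B4.a)⁻¹ * B4.b⁻¹ := by group
        _ = B4.b * B4.b * B4.c * B4.b * (B4.b * B4.a * B4.b)⁻¹ * B4.b⁻¹ := by rw [haba]
        _ = _ := by group
  have hc : B4.c ∈ H := by
    have : B4.c = iota U * B4.a := by rw [iota_U]; group
    rw [this]
    refine H.mul_mem ?_ ha
    intro w
    rw [iota_U, map_mul, psi_c, map_inv, psi_a, mul_inv_cancel_right, ← iota_U]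
    simp
  exact b4_ind H ha hb hc g w

theorem psi_iota (w : F2) : psi (iota w) = MulAut.conj w := by
  have : psi.comp iota = MulAut.conj := by
    apply F2.ext
    · simp [iota_U, psi_c, psi_a]
    · have h : ∀ (f : MulAut F2) (w : F2), f * MulAut.conj w * f⁻¹ = MulAut.conj (f w) := by
        intro f w
        ext x; simp
      have := h psiB U
      rw [psiB_U] at this
      simp [iota_V, psi_c, psi_a, psi_b, this]
  exact DFunLike.congr_fun this w

theorem center_F2 (w : F2) (h0 : w * U = U * w) (h1 : w * V = V * w) : w = 1 := by
  by_contra hw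
  have hne : w.toWord ≠ [] := fun h => hw (FreeGroup.toWord_eq_nil_iff.mp h)
  have hc : ∀ x : Bool × Bool, w * FreeGroup.mk [x] = FreeGroup.mk [x] * w := by
    have hinv : ∀ y, w * y = y * w → w * y⁻¹ = y⁻¹ * w := fun y h => by
      have : Commute w y := h
      exact this.inv_right
    rintro ⟨_ | _, _ | _⟩
    · exact hinv _ h0
    · exact h0
    · exact hinv _ h1
    · exact h1
  obtain ⟨p, L, hp⟩ : ∃ p L, w.toWord = p :: L := List.exists_cons_of_ne_nil hne
  obtain ⟨q, M, hq⟩ : ∃ q M, w.toWord = M ++ [q] :=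
    ⟨_, _, (List.dropLast_append_getLast hne).symm⟩
  let x : Bool × Bool := (!p.1, q.2)
  have hx := hc x
  have hr := FreeGroup.isReduced_toWord (x := w)
  have r1 : FreeGroup.IsReduced (x :: w.toWord) := by
    rw [hp] at hr ⊢
    refine List.isChain_cons_cons.mpr ⟨?_, hr⟩
    simp [x]
  have r2 : FreeGroup.IsReduced (w.toWord ++ [x]) := by
    rw [hq] at hr ⊢
    refine List.isChain_append.mpr ⟨hr, List.isChain_singleton _, ?_⟩
    simp [x]
  have e1 : (FreeGroup.mk [x] * w).toWord = x :: w.toWord := by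
    rw [FreeGroup.toWord_mul, FreeGroup.toWord_mk, FreeGroup.IsReduced.singleton.reduce_eq]
    exact r1.reduce_eq
  have e2 : (w * FreeGroup.mk [x]).toWord = w.toWord ++ [x] := by
    rw [FreeGroup.toWord_mul, FreeGroup.toWord_mk, FreeGroup.IsReduced.singleton.reduce_eq]
    exact r2.reduce_eq
  rw [← hx, e2, hp] at e1
  have : p = x := by simpa using (List.cons.inj e1).1
  have := congrArg Prod.fst this
  simp [x] at this

def retr : B4 →* B4 := PresentedGroup.toGroup (b4_lift (fun | .a => B4.a | .b => B4.b | .c => B4.a)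
  B4.aba B4.aba.symm rfl)
theorem retr_a : retr B4.a = B4.a := PresentedGroup.toGroup.of _
theorem retr_b : retr B4.b = B4.b := PresentedGroup.toGroup.of _
theorem retr_c : retr B4.c = B4.a := PresentedGroup.toGroup.of _

theorem iota_retr (g : B4) : ∃ w, g = iota w * retr g := by
  let H : Subgroup B4 :=
    { carrier := {g | ∃ w, g = iota w * retr g}
      one_mem' := ⟨1, by simp⟩
      mul_mem' := by
        rintro g h ⟨w, hw⟩ ⟨w', hw'⟩
        refine ⟨w * psi (retr g) w', ?_⟩
        rw [map_mul, map_mul, ← iota_psi]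
        nth_rw 1 [hw, hw']
        group
      inv_mem' := by
        rintro g ⟨w, hw⟩
        refine ⟨psi (retr g)⁻¹ w⁻¹, ?_⟩
        rw [map_inv retr, ← iota_psi]
        nth_rw 1 [hw]
        rw [map_inv]
        group }
  refine b4_ind H ⟨1, by simp [retr_a]⟩ ⟨1, by simp [retr_b]⟩ ⟨U, ?_⟩ g
  rw [iota_U, retr_c]; group

def bp : B4 := B4.a * B4.b * B4.a
def bq : B4 := B4.a * B4.b
theorem bpq : bp ^ 2 = bq ^ 3 := calc
  bp ^ 2 = B4.a * B4.b * B4.a * (B4.a * B4.b * B4.a) := by simp only [bp, pow_two]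
  _ = B4.a * B4.b * B4.a * (B4.b * B4.a * B4.b) := by rw [B4.aba]
  _ = bq ^ 3 := by simp only [bq, pow_succ, pow_zero, one_mul, mul_assoc]

/-- The positive words in `pq` and `pq²`. -/
def bT : Submonoid B4 := Submonoid.closure {bp * bq, bp * bq ^ 2}

def NF (h : B4) : Prop := ∃ (k : ℤ) (i : ℕ) (t : B4) (j : ℕ), i < 3 ∧ t ∈ bT ∧ j < 2 ∧
  h = (bq ^ 3) ^ k * bq ^ i * t * bp ^ j

theorem comm_qz (k : ℤ) : bq * (bq ^ 3) ^ k = (bq ^ 3) ^ k * bq :=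
  (((Commute.refl bq).pow_right 3).zpow_right k)
theorem comm_pz (k : ℤ) : bp * (bq ^ 3) ^ k = (bq ^ 3) ^ k * bp := by
  rw [← bpq]
  exact (((Commute.refl bp).pow_right 2).zpow_right k)

theorem NF_z (h : B4) (hh : NF h) (m : ℤ) : NF ((bq ^ 3) ^ m * h) := by
  obtain ⟨k, i, t, j, hi, ht, hj, rfl⟩ := hh
  exact ⟨m + k, i, t, j, hi, ht, hj, by rw [zpow_add]; simp only [mul_assoc]⟩

theorem NF_q (h : B4) (hh : NF h) : NF (bq * h) := by
  obtain ⟨k, i, t, j, hi, ht, hj, rfl⟩ := hh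
  rcases Nat.lt_or_ge (i + 1) 3 with h3 | h3
  · refine ⟨k, i + 1, t, j, h3, ht, hj, ?_⟩
    simp only [← mul_assoc, comm_qz]
    rw [pow_succ' bq i]; simp only [mul_assoc]
  · obtain rfl : i = 2 := by omega
    refine ⟨k + 1, 0, t, j, by omega, ht, hj, ?_⟩
    simp only [← mul_assoc, comm_qz, zpow_add]
    simp [pow_succ, mul_assoc]

theorem NF_p (h : B4) (hh : NF h) : NF (bp * h) := by
  obtain ⟨k, i, t, j, hi, ht, hj, rfl⟩ := hh
  have hp2 : bp * bp = bq ^ 3 := by rw [← bpq, pow_two]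
  have hT : ∀ s ∈ bT, ∀ j < 2, NF (bp * (s * bp ^ j)) := by
    intro s hs j hj
    induction hs using Submonoid.closure_induction_left with
    | one =>
      interval_cases j
      · exact ⟨0, 0, 1, 1, by omega, one_mem _, by omega, by simp⟩
      · exact ⟨1, 0, 1, 0, by omega, one_mem _, by omega, by simp [hp2]⟩
    | mul_left x hx y hy ih =>
      rcases hx with rfl | rfl
      · exact ⟨1, 1, y, j, by omega, hy, hj, by simp [← mul_assoc, hp2]⟩
      · exact ⟨1, 2, y, j, by omega, hy, hj, by simp [← mul_assoc, hp2]⟩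
  have e : bp * ((bq ^ 3) ^ k * bq ^ i * t * bp ^ j) =
      (bq ^ 3) ^ k * (bp * (bq ^ i * t * bp ^ j)) := by
    simp only [← mul_assoc, comm_pz]
  rw [e]
  apply NF_z
  interval_cases i
  · simpa using hT t ht j hj
  · exact ⟨0, 0, bp * bq * t, j, by omega,
      mul_mem (Submonoid.subset_closure (by simp)) ht, hj, by simp [mul_assoc]⟩
  · exact ⟨0, 0, bp * bq ^ 2 * t, j, by omega,
      mul_mem (Submonoid.subset_closure (by simp)) ht, hj, by simp [mul_assoc]⟩

theorem NF_retr (g : B4) : NF (retr g) := by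
  let S : Subgroup B4 :=
    { carrier := {s | (∀ h, NF h → NF (retr s * h)) ∧ ∀ h, NF h → NF (retr s⁻¹ * h)}
      one_mem' := by simp
      mul_mem' := by
        rintro s t ⟨h1, h2⟩ ⟨h3, h4⟩
        constructor
        · intro h hh; rw [map_mul, mul_assoc]; exact h1 _ (h3 _ hh)
        · intro h hh; rw [mul_inv_rev, map_mul, mul_assoc]; exact h4 _ (h2 _ hh)
      inv_mem' := by
        rintro s ⟨h1, h2⟩
        exact ⟨h2, by simpa using h1⟩ }
  have hz : ∀ h, NF h → NF ((bq ^ 3)⁻¹ * h) := fun h hh => by simpa using NF_z h hh (-1)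
  have rq : retr bq = bq := by simp [bq, retr_a, retr_b]
  have rp : retr bp = bp := by simp [bp, retr_a, retr_b]
  have hq : bq ∈ S := by
    refine ⟨fun h hh => by rw [rq]; exact NF_q h hh, fun h hh => ?_⟩
    have e : retr bq⁻¹ * h = (bq ^ 3)⁻¹ * (bq * (bq * h)) := by
      rw [map_inv, rq]; simp [pow_succ, mul_assoc]
    rw [e]
    exact hz _ (NF_q _ (NF_q _ hh))
  have hp : bp ∈ S := by
    refine ⟨fun h hh => by rw [rp]; exact NF_p h hh, fun h hh => ?_⟩
    have e : retr bp⁻¹ * h = (bq ^ 3)⁻¹ * (bp * h) := by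
      rw [map_inv, rp, ← bpq]; simp [pow_succ, mul_assoc]
    rw [e]
    exact hz _ (NF_p _ hh)
  have ha : B4.a ∈ S := by
    have : B4.a = bq⁻¹ * bp := by
      have h : bp = bq * B4.a := rfl
      rw [h]; simp
    rw [this]; exact mul_mem (inv_mem hq) hp
  have hb : B4.b ∈ S := by
    have : B4.b = B4.a⁻¹ * bq := by simp [bq]
    rw [this]; exact mul_mem (inv_mem ha) hq
  have hc : B4.c ∈ S := by
    obtain ⟨h1, h2⟩ := ha
    refine ⟨fun h hh => ?_, fun h hh => ?_⟩
    · have := h1 h hh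
      rwa [retr_a, ← retr_c] at this
    · have := h2 h hh
      rwa [map_inv, retr_a, ← retr_c, ← map_inv] at this
  have h1 : NF 1 := ⟨0, 0, 1, 0, by omega, one_mem _, by omega, by simp⟩
  simpa using (b4_ind S ha hb hc g).1 1 h1

open Matrix in
def muG : Gen → SpecialLinearGroup (Fin 2) ℤ
  | .b => ⟨!![1, 0; -1, 1], by simp⟩
  | _ => ⟨!![1, 1; 0, 1], by simp⟩

open Matrix in
def mu : B4 →* SpecialLinearGroup (Fin 2) ℤ := PresentedGroup.toGroup
  (b4_lift muG (by decide) (by decide) rfl)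

theorem mu_a : (mu B4.a : Matrix (Fin 2) (Fin 2) ℤ) = !![1, 1; 0, 1] :=
  congrArg Subtype.val (PresentedGroup.toGroup.of (f := muG) _ : mu B4.a = muG .a)
theorem mu_b : (mu B4.b : Matrix (Fin 2) (Fin 2) ℤ) = !![1, 0; -1, 1] :=
  congrArg Subtype.val (PresentedGroup.toGroup.of (f := muG) _ : mu B4.b = muG .b)
theorem mu_p : (mu bp : Matrix (Fin 2) (Fin 2) ℤ) = !![0, 1; -1, 0] := by
  simp [bp, mu_a, mu_b, Matrix.mul_fin_two]
theorem mu_q : (mu bq : Matrix (Fin 2) (Fin 2) ℤ) = !![0, 1; -1, 1] := by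
  simp [bq, mu_a, mu_b, Matrix.mul_fin_two]

/-- Up to sign, a positive word acts by a matrix with entries of known signs. -/
theorem mu_T (t : B4) (ht : t ∈ bT) : ∃ e x y w z : ℤ, (e = 1 ∨ e = -1) ∧ 1 ≤ x ∧ 0 ≤ y ∧ 0 ≤ w ∧
    1 ≤ z ∧ (mu t : Matrix (Fin 2) (Fin 2) ℤ) = !![e * x, -(e * y); -(e * w), e * z] ∧
    (t = 1 ∨ 1 ≤ y + w) := by
  induction ht using Submonoid.closure_induction_left with
  | one =>
    exact ⟨1, 1, 0, 0, 1, by simp, by simp, by simp, by simp, by simp,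
      by simp [Matrix.one_fin_two], by simp⟩
  | mul_left g hg t ht ih =>
    obtain ⟨e, x, y, w, z, he, hx, hy, hw, hz, hm, -⟩ := ih
    rcases hg with rfl | rfl
    · refine ⟨-e, x + w, y + z, w, z, by omega, by omega, by omega, by omega, by omega, ?_,
        Or.inr (by omega)⟩
      simp only [map_mul, Matrix.SpecialLinearGroup.coe_mul, mu_p, mu_q, hm, Matrix.mul_fin_two]
      ext i j; fin_cases i <;> fin_cases j <;> simp <;> ring
    · refine ⟨-e, x, y, x + w, y + z, by omega, by omega, by omega, by omega, by omega, ?_,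
        Or.inr (by omega)⟩
      simp only [map_mul, map_pow, pow_two, Matrix.SpecialLinearGroup.coe_mul, mu_p, mu_q, hm,
        Matrix.mul_fin_two]
      ext i j; fin_cases i <;> fin_cases j <;> simp <;> ring

theorem mu_z (k : ℤ) : ∃ e : ℤ, (e = 1 ∨ e = -1) ∧
    (mu ((bq ^ 3) ^ k) : Matrix (Fin 2) (Fin 2) ℤ) = !![e, 0; 0, e] := by
  have h1 : mu (bq ^ 3) = -1 := by
    have hq : mu bq = ⟨!![0, 1; -1, 1], by simp⟩ := Subtype.ext mu_q
    rw [map_pow, hq]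
    decide
  rw [map_zpow, h1]
  rcases Int.even_or_odd k with h | h
  · exact ⟨1, by simp, by rw [h.neg_one_zpow]; simp [Matrix.one_fin_two]⟩
  · refine ⟨-1, by simp, ?_⟩
    rw [h.neg_one_zpow]; ext i j; fin_cases i <;> fin_cases j <;> simp

theorem retr_central (g : B4) (h : NF g) (ha : B4.a * g = g * B4.a) (hb : B4.b * g = g * B4.b) :
    ∃ k : ℤ, g = (bq ^ 3) ^ k := by
  have hA := congrArg (fun x => (mu x : Matrix (Fin 2) (Fin 2) ℤ)) ha
  have hB := congrArg (fun x => (mu x : Matrix (Fin 2) (Fin 2) ℤ)) hb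
  obtain ⟨k, i, t, j, hi, ht, hj, rfl⟩ := h
  obtain ⟨e, x, y, w, z, he, hx, hy, hw, hz, hm, h1⟩ := mu_T t ht
  obtain ⟨d, hd, hk⟩ := mu_z k
  simp only [map_mul, Matrix.SpecialLinearGroup.coe_mul, mu_a, mu_b, hk, hm] at hA hB
  refine ⟨k, ?_⟩
  rcases he with rfl | rfl <;> rcases hd with rfl | rfl <;> interval_cases i <;> interval_cases j <;>
    simp [pow_two, mu_p, mu_q, Matrix.mul_fin_two] at hA hB
  all_goals first
    | (exfalso; omega)
    | (rcases h1 with rfl | h1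
       · simp
       · exfalso; omega)

theorem psi_z : psi (bq ^ 3) U = V⁻¹ * U⁻¹ * V ∧ psi (bq ^ 3) V = V⁻¹ * U * V⁻¹ * U⁻¹ * V := by
  constructor <;>
    simp [pow_succ, bq, psi_a, psi_b, psiA_U, psiA_V, psiB_U, psiB_V, mul_assoc]

def ab : F2 →* Multiplicative (ℤ × ℤ) :=
  FreeGroup.lift fun x => .ofAdd (cond x (0, 1) (1, 0))

theorem center_le (g : B4) (hg : g ∈ Subgroup.center B4) :
    g ∈ Subgroup.zpowers ((B4.b * B4.a * B4.c) ^ 4) := by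
  have hc : ∀ h, h * g = g * h := Subgroup.mem_center_iff.mp hg
  obtain ⟨w, hw⟩ := iota_retr g
  obtain ⟨k, hk⟩ := retr_central (retr g) (NF_retr g)
    (by have := congrArg retr (hc B4.a); simpa [retr_a] using this)
    (by have := congrArg retr (hc B4.b); simpa [retr_b] using this)
  have hF : ∀ v : F2, (∀ y, y * v = v * y) → v = 1 := fun v hv =>
    center_F2 v (hv U).symm (hv V).symm
  have hpsi : psi g = 1 := by
    ext v
    have h1 := congrArg psi (hc (iota v))
    rw [map_mul, map_mul, psi_iota] at h1
    have h2 : psi g v * v⁻¹ = 1 := by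
      apply hF
      intro y
      have h3 : ∀ t, v * t * v⁻¹ = psi g v * t * (psi g v)⁻¹ := by
        intro t
        have := DFunLike.congr_fun h1 ((psi g)⁻¹ t)
        simpa only [MulAut.mul_apply, MulAut.apply_inv_self, MulAut.conj_apply, map_mul,
          map_inv] using this
      have h4 : y = psi g v * (v⁻¹ * y * v) * (psi g v)⁻¹ := by
        rw [← h3]; group
      calc y * (psi g v * v⁻¹) = psi g v * (v⁻¹ * y * v) * (psi g v)⁻¹ * (psi g v * v⁻¹) := by
            rw [← h4]
        _ = _ := by group
    rw [MulAut.one_apply, ← mul_inv_eq_one, h2]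
  let S : Subgroup (MulAut F2) :=
    { carrier := {f | ∀ v, ab (f v) = ab v}
      one_mem' := fun _ => rfl
      mul_mem' := fun {f f'} hf hf' v => by rw [MulAut.mul_apply, hf, hf']
      inv_mem' := fun {f} hf v => by rw [← hf, MulAut.apply_inv_self] }
  have hmap : psi (bq ^ 3) ^ k ∈ S := by
    intro v
    have h1 : MulAut.conj w * psi (bq ^ 3) ^ k = 1 := by
      rw [← psi_iota, ← map_zpow, ← map_mul, ← hk, ← hw, hpsi]
    have h2 := congrArg ab (DFunLike.congr_fun h1 v)
    rw [MulAut.mul_apply, MulAut.conj_apply, map_mul, map_mul, map_inv, mul_comm (ab w),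
      mul_inv_cancel_right] at h2
    exact h2
  have hneg : ∀ v, ab (psi (bq ^ 3) v) = (ab v)⁻¹ := by
    intro v
    have : ab.comp (psi (bq ^ 3)).toMonoidHom = ab⁻¹ := by
      apply F2.ext
      · change ab (psi (bq ^ 3) U) = (ab U)⁻¹
        rw [psi_z.1]; simp [mul_comm]
      · change ab (psi (bq ^ 3) V) = (ab V)⁻¹
        rw [psi_z.2]; simp only [map_mul, map_inv]
        rw [mul_assoc (_ * _) _ (ab U)⁻¹, mul_comm (ab V)⁻¹ (ab U)⁻¹]; group
    exact DFunLike.congr_fun this v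
  have heven : Even k := by
    by_contra hodd
    obtain ⟨m, rfl⟩ := Int.not_even_iff_odd.mp hodd
    have h2 : psi (bq ^ 3) ^ (2 : ℤ) ∈ S := by
      intro v
      rw [zpow_two, MulAut.mul_apply, hneg, hneg, inv_inv]
    have h3 : psi (bq ^ 3) ∈ S := by
      have := S.mul_mem (S.inv_mem (S.zpow_mem h2 m)) hmap
      rwa [zpow_add, ← zpow_mul, inv_mul_cancel_left, zpow_one] at this
    have h4 := h3 U
    rw [hneg] at h4
    exact absurd h4 (by simp [ab, U]; decide)
  obtain ⟨m, hm⟩ := heven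
  have hX : retr ((B4.b * B4.a * B4.c) ^ 4) = (bq ^ 3) ^ (2 : ℤ) := by
    have h := B4.aba
    have h2 : B4.b * B4.a * B4.a * (B4.b * B4.a * B4.a) = bq ^ 3 := calc
      _ = B4.b * B4.a * (B4.a * B4.b * B4.a) * B4.a := by group
      _ = B4.b * B4.a * (B4.b * B4.a * B4.b) * B4.a := by rw [B4.aba]
      _ = (B4.b * B4.a * B4.b) * (B4.a * B4.b * B4.a) := by group
      _ = (B4.a * B4.b * B4.a) * (B4.b * B4.a * B4.b) := by rw [B4.aba]
      _ = _ := by simp only [bq, pow_succ, pow_zero, one_mul, mul_assoc]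
    rw [zpow_two, ← h2, map_pow, map_mul, map_mul, retr_a, retr_b, retr_c]
    simp only [pow_succ, pow_zero, one_mul, mul_assoc]
  obtain ⟨v, hv⟩ := iota_retr (g * ((B4.b * B4.a * B4.c) ^ 4) ^ (-m))
  have h1 : retr (g * ((B4.b * B4.a * B4.c) ^ 4) ^ (-m)) = 1 := by
    rw [map_mul, map_zpow, hX, hk, hm, ← zpow_mul, ← zpow_add,
      show m + m + 2 * -m = 0 by ring, zpow_zero]
  rw [h1, mul_one] at hv
  have h2 : psi (iota v) = 1 := by
    rw [← hv, map_mul, map_zpow, psi_x4, hpsi]; simp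
  rw [psi_iota] at h2
  have h3 : v = 1 := hF v fun y => by
    have := DFunLike.congr_fun h2 y
    simp only [MulAut.conj_apply, MulAut.one_apply] at this
    rw [mul_inv_eq_iff_eq_mul] at this
    exact this.symm
  rw [h3, map_one, zpow_neg, mul_inv_eq_one] at hv
  exact ⟨m, hv.symm⟩

end Center

/-! ## Homomorphisms from `G₁`

For elements `α`, `η` of a group `K` such that `η³ = 1` and such that `α` and `ηαη⁻¹` satisfy the braid
relation, we construct the homomorphism from `G₁` to `K` with `a ↦ α` and `y ↦ η`. It is obtained from
an action of `G₀` on four copies of `K` (the cosets `xⁱG₁`). -/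

section Mono
variable {K : Type*} [Group K]

def mono (s : Equiv.Perm (Fin 4)) (k : Fin 4 → K) : Equiv.Perm (Fin 4 × K) where
  toFun p := (s p.1, k p.1 * p.2)
  invFun p := (s.symm p.1, (k (s.symm p.1))⁻¹ * p.2)
  left_inv p := by simp
  right_inv p := by simp

variable (α η : K)

def mA : Equiv.Perm (Fin 4 × K) :=
  mono (Equiv.swap 1 2) ![α, (η*α*η⁻¹)⁻¹ * α⁻¹, η, η*α*η⁻¹]
def mB : Equiv.Perm (Fin 4 × K) :=
  mono (Equiv.swap 1 3) ![α*(η*α*η⁻¹)*α⁻¹, α⁻¹ * η⁻¹, α*(η*α*η⁻¹)*α⁻¹, α⁻¹ * η⁻¹]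
def mC : Equiv.Perm (Fin 4 × K) :=
  mono (Equiv.swap 0 3) ![η, η*α*η⁻¹, α, (η*α*η⁻¹)⁻¹ * α⁻¹]

theorem mono_eq {s t : Equiv.Perm (Fin 4)} {k l : Fin 4 → K} (h : s = t) (h' : ∀ i, k i = l i) :
    mono s k = mono t l := by
  rw [h, funext h']

theorem mono_mul (s t : Equiv.Perm (Fin 4)) (k l : Fin 4 → K) :
    mono s k * mono t l = mono (s * t) (fun i => k (t i) * l i) := by
  ext1 p; simp [mono, mul_assoc]

variable {α η}

theorem rel_ac (hb : α * (η * α * η⁻¹) * α = (η * α * η⁻¹) * α * (η * α * η⁻¹)) :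
    mA α η * mC α η = mC α η * mA α η := by
  have h1 : ((η * α * η⁻¹)⁻¹ * α⁻¹) * (η * α * η⁻¹) = α * ((η * α * η⁻¹)⁻¹ * α⁻¹) := calc
    _ = ((η * α * η⁻¹)⁻¹ * α⁻¹) * ((η * α * η⁻¹) * α * (η * α * η⁻¹)) *
        ((η * α * η⁻¹)⁻¹ * α⁻¹) := by group
    _ = ((η * α * η⁻¹)⁻¹ * α⁻¹) * (α * (η * α * η⁻¹) * α) * ((η * α * η⁻¹)⁻¹ * α⁻¹) := by rw [hb]
    _ = _ := by group
  simp only [mA, mC, mono_mul]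
  refine mono_eq (by decide) fun i => ?_
  fin_cases i
  · exact (show (η * α * η⁻¹) * η = η * α by group)
  · exact h1
  · exact (show η * α = (η * α * η⁻¹) * η by group)
  · exact h1.symm

theorem id0
    (hb : α * (η * α * η⁻¹) * α = (η * α * η⁻¹) * α * (η * α * η⁻¹)) : α * (α * (η * α * η⁻¹) * α⁻¹) * α =
    (α * (η * α * η⁻¹) * α⁻¹) * α * (α * (η * α * η⁻¹) * α⁻¹) := calc
  _ = α * (α * (η * α * η⁻¹) * α) * α⁻¹ := by group
  _ = α * ((η * α * η⁻¹) * α * (η * α * η⁻¹)) * α⁻¹ := by rw [hb]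
  _ = _ := by group

theorem id1
    (hb : α * (η * α * η⁻¹) * α = (η * α * η⁻¹) * α * (η * α * η⁻¹))
    (h3 : η ^ 3 = 1) : η * (α * (η * α * η⁻¹) * α⁻¹) * ((η * α * η⁻¹)⁻¹ * α⁻¹) =
    (α⁻¹ * η⁻¹) * (η * α * η⁻¹) * (α⁻¹ * η⁻¹) := calc
  _ = η * α * (η * α * η⁻¹) * (α * (η * α * η⁻¹) * α)⁻¹ := by group
  _ = η * α * (η * α * η⁻¹) * ((η * α * η⁻¹) * α * (η * α * η⁻¹))⁻¹ := by rw [hb]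
  _ = η ^ 3 * (α⁻¹ * η⁻¹) * (η * α * η⁻¹) * (α⁻¹ * η⁻¹) := by
    simp [pow_succ, mul_assoc]
  _ = _ := by rw [h3, one_mul]

theorem id3
    (hb : α * (η * α * η⁻¹) * α = (η * α * η⁻¹) * α * (η * α * η⁻¹)) : ((η * α * η⁻¹)⁻¹ * α⁻¹) * (α⁻¹ * η⁻¹) * (η * α * η⁻¹) =
    (α * (η * α * η⁻¹) * α⁻¹) * ((η * α * η⁻¹)⁻¹ * α⁻¹) * (α⁻¹ * η⁻¹) := calc
  _ = α * (η * α * η⁻¹) * ((η * α * η⁻¹) * α * (η * α * η⁻¹))⁻¹ * α⁻¹ * η⁻¹ := by group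
  _ = α * (η * α * η⁻¹) * (α * (η * α * η⁻¹) * α)⁻¹ * α⁻¹ * η⁻¹ := by rw [hb]
  _ = _ := by group

theorem rel_aba
    (hb : α * (η * α * η⁻¹) * α = (η * α * η⁻¹) * α * (η * α * η⁻¹))
    (h3 : η ^ 3 = 1) :
    mA α η * mB α η * mA α η = mB α η * mA α η * mB α η := by
  simp only [mA, mB, mono_mul]
  refine mono_eq (by decide) fun i => ?_
  fin_cases i
  · exact id0 hb
  · exact id1 hb h3
  · exact (show (η * α * η⁻¹) * (α⁻¹ * η⁻¹) * η =
      (α⁻¹ * η⁻¹) * η * (α * (η * α * η⁻¹) * α⁻¹) by group)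
  · exact id3 hb

theorem rel_bcb
    (hb : α * (η * α * η⁻¹) * α = (η * α * η⁻¹) * α * (η * α * η⁻¹))
    (h3 : η ^ 3 = 1) :
    mB α η * mC α η * mB α η = mC α η * mB α η * mC α η := by
  simp only [mC, mB, mono_mul]
  refine mono_eq (by decide) fun i => ?_
  fin_cases i
  · exact (show (α⁻¹ * η⁻¹) * η * (α * (η * α * η⁻¹) * α⁻¹) =
      (η * α * η⁻¹) * (α⁻¹ * η⁻¹) * η by group)
  · exact (id3 hb).symm
  · exact (id0 hb).symm
  · exact (id1 hb h3).symm

theorem rel_x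
    (hb : α * (η * α * η⁻¹) * α = (η * α * η⁻¹) * α * (η * α * η⁻¹)) : mB α η * mA α η * mC α η = mono (finRotate 4) 1 := by
  simp only [mA, mC, mB, mono_mul]
  refine mono_eq (by decide) fun i => ?_
  fin_cases i
  · exact (show (α⁻¹ * η⁻¹) * (η * α * η⁻¹) * η = 1 by group)
  · exact (calc (α * (η * α * η⁻¹) * α⁻¹) * ((η * α * η⁻¹)⁻¹ * α⁻¹) * (η * α * η⁻¹)
      _ = α * (η * α * η⁻¹) * (α * (η * α * η⁻¹) * α)⁻¹ * (η * α * η⁻¹) := by group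
      _ = α * (η * α * η⁻¹) * ((η * α * η⁻¹) * α * (η * α * η⁻¹))⁻¹ * (η * α * η⁻¹) := by rw [hb]
      _ = 1 := by group)
  · exact (show (α⁻¹ * η⁻¹) * η * α = 1 by group)
  · exact (show (α * (η * α * η⁻¹) * α⁻¹) * α * ((η * α * η⁻¹)⁻¹ * α⁻¹) = 1 by group)

variable (α η) in
def thetaG : Gen → Equiv.Perm (Fin 4 × K)
  | .a => mA α η
  | .b => mB α η
  | .c => mC α η

/-- The action of `B₄` on four copies of `K`. -/
def theta4 (h3 : η ^ 3 = 1)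
    (hb : α * (η * α * η⁻¹) * α = (η * α * η⁻¹) * α * (η * α * η⁻¹)) :
    B4 →* Equiv.Perm (Fin 4 × K) :=
  PresentedGroup.toGroup
    (b4_lift (thetaG α η) (rel_aba hb h3) (rel_bcb hb h3) (rel_ac hb))

theorem theta4_center (h3 : η ^ 3 = 1)
    (hb : α * (η * α * η⁻¹) * α = (η * α * η⁻¹) * α * (η * α * η⁻¹)) :
    ∀ g ∈ Subgroup.center B4, theta4 h3 hb g = 1 := by
  intro g hg
  obtain ⟨k, rfl⟩ := center_le g hg
  have h : theta4 h3 hb ((B4.b * B4.a * B4.c) ^ 4) = 1 := by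
    have e : theta4 h3 hb (B4.b * B4.a * B4.c) = mono (finRotate 4) 1 := by
      rw [← rel_x hb, map_mul, map_mul]
      rfl
    rw [map_pow, e]
    have h2 : ∀ s t : Equiv.Perm (Fin 4), mono s (1 : Fin 4 → K) * mono t 1 = mono (s * t) 1 :=
      fun s t => by rw [mono_mul]; exact mono_eq rfl (by simp)
    simp only [pow_succ, pow_zero, one_mul, h2]
    rw [show finRotate 4 * finRotate 4 * finRotate 4 * finRotate 4 = 1 by decide]
    ext1 p; simp [mono]
  change theta4 h3 hb (_ ^ k) = 1
  rw [map_zpow, h, one_zpow]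

/-- The action of `G₀` on four copies of `K`. -/
def theta (h3 : η ^ 3 = 1)
    (hb : α * (η * α * η⁻¹) * α = (η * α * η⁻¹) * α * (η * α * η⁻¹)) :
    G0 →* Equiv.Perm (Fin 4 × K) :=
  QuotientGroup.lift _ (theta4 h3 hb) (theta4_center h3 hb)

theorem theta_a (h3 : η ^ 3 = 1)
    (hb : α * (η * α * η⁻¹) * α = (η * α * η⁻¹) * α * (η * α * η⁻¹)) (k : K) :
    theta h3 hb G0.a (0, k) = (0, α * k) := rfl

theorem theta_y (h3 : η ^ 3 = 1)
    (hb : α * (η * α * η⁻¹) * α = (η * α * η⁻¹) * α * (η * α * η⁻¹)) (k : K) :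
    theta h3 hb G0.y (0, k) = (0, η * k) := by
  have e : theta h3 hb G0.x = mono (finRotate 4) 1 := by
    rw [← rel_x hb, G0.x, map_mul, map_mul]
    rfl
  have e' : theta h3 hb G0.c = mC α η := rfl
  rw [G0.y, map_mul, e, e']
  have h1 : mC α η (0, k) = (3, η * k) := rfl
  rw [Equiv.Perm.mul_apply, h1]
  simp [mono]

theorem theta_G1 (h3 : η ^ 3 = 1)
    (hb : α * (η * α * η⁻¹) * α = (η * α * η⁻¹) * α * (η * α * η⁻¹)) (g : G0) (hg : g ∈ G1) :
    ∃ m : K, ∀ k, theta h3 hb g (0, k) = (0, m * k) := by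
  induction hg using Subgroup.closure_induction with
  | mem g hg =>
    rcases hg with rfl | rfl
    · exact ⟨α, theta_a h3 hb⟩
    · exact ⟨η, theta_y h3 hb⟩
  | one => exact ⟨1, by simp⟩
  | mul g h _ _ hg hh =>
    obtain ⟨m, hm⟩ := hg
    obtain ⟨n, hn⟩ := hh
    exact ⟨m * n, fun k => by rw [map_mul, Equiv.Perm.mul_apply, hn, hm, mul_assoc]⟩
  | inv g _ hg =>
    obtain ⟨m, hm⟩ := hg
    exact ⟨m⁻¹, fun k => by rw [map_inv, Equiv.Perm.inv_eq_iff_eq, hm, mul_inv_cancel_left]⟩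

/-- The homomorphism from `G₁` to `K` with `a ↦ α` and `y ↦ η`. -/
def homG1 (h3 : η ^ 3 = 1)
    (hb : α * (η * α * η⁻¹) * α = (η * α * η⁻¹) * α * (η * α * η⁻¹)) : G1 →* K where
  toFun g := (theta h3 hb g (0, 1)).2
  map_one' := by simp
  map_mul' g h := by
    obtain ⟨m, hm⟩ := theta_G1 h3 hb g g.2
    obtain ⟨n, hn⟩ := theta_G1 h3 hb h h.2
    rw [Subgroup.coe_mul, map_mul, Equiv.Perm.mul_apply, hn, hm, hm]
    simp

theorem homG1_a (h3 : η ^ 3 = 1)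
    (hb : α * (η * α * η⁻¹) * α = (η * α * η⁻¹) * α * (η * α * η⁻¹)) :
    homG1 h3 hb G1.a = α := by
  change (theta h3 hb G0.a (0, 1)).2 = α
  rw [theta_a, mul_one]

theorem homG1_y (h3 : η ^ 3 = 1)
    (hb : α * (η * α * η⁻¹) * α = (η * α * η⁻¹) * α * (η * α * η⁻¹)) :
    homG1 h3 hb G1.y = η := by
  change (theta h3 hb G0.y (0, 1)).2 = η
  rw [theta_y, mul_one]

end Mono

/-! ## The complex `X₁`

For `i = 0, 1, 2`, let `Y i` be the complex with one vertex, four oriented loops, and three triangles,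
which read `u v = t` for the three expressions of the element `t` in the presentation
`⟨u, v, w ∣ uv = vw = wu⟩` of the `i`-th of the groups `⟨a, e, b⟩`, `y⟨a, e, b⟩y⁻¹`, `y²⟨a, e, b⟩y⁻²`.
The second loop of `Y i` is glued to the first loop of `Y (i + 1)`. The result is a complex `Y` with one
vertex, nine loops and nine triangles, and `X₁` is its universal cover. -/

namespace X1

/-- The loops of `Y` are `(first, i)`, `(third, i)` and `(prod, i)` for `i` modulo 3. Those of `Y i` are
`u = (first, i)`, `v = (first, i + 1)`, `w = (third, i)` and `t = (prod, i)`. The loops `(first, 0)`,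
`(first, 1)`, `(first, 2)` are the loops `a`, `e = yay⁻¹`, `y²ay⁻²`, and `(third, 0)` is `b`. -/
inductive Loop
  | first
  | third
  | prod

/-- The boundaries of the triangles of `Y i`: `uv = t`, `vw = t`, `wu = t`. -/
def rels : Set (FreeGroup (Loop × ZMod 3)) :=
  {r | ∃ i : ZMod 3,
    r = .of (.first, i) * .of (.first, i + 1) * (.of (.prod, i))⁻¹ ∨
    r = .of (.first, i + 1) * .of (.third, i) * (.of (.prod, i))⁻¹ ∨
    r = .of (.third, i) * .of (.first, i) * (.of (.prod, i))⁻¹}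

/-- The fundamental group of `Y`. -/
abbrev Pi1 : Type := PresentedGroup rels

/-- The element of the fundamental group represented by a loop of `Y`. -/
def loop (l : Loop) (i : ZMod 3) : Pi1 := PresentedGroup.of (l, i)

theorem first_first (i : ZMod 3) : loop .first i * loop .first (i + 1) = loop .prod i := by
  have h : PresentedGroup.mk rels _ = 1 := PresentedGroup.one_of_mem (rels := rels)
    ⟨i, Or.inl rfl⟩
  exact mul_inv_eq_one.mp h

theorem first_third (i : ZMod 3) : loop .first (i + 1) * loop .third i = loop .prod i := by
  have h : PresentedGroup.mk rels _ = 1 := PresentedGroup.one_of_mem (rels := rels)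
    ⟨i, Or.inr (Or.inl rfl)⟩
  exact mul_inv_eq_one.mp h

theorem third_first (i : ZMod 3) : loop .third i * loop .first i = loop .prod i := by
  have h : PresentedGroup.mk rels _ = 1 := PresentedGroup.one_of_mem (rels := rels)
    ⟨i, Or.inr (Or.inr rfl)⟩
  exact mul_inv_eq_one.mp h

theorem braid (i : ZMod 3) : loop .first i * loop .first (i + 1) * loop .first i =
    loop .first (i + 1) * loop .first i * loop .first (i + 1) := by
  rw [first_first, ← first_third, mul_assoc, third_first, ← first_first, mul_assoc]

/-- The symmetry of `Y` that maps `Y i` to `Y (i + r)`, on the fundamental group. -/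
def shift (r : ZMod 3) : Pi1 →* Pi1 :=
  PresentedGroup.toGroup (f := fun p => loop p.1 (p.2 + r)) (by
    rintro _ ⟨i, rfl | rfl | rfl⟩
    · simp [-mul_inv_rev, add_right_comm i 1 r, first_first]
    · simp [-mul_inv_rev, add_right_comm i 1 r, first_third]
    · simp [-mul_inv_rev, third_first])

theorem shift_loop (r : ZMod 3) (l : Loop) (i : ZMod 3) : shift r (loop l i) = loop l (i + r) :=
  PresentedGroup.toGroup.of _

theorem shift_add (r s : ZMod 3) : (shift r).comp (shift s) = shift (r + s) := by
  refine PresentedGroup.ext fun p => ?_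
  change shift r (shift s (loop p.1 p.2)) = shift (r + s) (loop p.1 p.2)
  rw [shift_loop, shift_loop, shift_loop, add_assoc, add_comm s r]

theorem shift_zero : shift 0 = MonoidHom.id Pi1 := by
  refine PresentedGroup.ext fun p => ?_
  change shift 0 (loop p.1 p.2) = loop p.1 p.2
  rw [shift_loop, add_zero]

/-- The symmetries, as an action of the cyclic group of order 3 on the fundamental group. -/
def shiftAut : Multiplicative (ZMod 3) →* MulAut Pi1 where
  toFun r := MonoidHom.toMulEquiv (shift r.toAdd) (shift (-r.toAdd))
    (by rw [shift_add, neg_add_cancel, shift_zero]) (by rw [shift_add, add_neg_cancel, shift_zero])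
  map_one' := by
    ext g; exact DFunLike.congr_fun shift_zero g
  map_mul' r s := by
    ext g; exact (DFunLike.congr_fun (shift_add r.toAdd s.toAdd) g).symm

/-- The group generated by the deck transformations and by the symmetries. -/
abbrev Sym : Type := Pi1 ⋊[shiftAut] Multiplicative (ZMod 3)

/-- The element `α` of `Sym` is the deck transformation of the loop `a`. -/
def α : Sym := SemidirectProduct.inl (loop .first 0)

/-- The element `η` of `Sym` is the symmetry that maps `Y i` to `Y (i + 1)`. -/
def η : Sym := SemidirectProduct.inr (Multiplicative.ofAdd 1)

theorem η_pow : η ^ 3 = 1 := by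
  rw [η, ← map_pow, ← ofAdd_nsmul]
  exact map_one _

theorem conj_α : η * α * η⁻¹ = SemidirectProduct.inl (loop .first 1) := by
  rw [η, α, ← map_inv, ← SemidirectProduct.inl_aut]
  congr 1

theorem braid_α : α * (η * α * η⁻¹) * α = (η * α * η⁻¹) * α * (η * α * η⁻¹) := by
  have h := braid 0
  rw [zero_add] at h
  rw [conj_α, α, ← map_mul, ← map_mul, h, map_mul, map_mul]

/-- The homomorphism from `G₁` to the symmetries of `X₁` with `a ↦ α` and `y ↦ η`; it is unique since
`G₁` is generated by `a` and `y`. -/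
def hom : G1 →* Sym := homG1 η_pow braid_α

theorem hom_a : hom G1.a = α := homG1_a _ _

theorem hom_y : hom G1.y = η := homG1_y _ _

/-- The vertices of the universal cover of `Y` (which has one vertex) are the elements of the
fundamental group. -/
def Vertex : Type := Pi1

/-- The action on the vertices: deck transformations act by left multiplication, and the symmetries
fix the base vertex. -/
instance : MulAction Sym Vertex where
  smul k g := (k.left * shiftAut k.right g : Pi1)
  one_smul g := by
    change (1 * shiftAut 1 g : Pi1) = g
    rw [map_one, one_mul]; rfl
  mul_smul k l g := by
    change ((k * l).left * shiftAut (k * l).right g : Pi1) =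
      k.left * shiftAut k.right (l.left * shiftAut l.right g)
    rw [SemidirectProduct.mul_left, SemidirectProduct.mul_right, map_mul, map_mul, mul_assoc]
    rfl

/-- The action of `G₁` on the vertices. -/
instance : MulAction G1 Vertex := MulAction.compHom Vertex hom

/-- The pairs `(u, v)` for which `uv = t` is the boundary of a triangle of `Y`. -/
def pairs : Set (Pi1 × Pi1) :=
  {p | ∃ i : ZMod 3, p = (loop .first i, loop .first (i + 1)) ∨
    p = (loop .first (i + 1), loop .third i) ∨ p = (loop .third i, loop .first i)}

/-- The vertex sets `{g, gu, guv}` of the lifts of the triangles of `Y`. -/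
def triangles : Set (Set Vertex) :=
  {t | ∃ g : Pi1, ∃ p ∈ pairs, t = {g, g * p.1, g * p.1 * p.2}}

/-- The universal cover of `Y`. -/
def complex : AbstractSimplicialComplex Vertex :=
  spannedBy triangles fun g => ⟨_, ⟨g, _, ⟨0, Or.inl rfl⟩, rfl⟩, Or.inl rfl⟩

theorem shiftAut_pairs (r : Multiplicative (ZMod 3)) (p : Pi1 × Pi1) (hp : p ∈ pairs) :
    (shiftAut r p.1, shiftAut r p.2) ∈ pairs := by
  have h : ∀ l i, shiftAut r (loop l i) = loop l (i + r.toAdd) := shift_loop r.toAdd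
  obtain ⟨i, rfl | rfl | rfl⟩ := hp
  · exact ⟨i + r.toAdd, Or.inl (by simp only [h, add_right_comm])⟩
  · exact ⟨i + r.toAdd, Or.inr (Or.inl (by simp only [h, add_right_comm]))⟩
  · exact ⟨i + r.toAdd, Or.inr (Or.inr (by simp only [h]))⟩

instance : SimplicialAction G1 complex where
  smul_mem k s := by
    rintro ⟨hs, t, ⟨g, p, hp, rfl⟩, hst⟩
    refine ⟨by simpa using hs, _, ⟨(hom k).left * shiftAut (hom k).right g, _,
      shiftAut_pairs (hom k).right p hp, rfl⟩, ?_⟩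
    intro v hv
    obtain ⟨w, hw, rfl⟩ := Finset.mem_map.mp (Finset.mem_coe.mp hv)
    change (hom k).left * shiftAut (hom k).right w ∈ _
    rcases hst hw with rfl | rfl | rfl
    · exact Or.inl rfl
    · exact Or.inr (Or.inl (by rw [map_mul, mul_assoc]))
    · exact Or.inr (Or.inr (by rw [map_mul, map_mul]; simp only [mul_assoc]; rfl))

/-- The metric space `X₁`. -/
abbrev Space : Type := Realization complex

end X1

end BradyRigidity

/-! Both complexes are 3-coloured by the exponent sum modulo three: `x` has exponent sum three, so
the colour of a coset is well defined, and the vertices of every triangle get three different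
colours. A colouring folds the complex onto one triangle. Up to the factor √2 the folding map is
isometric on simplices and does not increase distances; what remains of a point is its three colour
weights.

Let `c` be the scaling factor of a map `f` as in the theorem. If an edge of `X₀` lies in at least
three triangles, no inner point of it can be sent into an open triangle of `X₁`: three half-discs
with a common diameter do not fit into the plane (`exists_colourWeight_eq_zero`). So the open edge
is sent into the 1-skeleton of `X₁` with speed `c`. When it meets a vertex of `X₁` it goes straight
on as far as colours are concerned: a half turn inside a triangle of `X₀` consists of three turns by
π/3, and each turn exchanges the two colours other than that of the vertex (`colourWeight_turn`).
Thus, in colours, the edge runs around the boundary of a triangle, a circle of length three, without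
turning back: its position is `θ ± c t` (`IsBranchEdge.exists_wave`).

The images of two sides of a triangle approach each other at the common corner
(`IsTriangle.tendsto_colourWeight_sub`). Hence branch edges at one vertex that are linked by a chain
of triangles start from the same position modulo three.

Now `y` moves the vertex `⟨x⟩` to its neighbour `f⟨x⟩` (here `f` is the element of `G₀`) and
preserves the colours of `X₁`, so the positions at the two ends of this branch edge agree and `c ≡
0` modulo 3. Likewise `a` moves `⟨x⟩` to `a⟨x⟩` but shifts the colours of `X₁` by one, so `±c ≡ 1`
modulo 3. These congruences contradict each other. -/

namespace BradyRigidity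

/-! ## Folding maps of complexes with regular simplices -/

namespace Realization

section Bary

variable {V : Type} {K : AbstractSimplicialComplex V} {E : Type*} [NormedAddCommGroup E]
  [InnerProductSpace ℝ E]

/-- The affine extension to the realization of a map that is defined on the vertices. -/
noncomputable def bary (φ : V → E) (p : Realization K) : E :=
  Finsupp.linearCombination ℝ φ p.weight

/-- A map of the vertices that sends every simplex to a regular simplex of side `√2`. -/
def IsRegular (K : AbstractSimplicialComplex V) (φ : V → E) : Prop :=
  ∀ s ∈ K.faces, ∀ v ∈ s, ∀ w ∈ s, v ≠ w → ‖φ v - φ w‖ ^ 2 = 2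

/-- Since the coefficients sum to zero, the terms of the Gram matrix that depend on only one of the
two vertices drop out, and the mutual distances determine the norm. -/
theorem norm_sum_smul_sq {s : Finset V} {φ : V → E}
    (hφ : ∀ v ∈ s, ∀ w ∈ s, v ≠ w → ‖φ v - φ w‖ ^ 2 = 2) (δ : V → ℝ) (hδ : ∑ v ∈ s, δ v = 0) :
    ‖∑ v ∈ s, δ v • φ v‖ ^ 2 = ∑ v ∈ s, δ v ^ 2 := by
  classical
  have hin : ∀ v ∈ s, ∀ w ∈ s, inner ℝ (φ v) (φ w) =
      ‖φ v‖ ^ 2 / 2 + ‖φ w‖ ^ 2 / 2 - 1 + if v = w then 1 else 0 := by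
    intro v hv w hw
    split_ifs with h
    · rw [h, real_inner_self_eq_norm_sq]; ring
    · have := hφ v hv w hw h
      rw [norm_sub_sq_real] at this
      linarith
  rw [← real_inner_self_eq_norm_sq, sum_inner]
  simp_rw [inner_sum, real_inner_smul_left, real_inner_smul_right]
  calc ∑ v ∈ s, ∑ w ∈ s, δ v * (δ w * inner ℝ (φ v) (φ w))
      = ∑ v ∈ s, ∑ w ∈ s, ((δ v * (‖φ v‖ ^ 2 / 2)) * δ w + δ v * (δ w * (‖φ w‖ ^ 2 / 2))
          - δ v * δ w + if v = w then δ v * δ w else 0) := by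
        refine Finset.sum_congr rfl fun v hv => Finset.sum_congr rfl fun w hw => ?_
        rw [hin v hv w hw]
        split_ifs <;> ring
    _ = ∑ v ∈ s, δ v ^ 2 := by
        simp only [Finset.sum_add_distrib, Finset.sum_sub_distrib, ← Finset.mul_sum,
          ← Finset.sum_mul, hδ]
        simp only [mul_zero, zero_mul, add_zero, sub_zero, zero_add]
        refine Finset.sum_congr rfl fun v hv => ?_
        rw [Finset.sum_ite_eq, if_pos hv, pow_two]

theorem norm_bary_sub_sq {φ : V → E} (hφ : IsRegular K φ) {p q : Realization K} {s : Finset V}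
    (hs : s ∈ K.faces) (hp : p.weight.support ⊆ s) (hq : q.weight.support ⊆ s) :
    ‖bary φ p - bary φ q‖ ^ 2 = (p.weight - q.weight).sum fun _ t => t ^ 2 := by
  classical
  have hsub : (p.weight - q.weight).support ⊆ s :=
    Finsupp.support_sub.trans (Finset.union_subset hp hq)
  have h1 : ∀ r : Realization K, r.weight.support ⊆ s → ∑ v ∈ s, r.weight v = 1 := fun r hr => by
    rw [← r.sum_eq_one, Finsupp.sum_of_support_subset _ hr _ (by simp)]
  rw [bary, bary, ← map_sub, Finsupp.linearCombination_apply,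
    Finsupp.sum_of_support_subset _ hsub _ (by simp),
    Finsupp.sum_of_support_subset _ hsub _ (by simp)]
  apply norm_sum_smul_sq (hφ s hs)
  simp [Finset.sum_sub_distrib, h1 p hp, h1 q hq]

/-- The length metric is the largest one that is bounded by the metrics of the simplices. -/
theorem le_edist {D : Realization K → Realization K → ℝ≥0∞}
    (tri : ∀ p q r, D p r ≤ D p q + D q r) (h : ∀ p q, D p q ≤ simplexDist p q)
    (p q : Realization K) : D p q ≤ edist p q := by
  refine le_iInf fun l => ?_
  induction l generalizing p with
  | nil => exact h p q
  | cons r l ih => exact (tri p r q).trans (add_le_add (h p r) (ih r))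

theorem edist_le_simplexDist (p q : Realization K) : edist p q ≤ simplexDist p q :=
  iInf_le _ []

theorem simplexDist_of_subset {p q : Realization K} {s : Finset V} (hs : s ∈ K.faces)
    (hp : p.weight.support ⊆ s) (hq : q.weight.support ⊆ s) :
    simplexDist p q =
      ENNReal.ofReal (√(((p.weight - q.weight).sum fun _ t => t ^ 2) / 2)) :=
  if_pos ⟨s, hs, hp, hq⟩

/-- The pulled back distance obeys the triangle inequality and agrees with the metric of each
simplex, so the maximality of the length metric applies. Lower bounds for distances come from
choosing a suitable `φ`. -/
theorem ofReal_norm_bary_sub_le {φ : V → E} (hφ : IsRegular K φ) (p q : Realization K) :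
    ENNReal.ofReal (√(‖bary φ p - bary φ q‖ ^ 2 / 2)) ≤ edist p q := by
  refine le_edist (D := fun p q => ENNReal.ofReal (√(‖bary φ p - bary φ q‖ ^ 2 / 2)))
    (fun p q r => ?_) (fun p q => ?_) p q
  · rw [← ENNReal.ofReal_add (Real.sqrt_nonneg _) (Real.sqrt_nonneg _)]
    apply ENNReal.ofReal_le_ofReal
    simp only [Real.sqrt_div (sq_nonneg _), Real.sqrt_sq (norm_nonneg _)]
    rw [← add_div]
    gcongr
    exact norm_sub_le_norm_sub_add_norm_sub _ _ _
  · by_cases h : ∃ s ∈ K.faces, p.weight.support ⊆ s ∧ q.weight.support ⊆ s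
    · obtain ⟨s, hs, hp, hq⟩ := h
      rw [simplexDist_of_subset hs hp hq, norm_bary_sub_sq hφ hs hp hq]
    · rw [simplexDist, if_neg h]
      exact le_top

theorem norm_bary_sub_sq_le {φ : V → E} (hφ : IsRegular K φ) {p q : Realization K} {d : ℝ}
    (hd : 0 ≤ d) (h : edist p q ≤ ENNReal.ofReal d) : ‖bary φ p - bary φ q‖ ^ 2 ≤ 2 * d ^ 2 := by
  have := (ofReal_norm_bary_sub_le hφ p q).trans h
  rw [ENNReal.ofReal_le_ofReal_iff hd, Real.sqrt_le_left hd] at this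
  linarith

/-- Again by maximality of the length metric. This keeps points near `p` inside the open stars of
the vertices that support `p`; the constant 2 is not sharp. -/
theorem abs_weight_sub_le {p q : Realization K} {d : ℝ} (hd : 0 ≤ d)
    (h : edist p q ≤ ENNReal.ofReal d) (v : V) : |p.weight v - q.weight v| ≤ 2 * d := by
  have key : ENNReal.ofReal (|p.weight v - q.weight v| / 2) ≤ edist p q := by
    refine le_edist (D := fun p q => ENNReal.ofReal (|p.weight v - q.weight v| / 2))
      (fun p q r => ?_) (fun p q => ?_) p q
    · rw [← ENNReal.ofReal_add (by positivity) (by positivity)]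
      apply ENNReal.ofReal_le_ofReal
      linarith [abs_sub_le (p.weight v) (q.weight v) (r.weight v)]
    · by_cases h : ∃ s ∈ K.faces, p.weight.support ⊆ s ∧ q.weight.support ⊆ s
      · obtain ⟨s, hs, hp, hq⟩ := h
        rw [simplexDist_of_subset hs hp hq]
        apply ENNReal.ofReal_le_ofReal
        apply Real.le_sqrt_of_sq_le
        rw [div_pow, sq_abs]
        have : (p.weight v - q.weight v) ^ 2 ≤ (p.weight - q.weight).sum fun _ t => t ^ 2 := by
          by_cases hv : v ∈ (p.weight - q.weight).support
          · exact Finset.single_le_sum (f := fun v => (p.weight - q.weight) v ^ 2)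
              (fun _ _ => sq_nonneg _) hv
          · have h0 : p.weight v - q.weight v = 0 := by simpa using hv
            rw [h0, zero_pow two_ne_zero]
            exact Finset.sum_nonneg fun _ _ => sq_nonneg _
        nlinarith [sq_nonneg (p.weight v - q.weight v)]
      · rw [simplexDist, if_neg h]
        exact le_top
  have := key.trans h
  rw [ENNReal.ofReal_le_ofReal_iff hd] at this
  linarith

/-- The straight segment bounds the distance from above and the map `bary φ` bounds it from below: a
detour through other simplices is no shortcut. -/
theorem edist_eq_of_subset {φ : V → E} (hφ : IsRegular K φ) {p q : Realization K} {s : Finset V}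
    (hs : s ∈ K.faces) (hp : p.weight.support ⊆ s) (hq : q.weight.support ⊆ s) :
    edist p q = ENNReal.ofReal (√(‖bary φ p - bary φ q‖ ^ 2 / 2)) := by
  refine le_antisymm ?_ (ofReal_norm_bary_sub_le hφ p q)
  rw [norm_bary_sub_sq hφ hs hp hq, ← simplexDist_of_subset hs hp hq]
  exact edist_le_simplexDist p q

end Bary

/-! ## Coloured complexes -/

section Colour

variable {V : Type} {K : AbstractSimplicialComplex V} (col : V → ZMod 3)

/-- The vertices of every simplex have different colours. -/
def IsColouring (K : AbstractSimplicialComplex V) (col : V → ZMod 3) : Prop :=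
  ∀ s ∈ K.faces, Set.InjOn col s

/-- The folding map onto a triangle that is given by a colouring. -/
noncomputable def fold (v : V) : EuclideanSpace ℝ (ZMod 3) := EuclideanSpace.single (col v) 1

open Classical in
/-- The folding map with the image of one vertex reflected in the opposite side. -/
noncomputable def foldAt (w v : V) : EuclideanSpace ℝ (ZMod 3) :=
  fold col v + if v = w then WithLp.toLp 2 fun l => if l = col w then -2 else 1 else 0

/-- The total weight of the vertices of each colour. -/
noncomputable def colourWeight (p : Realization K) (l : ZMod 3) : ℝ := bary (fold col) p l

theorem sum_zmod_three {k j i : ZMod 3} (hkj : k ≠ j) (hki : k ≠ i) (hji : j ≠ i) (g : ZMod 3 → ℝ) :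
    ∑ l, g l = g k + g j + g i := by
  have : (Finset.univ : Finset (ZMod 3)) = {k, j, i} := by
    revert k j i; decide
  rw [this, Finset.sum_insert (by simp [hkj, hki]), Finset.sum_pair hji, add_assoc]

theorem exists_third : ∀ {k j : ZMod 3}, k ≠ j → ∃ i, k ≠ i ∧ j ≠ i := by decide

theorem norm_sq_three {k j i : ZMod 3} (hkj : k ≠ j) (hki : k ≠ i) (hji : j ≠ i)
    (x : EuclideanSpace ℝ (ZMod 3)) : ‖x‖ ^ 2 = x k ^ 2 + x j ^ 2 + x i ^ 2 := by
  rw [EuclideanSpace.real_norm_sq_eq, sum_zmod_three hkj hki hji fun l => x l ^ 2]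

variable {col}

theorem isRegular_fold (hcol : IsColouring K col) : IsRegular K (fold col) := by
  intro s hs v hv w hw hvw
  have hne : col v ≠ col w := fun h => hvw (hcol s hs hv hw h)
  obtain ⟨i, hi, hj⟩ := exists_third hne
  rw [norm_sq_three hne hi hj]
  simp [fold, hne, hne.symm, hi.symm, hj.symm]
  norm_num

/-- The reflected unit vector has coordinate -1 at its own colour and 1 at the other two, so its
squared distance from each of the other two unit vectors is still 2. -/
theorem isRegular_foldAt (hcol : IsColouring K col) (u : V) : IsRegular K (foldAt col u) := by
  intro s hs v hv w hw hvw
  have hne : col v ≠ col w := fun h => hvw (hcol s hs hv hw h)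
  obtain ⟨i, hi, hj⟩ := exists_third hne
  rw [norm_sq_three hne hi hj]
  by_cases h1 : v = u
  · have h2 : w ≠ u := fun h => hvw (h1.trans h.symm)
    subst h1
    simp [fold, foldAt, h2, hne, hne.symm, hi.symm, hj.symm]
    norm_num
  · by_cases h2 : w = u
    · subst h2
      simp [fold, foldAt, h1, hne, hne.symm, hi.symm, hj.symm]
      norm_num
    · simp [fold, foldAt, h1, h2, hne, hne.symm, hi.symm, hj.symm]
      norm_num

theorem bary_foldAt (w : V) (p : Realization K) (l : ZMod 3) :
    bary (foldAt col w) p l = colourWeight col p l + p.weight w * if l = col w then -2 else 1 := by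
  have h : bary (foldAt col w) p = bary (fold col) p +
      p.weight w • WithLp.toLp 2 fun l => if l = col w then (-2 : ℝ) else 1 := by
    classical
    simp only [bary, Finsupp.linearCombination_apply, foldAt, smul_add, Finsupp.sum_add, smul_ite,
      smul_zero]
    congr 1
    rw [Finsupp.sum_ite_eq']
    split_ifs with hw
    · rfl
    · rw [Finsupp.notMem_support_iff.mp hw, zero_smul]
  rw [h, colourWeight]
  simp

theorem colourWeight_eq (p : Realization K) (l : ZMod 3) :
    colourWeight col p l = ∑ v ∈ p.weight.support, if col v = l then p.weight v else 0 := by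
  rw [colourWeight, bary, Finsupp.linearCombination_apply, Finsupp.sum, WithLp.ofLp_sum,
    Finset.sum_apply]
  refine Finset.sum_congr rfl fun v _ => ?_
  simp [fold, eq_comm]

theorem colourWeight_nonneg (p : Realization K) (l : ZMod 3) : 0 ≤ colourWeight col p l := by
  rw [colourWeight_eq]
  exact Finset.sum_nonneg fun v _ => by split_ifs; exacts [p.nonneg v, le_rfl]

theorem sum_colourWeight {k j i : ZMod 3} (hkj : k ≠ j) (hki : k ≠ i) (hji : j ≠ i)
    (p : Realization K) : colourWeight col p k + colourWeight col p j + colourWeight col p i = 1 := by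
  rw [← sum_zmod_three hkj hki hji (colourWeight col p), ← p.sum_eq_one]
  simp_rw [colourWeight_eq]
  rw [Finset.sum_comm]
  exact Finset.sum_congr rfl fun v _ => by simp

theorem colourWeight_of_mem (hcol : IsColouring K col) {p : Realization K} {s : Finset V}
    (hs : s ∈ K.faces) (hp : p.weight.support ⊆ s) {v : V} (hv : v ∈ s) :
    colourWeight col p (col v) = p.weight v := by
  rw [colourWeight_eq, Finset.sum_eq_single v]
  · simp
  · intro w hw hwv
    exact if_neg fun h => hwv (hcol s hs (hp hw) hv h)
  · intro h
    simpa using h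

theorem exists_of_colourWeight_ne_zero {p : Realization K} {l : ZMod 3}
    (h : colourWeight col p l ≠ 0) : ∃ v ∈ p.weight.support, col v = l := by
  rw [colourWeight_eq] at h
  obtain ⟨v, hv, h⟩ := Finset.exists_ne_zero_of_sum_ne_zero h
  exact ⟨v, hv, by by_contra h'; exact h (if_neg h')⟩

theorem weight_eq_zero_of_colourWeight {p : Realization K} {v : V}
    (h : colourWeight col p (col v) = 0) : p.weight v = 0 := by
  by_contra hv
  rw [colourWeight_eq, Finset.sum_eq_zero_iff_of_nonneg
    fun w _ => by split_ifs; exacts [p.nonneg w, le_rfl]] at h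
  exact hv (by simpa using h v (Finsupp.mem_support_iff.mpr hv))

theorem colourWeight_sub_sq_le (hcol : IsColouring K col) {k j i : ZMod 3} (hkj : k ≠ j)
    (hki : k ≠ i) (hji : j ≠ i) {p q : Realization K} {d : ℝ} (hd : 0 ≤ d)
    (h : edist p q ≤ ENNReal.ofReal d) :
    (colourWeight col p k - colourWeight col q k) ^ 2 +
      (colourWeight col p j - colourWeight col q j) ^ 2 +
      (colourWeight col p i - colourWeight col q i) ^ 2 ≤ 2 * d ^ 2 := by
  have := norm_bary_sub_sq_le (isRegular_fold hcol) hd h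
  rwa [norm_sq_three hkj hki hji] at this

theorem abs_colourWeight_sub_le (hcol : IsColouring K col) {p q : Realization K} {d : ℝ}
    (hd : 0 ≤ d) (h : edist p q ≤ ENNReal.ofReal d) (l : ZMod 3) :
    |colourWeight col p l - colourWeight col q l| ≤ 2 * d := by
  have h1 : ∀ l : ZMod 3, l ≠ l + 1 ∧ l ≠ l + 2 ∧ l + 1 ≠ l + 2 := by decide
  obtain ⟨h2, h3, h4⟩ := h1 l
  apply abs_le_of_sq_le_sq _ (by linarith)
  nlinarith [colourWeight_sub_sq_le hcol h2 h3 h4 hd h,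
    sq_nonneg (colourWeight col p (l + 1) - colourWeight col q (l + 1)),
    sq_nonneg (colourWeight col p (l + 2) - colourWeight col q (l + 2))]

theorem edist_eq (hcol : IsColouring K col) {k j i : ZMod 3} (hkj : k ≠ j)
    (hki : k ≠ i) (hji : j ≠ i) {p q : Realization K} {s : Finset V}
    (hs : s ∈ K.faces) (hp : p.weight.support ⊆ s) (hq : q.weight.support ⊆ s) :
    edist p q = ENNReal.ofReal (√(((colourWeight col p k - colourWeight col q k) ^ 2 +
      (colourWeight col p j - colourWeight col q j) ^ 2 +
      (colourWeight col p i - colourWeight col q i) ^ 2) / 2)) := by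
  rw [edist_eq_of_subset (isRegular_fold hcol) hs hp hq, norm_sq_three hkj hki hji]
  rfl

theorem colourWeight_sub_sq_eq (hcol : IsColouring K col) {k j i : ZMod 3} (hkj : k ≠ j)
    (hki : k ≠ i) (hji : j ≠ i) {p q : Realization K} {s : Finset V}
    (hs : s ∈ K.faces) (hp : p.weight.support ⊆ s) (hq : q.weight.support ⊆ s) {d : ℝ}
    (hd : 0 ≤ d) (h : edist p q = ENNReal.ofReal d) :
    (colourWeight col p k - colourWeight col q k) ^ 2 +
      (colourWeight col p j - colourWeight col q j) ^ 2 +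
      (colourWeight col p i - colourWeight col q i) ^ 2 = 2 * d ^ 2 := by
  rw [edist_eq hcol hkj hki hji hs hp hq, ENNReal.ofReal_eq_ofReal_iff (Real.sqrt_nonneg _) hd,
    Real.sqrt_eq_iff_mul_self_eq (by positivity) hd] at h
  linarith

/-- Plain folding lays two triangles with a common side on top of each other. Reflecting the vertex
`w` of one of them unfolds the pair into the plane, which gives a sharper lower bound for the
distance. -/
theorem colourWeight_sub_sq_le_of_reflect (hcol : IsColouring K col) {k j i : ZMod 3} (hkj : k ≠ j)
    (hki : k ≠ i) (hji : j ≠ i) {p q : Realization K} {w : V} (hw : col w = i) {d : ℝ} (hd : 0 ≤ d)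
    (h : edist p q ≤ ENNReal.ofReal d) :
    (colourWeight col p k + p.weight w - (colourWeight col q k + q.weight w)) ^ 2 +
      (colourWeight col p j + p.weight w - (colourWeight col q j + q.weight w)) ^ 2 +
      (colourWeight col p i - 2 * p.weight w - (colourWeight col q i - 2 * q.weight w)) ^ 2 ≤
      2 * d ^ 2 := by
  have := norm_bary_sub_sq_le (isRegular_foldAt hcol w) hd h
  rw [norm_sq_three hkj hki hji] at this
  simp only [PiLp.sub_apply, bary_foldAt, hw, if_neg hki, if_neg hji, if_true] at this
  linarith

end Colour

/-! ## Maps that scale the metric, along edges with at least three triangles -/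

section Local

variable {V V' : Type} {K : AbstractSimplicialComplex V} {K' : AbstractSimplicialComplex V'}
  {col : V → ZMod 3} {col' : V' → ZMod 3}

/-- Three vertices of different colours that span a triangle. -/
structure IsTriangle (K : AbstractSimplicialComplex V) (col : V → ZMod 3) (v₀ v₁ v₂ : V) : Prop where
  face : ∃ s ∈ K.faces, v₀ ∈ s ∧ v₁ ∈ s ∧ v₂ ∈ s
  ne₀₁ : col v₀ ≠ col v₁
  ne₀₂ : col v₀ ≠ col v₂
  ne₁₂ : col v₁ ≠ col v₂

/-- The point `p` has the barycentric coordinates `w₀, w₁, w₂` at `v₀, v₁, v₂`. -/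
def IsPoint (v₀ v₁ v₂ : V) (w₀ w₁ w₂ : ℝ) (p : Realization K) : Prop :=
  p.weight = Finsupp.single v₀ w₀ + Finsupp.single v₁ w₁ + Finsupp.single v₂ w₂

theorem IsPoint.support_subset {v₀ v₁ v₂ : V} {w₀ w₁ w₂ : ℝ} {p : Realization K}
    (hp : IsPoint v₀ v₁ v₂ w₀ w₁ w₂ p) {s : Finset V} (h₀ : v₀ ∈ s) (h₁ : v₁ ∈ s) (h₂ : v₂ ∈ s) :
    p.weight.support ⊆ s := by
  intro v hv
  by_contra hs
  rw [hp, Finsupp.mem_support_iff] at hv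
  have h : ∀ w ∈ s, w ≠ v := fun w hw h => hs (h ▸ hw)
  exact hv (by simp [h _ h₀, h _ h₁, h _ h₂])

theorem IsTriangle.exists_isPoint {v₀ v₁ v₂ : V} (h : IsTriangle K col v₀ v₁ v₂) {w₀ w₁ w₂ : ℝ}
    (h₀ : 0 ≤ w₀) (h₁ : 0 ≤ w₁) (h₂ : 0 ≤ w₂) (hw : w₀ + w₁ + w₂ = 1) :
    ∃ p : Realization K, IsPoint v₀ v₁ v₂ w₀ w₁ w₂ p := by
  classical
  obtain ⟨s, hs, hv₀, hv₁, hv₂⟩ := h.face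
  set w : V →₀ ℝ := Finsupp.single v₀ w₀ + Finsupp.single v₁ w₁ + Finsupp.single v₂ w₂ with hwdef
  have hsum : (w.sum fun _ t => t) = 1 := by
    rw [hwdef, Finsupp.sum_add_index' (by simp) (by simp), Finsupp.sum_add_index' (by simp) (by simp)]
    simpa using hw
  have hsub : w.support ⊆ s := by
    intro v hv
    by_contra hs
    rw [Finsupp.mem_support_iff] at hv
    have h : ∀ w ∈ s, w ≠ v := fun w hw h => hs (h ▸ hw)
    exact hv (by simp [w, h _ hv₀, h _ hv₁, h _ hv₂])
  have hne : w.support.Nonempty := by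
    rw [Finset.nonempty_iff_ne_empty]
    intro h0
    rw [Finsupp.sum, h0] at hsum
    simp at hsum
  refine ⟨⟨w, fun v => ?_, hsum, (K.isRelLowerSet_faces hs).2 hsub hne⟩, rfl⟩
  simp only [w, Finsupp.add_apply, Finsupp.single_apply]
  refine add_nonneg (add_nonneg ?_ ?_) ?_ <;> split_ifs <;> first | assumption | exact le_rfl

theorem IsPoint.colourWeight {v₀ v₁ v₂ : V} {w₀ w₁ w₂ : ℝ} {p : Realization K}
    (hp : IsPoint v₀ v₁ v₂ w₀ w₁ w₂ p) (h : IsTriangle K col v₀ v₁ v₂) :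
    colourWeight col p (col v₀) = w₀ ∧ colourWeight col p (col v₁) = w₁ ∧
      colourWeight col p (col v₂) = w₂ := by
  have h1 : bary (fold col) p = w₀ • fold col v₀ + w₁ • fold col v₁ + w₂ • fold col v₂ := by
    rw [bary, hp]
    simp
  simp [Realization.colourWeight, h1, fold, h.ne₀₁, h.ne₀₂, h.ne₁₂, h.ne₀₁.symm, h.ne₀₂.symm,
    h.ne₁₂.symm]

theorem IsPoint.edist_eq (hcol : IsColouring K col) {v₀ v₁ v₂ : V} {w₀ w₁ w₂ x₀ x₁ x₂ : ℝ}
    {p q : Realization K} (hp : IsPoint v₀ v₁ v₂ w₀ w₁ w₂ p) (hq : IsPoint v₀ v₁ v₂ x₀ x₁ x₂ q)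
    (h : IsTriangle K col v₀ v₁ v₂) {d : ℝ} (hd : 0 ≤ d)
    (hdist : (w₀ - x₀) ^ 2 + (w₁ - x₁) ^ 2 + (w₂ - x₂) ^ 2 = 2 * d ^ 2) :
    edist p q = ENNReal.ofReal d := by
  obtain ⟨s, hs, hv₀, hv₁, hv₂⟩ := h.face
  obtain ⟨h1, h2, h3⟩ := hp.colourWeight h
  obtain ⟨h4, h5, h6⟩ := hq.colourWeight h
  rw [Realization.edist_eq hcol h.ne₀₁ h.ne₀₂ h.ne₁₂ hs (hp.support_subset hv₀ hv₁ hv₂)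
    (hq.support_subset hv₀ hv₁ hv₂), h1, h2, h3, h4, h5, h6, hdist]
  congr 1
  rw [mul_div_cancel_left₀ _ two_ne_zero, Real.sqrt_sq hd]

theorem IsPoint.notMem_zeroSkeleton {v₀ v₁ v₂ : V} {w₀ w₁ w₂ : ℝ} {p : Realization K}
    (hcol : IsColouring K col) (hp : IsPoint v₀ v₁ v₂ w₀ w₁ w₂ p) (h : IsTriangle K col v₀ v₁ v₂)
    (hw : (w₀ ≠ 0 ∧ w₁ ≠ 0) ∨ (w₀ ≠ 0 ∧ w₂ ≠ 0)) : p ∉ zeroSkeleton K := by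
  rintro ⟨v, hv⟩
  obtain ⟨s, hs, hv₀, hv₁, hv₂⟩ := h.face
  have hsub := hp.support_subset hv₀ hv₁ hv₂
  obtain ⟨h1, h2, h3⟩ := hp.colourWeight h
  rw [colourWeight_of_mem hcol hs hsub hv₀, hv] at h1
  rw [colourWeight_of_mem hcol hs hsub hv₁, hv] at h2
  rw [colourWeight_of_mem hcol hs hsub hv₂, hv] at h3
  have hne₁ : v₀ ≠ v₁ := fun e => h.ne₀₁ (congrArg col e)
  have hne₂ : v₀ ≠ v₂ := fun e => h.ne₀₂ (congrArg col e)
  have e : ∀ {x : V} {t : ℝ}, Finsupp.single v (1 : ℝ) x = t → t ≠ 0 → v = x := by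
    intro x t hx ht
    by_contra hne
    exact ht (hx.symm.trans (Finsupp.single_eq_of_ne' hne))
  rcases hw with ⟨ha, hb⟩ | ⟨ha, hb⟩
  · exact hne₁ ((e h1 ha).symm.trans (e h2 hb))
  · exact hne₂ ((e h1 ha).symm.trans (e h3 hb))

/-- Near the point `p`, the map `f` scales distances by the factor `c`. -/
def ScaledAt (f : Realization K → Realization K') (c : ℝ) (p : Realization K) : Prop :=
  ∃ ε > 0, ∀ q r : Realization K, ∀ a b d : ℝ, a < ε → b < ε → 0 ≤ d → edist p q = ENNReal.ofReal a →
    edist p r = ENNReal.ofReal b → edist q r = ENNReal.ofReal d →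
    edist (f q) (f r) = ENNReal.ofReal (c * d)

theorem scaledAt_of_nhds {f : Realization K → Realization K'} {c : ℝ≥0} {p : Realization K}
    (h : ∃ U ∈ 𝓝 p, ∀ q ∈ U, ∀ r ∈ U, edist (f q) (f r) = c * edist q r) : ScaledAt f c p := by
  obtain ⟨U, hU, h⟩ := h
  obtain ⟨ε, hε, hεU⟩ := EMetric.mem_nhds_iff.mp hU
  obtain ⟨δ, hδ, hδε⟩ : ∃ δ : ℝ, 0 < δ ∧ ENNReal.ofReal δ ≤ ε := by
    by_cases htop : ε = ⊤
    · exact ⟨1, one_pos, by simp [htop]⟩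
    · exact ⟨ε.toReal, ENNReal.toReal_pos hε.ne' htop, by rw [ENNReal.ofReal_toReal htop]⟩
  refine ⟨δ, hδ, fun q r a b d ha hb hd hq hr hqr => ?_⟩
  have hmem : ∀ q a, a < δ → edist p q = ENNReal.ofReal a → q ∈ U := by
    intro q a ha hq
    apply hεU
    rw [Metric.mem_eball, edist_comm, hq]
    exact ((ENNReal.ofReal_lt_ofReal_iff hδ).mpr ha).trans_le hδε
  rw [h q (hmem q a ha hq) r (hmem r b hb hr), hqr, ENNReal.ofReal_mul c.coe_nonneg]
  simp

/-- By the parallelogram law the sum of the two vectors has norm zero. -/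
theorem add_eq_zero_of_antipodal {x y z x' y' z' N : ℝ} (h : x ^ 2 + y ^ 2 + z ^ 2 = N)
    (h' : x' ^ 2 + y' ^ 2 + z' ^ 2 = N)
    (hd : (x - x') ^ 2 + (y - y') ^ 2 + (z - z') ^ 2 = 4 * N) :
    x + x' = 0 ∧ y + y' = 0 ∧ z + z' = 0 := by
  have : (x + x') ^ 2 + (y + y') ^ 2 + (z + z') ^ 2 = 0 := by nlinarith
  refine ⟨?_, ?_, ?_⟩ <;> apply pow_eq_zero_iff two_ne_zero |>.mp <;>
    nlinarith [sq_nonneg (x + x'), sq_nonneg (y + y'), sq_nonneg (z + z')]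

/-- In an open triangle there is no room for three half-discs with a common diameter. -/
theorem exists_colourWeight_eq_zero (hcol : IsColouring K col) (hcol' : IsColouring K' col')
    {f : Realization K → Realization K'} {c : ℝ} (hc : 0 < c) {v₀ v₁ : V} {u : Fin 3 → V}
    (hu : Function.Injective u) (htri : ∀ i, IsTriangle K col v₀ v₁ (u i)) {t : ℝ} (h0 : 0 < t)
    (h1 : t < 1) {x : Realization K} (hx : ∀ i, IsPoint v₀ v₁ (u i) (1 - t) t 0 x)
    (hf : ScaledAt f c x) : ∃ l, colourWeight col' (f x) l = 0 := by
  by_contra! hne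
  obtain ⟨ε, hε, hf⟩ := hf
  have hpos : ∀ l, 0 < colourWeight col' (f x) l := fun l =>
    lt_of_le_of_ne (colourWeight_nonneg _ _) (hne l).symm
  choose w hws hwl using fun l => exists_of_colourWeight_ne_zero (hne l)
  have hww : ∀ l, colourWeight col' (f x) l = (f x).weight (w l) := fun l => by
    rw [← colourWeight_of_mem hcol' (f x).support_mem subset_rfl (hws l), hwl]
  obtain ⟨m, hm, hml⟩ : ∃ m > 0, ∀ l, m ≤ (f x).weight (w l) := by
    refine ⟨min (colourWeight col' (f x) 0) (min (colourWeight col' (f x) 1)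
      (colourWeight col' (f x) 2)), by simp [hpos], fun l => ?_⟩
    rw [← hww]
    have : ∀ l : ZMod 3, l = 0 ∨ l = 1 ∨ l = 2 := by decide
    rcases this l with rfl | rfl | rfl <;> simp
  -- The first two bounds keep the points `r i` below inside their triangles, the third puts them
  -- within `ε` of `x` because `√3 ≤ 2`, and the last keeps their images inside the open triangle
  -- around `f x`.
  obtain ⟨τ, hτ, hτm⟩ := exists_between (show 0 < min (min (t / 2) ((1 - t) / 2))
    (min (ε / 2) (m / (4 * c))) from lt_min (lt_min (by linarith) (by linarith))
      (lt_min (by linarith) (by positivity)))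
  simp only [lt_min_iff] at hτm
  obtain ⟨⟨hτ1, hτ2⟩, hτ3, hτ4⟩ := hτm
  rw [lt_div_iff₀ (by positivity)] at hτ4
  have hs3 : √3 ^ 2 = 3 := Real.sq_sqrt (by norm_num)
  have hs0 : 0 ≤ √3 := Real.sqrt_nonneg 3
  have hs2 : √3 ≤ 2 := by nlinarith
  -- The displacement `(-τ, -τ, 2τ)` from `x` is perpendicular to the edge and has length `√3 τ`.
  choose r hr using fun i => (htri i).exists_isPoint (show 0 ≤ 1 - t - τ by linarith)
    (show 0 ≤ t - τ by linarith) (show 0 ≤ 2 * τ by linarith) (by ring)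
  have hxr : ∀ i, edist x (r i) = ENNReal.ofReal (√3 * τ) := fun i =>
    (hx i).edist_eq hcol (hr i) (htri i) (by positivity) (by rw [mul_pow, hs3]; ring)
  have hcu : ∀ i, col (u i) = col (u 0) := by
    have : ∀ a b d e : ZMod 3, a ≠ b → a ≠ d → b ≠ d → a ≠ e → b ≠ e → d = e := by decide
    exact fun i => this _ _ _ _ (htri i).ne₀₁ (htri i).ne₀₂ (htri i).ne₁₂ (htri 0).ne₀₂ (htri 0).ne₁₂
  -- The path through `x` gives the upper bound. For the lower bound, unfold the two triangles along
  -- the edge; then the two points are mirror images.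
  have hrr : ∀ i j, i ≠ j → edist (r i) (r j) = ENNReal.ofReal (2 * (√3 * τ)) := by
    intro i j hij
    have hle : edist (r i) (r j) ≤ ENNReal.ofReal (2 * (√3 * τ)) := by
      refine (edist_triangle_left _ _ x).trans_eq ?_
      rw [hxr, hxr, ← ENNReal.ofReal_add (by positivity) (by positivity), two_mul]
    refine le_antisymm hle ?_
    have hfin : edist (r i) (r j) ≠ ⊤ := ne_top_of_le_ne_top ENNReal.ofReal_ne_top hle
    have hd := colourWeight_sub_sq_le_of_reflect hcol (htri 0).ne₀₁ (htri 0).ne₀₂ (htri 0).ne₁₂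
      (p := r i) (q := r j) (hcu j) (d := (edist (r i) (r j)).toReal) ENNReal.toReal_nonneg
      (by rw [ENNReal.ofReal_toReal hfin])
    obtain ⟨hi1, hi2, hi3⟩ := (hr i).colourWeight (htri i)
    obtain ⟨hj1, hj2, hj3⟩ := (hr j).colourWeight (htri j)
    have hwi : (r i).weight (u j) = 0 := by
      rw [hr i]
      have e1 : v₀ ≠ u j := fun e => (htri j).ne₀₂ (congrArg col e)
      have e2 : v₁ ≠ u j := fun e => (htri j).ne₁₂ (congrArg col e)
      have e3 : u i ≠ u j := fun e => hij (hu e)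
      simp [e1, e2, e3]
    have hwj : (r j).weight (u j) = 2 * τ := by
      rw [hr j]
      have e1 : v₀ ≠ u j := fun e => (htri j).ne₀₂ (congrArg col e)
      have e2 : v₁ ≠ u j := fun e => (htri j).ne₁₂ (congrArg col e)
      simp [e1, e2]
    rw [hcu] at hi3 hj3
    rw [hi1, hi2, hi3, hj1, hj2, hj3, hwi, hwj] at hd
    rw [← ENNReal.ofReal_toReal hfin]
    apply ENNReal.ofReal_le_ofReal
    apply abs_le_of_sq_le_sq' _ ENNReal.toReal_nonneg |>.2
    rw [mul_pow, mul_pow, hs3]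
    nlinarith
  have hxε : √3 * τ < ε := by nlinarith
  have hxx : edist x x = ENNReal.ofReal 0 := by simp
  have hfx : ∀ i, edist (f x) (f (r i)) = ENNReal.ofReal (c * (√3 * τ)) := fun i =>
    hf x (r i) 0 _ _ hε hxε (by positivity) hxx (hxr i) (hxr i)
  have hfr : ∀ i j, i ≠ j → edist (f (r i)) (f (r j)) = ENNReal.ofReal (c * (2 * (√3 * τ))) :=
    fun i j hij => hf _ _ _ _ _ hxε hxε (by positivity) (hxr i) (hxr j) (hrr i j hij)
  -- A coordinate changes by at most `4cτ < m`, so the three vertices around `f x` keep positive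
  -- weight, and their colours leave no room for a fourth vertex.
  have hsub : ∀ i, (f (r i)).weight.support ⊆ (f x).weight.support := by
    intro i v hv
    have hmem : w (col' v) ∈ (f (r i)).weight.support := by
      rw [Finsupp.mem_support_iff]
      have := abs_weight_sub_le (by positivity) (hfx i).le (w (col' v))
      have h2 := hml (col' v)
      have h3 : √3 * (c * τ) ≤ 2 * (c * τ) := by gcongr
      intro h0
      rw [h0, sub_zero, abs_of_pos (by linarith)] at this
      nlinarith
    rw [hcol' _ (f (r i)).support_mem hv hmem (hwl _).symm]
    exact hws _
  have e01 : (0 : ZMod 3) ≠ 1 := by decide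
  have e02 : (0 : ZMod 3) ≠ 2 := by decide
  have e12 : (1 : ZMod 3) ≠ 2 := by decide
  have hN : ∀ i, _ := fun i => colourWeight_sub_sq_eq hcol' e01 e02 e12 (f x).support_mem (hsub i)
    subset_rfl (by positivity) ((edist_comm _ _).trans (hfx i))
  have hM : ∀ i j, i ≠ j → _ := fun i j hij => colourWeight_sub_sq_eq hcol' e01 e02 e12
    (f x).support_mem (hsub i) (hsub j) (by positivity) (hfr i j hij)
  -- The three image points are pairwise antipodal on a circle around `f x`. Three vectors with
  -- vanishing pairwise sums are all zero, but the radius is positive.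
  have key : ∀ i j, i ≠ j → _ := fun i j hij =>
    add_eq_zero_of_antipodal (hN i) (hN j) (by linear_combination hM i j hij)
  obtain ⟨a1, a2, a3⟩ := key 0 1 (by decide)
  obtain ⟨b1, b2, b3⟩ := key 0 2 (by decide)
  obtain ⟨c1, c2, c3⟩ := key 1 2 (by decide)
  have hlast := hN 0
  rw [show colourWeight col' (f (r 0)) 0 - colourWeight col' (f x) 0 = 0 by linarith,
    show colourWeight col' (f (r 0)) 1 - colourWeight col' (f x) 1 = 0 by linarith,
    show colourWeight col' (f (r 0)) 2 - colourWeight col' (f x) 2 = 0 by linarith] at hlast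
  have : 0 < (c * (√3 * τ)) ^ 2 := by
    have : 0 < √3 := Real.sqrt_pos.mpr (by norm_num)
    positivity
  linarith

/-- The distance from a vertex. -/
theorem support_of_edist_vertex {p : Realization K} {q : V} (hp : p.weight = Finsupp.single q 1)
    {u : Realization K} {ρ : ℝ} (hρ0 : 0 ≤ ρ) (hρ : ρ < 1 / 2) (h : edist p u = ENNReal.ofReal ρ) :
    q ∈ u.weight.support := by
  have := abs_weight_sub_le hρ0 h.le q
  rw [hp, Finsupp.single_eq_same] at this
  rw [Finsupp.mem_support_iff]
  intro h0
  rw [h0, sub_zero, abs_one] at this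
  linarith

theorem colourWeight_vertex {p : Realization K} {q : V}
    (hp : p.weight = Finsupp.single q 1) {j : ZMod 3} :
    colourWeight col p j = if col q = j then 1 else 0 := by
  rw [colourWeight_eq, hp, Finsupp.support_single (hb := one_ne_zero)]
  simp

/-- The law of cosines in the coordinates along the two sides at `q`, which enclose the angle π/3.
The bound on `ρ` keeps `u` in the open star of `q`. -/
theorem colourWeight_of_edist_vertex (hcol : IsColouring K col) {p : Realization K} {q : V}
    (hp : p.weight = Finsupp.single q 1) {j i : ZMod 3} (hqj : col q ≠ j) (hqi : col q ≠ i)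
    (hji : j ≠ i) {u : Realization K} {ρ : ℝ} (hρ0 : 0 ≤ ρ) (hρ : ρ < 1 / 2)
    (h : edist p u = ENNReal.ofReal ρ) :
    colourWeight col u j ^ 2 + colourWeight col u j * colourWeight col u i +
      colourWeight col u i ^ 2 = ρ ^ 2 := by
  have hq := support_of_edist_vertex hp hρ0 hρ h
  have hsub : p.weight.support ⊆ u.weight.support := by
    rw [hp, Finsupp.support_single (hb := one_ne_zero)]
    simpa using hq
  have := colourWeight_sub_sq_eq hcol hqj hqi hji u.support_mem hsub subset_rfl hρ0 h
  have hs := sum_colourWeight hqj hqi hji u (col := col)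
  simp only [colourWeight_vertex hp, if_true, if_neg hqj, if_neg hqi] at this
  rw [show colourWeight col u (col q) = 1 - colourWeight col u j - colourWeight col u i by linarith]
    at this
  linarith

/-- In the star of a vertex, a turn by a sixth of a full turn exchanges the other two colours. -/
theorem colourWeight_turn (hcol : IsColouring K col) {p : Realization K} {q : V}
    (hp : p.weight = Finsupp.single q 1) {j i : ZMod 3} (hqj : col q ≠ j) (hqi : col q ≠ i)
    (hji : j ≠ i) {u v : Realization K} {ρ : ℝ} (hρ0 : 0 < ρ) (hρ : ρ < 1 / 2)
    (hu : edist p u = ENNReal.ofReal ρ) (hv : edist p v = ENNReal.ofReal ρ)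
    (huv : edist u v = ENNReal.ofReal ρ) (hui : colourWeight col u i = 0) :
    colourWeight col v j = 0 := by
  have h1 := colourWeight_of_edist_vertex hcol hp hqj hqi hji hρ0.le hρ hu
  have h2 := colourWeight_of_edist_vertex hcol hp hqj hqi hji hρ0.le hρ hv
  have hj0 := colourWeight_nonneg u j (col := col)
  have hvj0 := colourWeight_nonneg v j (col := col)
  have hvi0 := colourWeight_nonneg v i (col := col)
  have huj : colourWeight col u j = ρ := by
    rw [hui] at h1
    exact (pow_left_inj₀ hj0 hρ0.le two_ne_zero).mp (by linarith)
  have hus := sum_colourWeight hqj hqi hji u (col := col)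
  have hvs := sum_colourWeight hqj hqi hji v (col := col)
  obtain ⟨w, hwu, rfl⟩ := exists_of_colourWeight_ne_zero (huj.trans_ne hρ0.ne')
  have hww := (colourWeight_of_mem hcol u.support_mem subset_rfl hwu).symm.trans huj
  set α := colourWeight col v (col w)
  set β := colourWeight col v i
  -- If `w` supports `v`, then `q`, `u`, `v` form an equilateral triangle inside one simplex, so `v`
  -- lies on the other side at `q`. If not, reflect `w` in the side of colours `col q` and `i`: the
  -- unfolded angle between `u` and `v` is at least π/3, with equality only if `v` lies on that
  -- side. Either way `α = 0`.
  by_cases hwv : w ∈ v.weight.support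
  · have hsub : u.weight.support ⊆ v.weight.support := by
      intro z hz
      have hcz : col z ≠ i := by
        rintro rfl
        exact Finsupp.mem_support_iff.mp hz (weight_eq_zero_of_colourWeight hui)
      have : ∀ a b d e : ZMod 3, a ≠ b → a ≠ d → b ≠ d → e ≠ d → e = a ∨ e = b := by decide
      rcases this _ _ _ _ hqj hqi hji hcz with h | h
      · rw [hcol _ u.support_mem hz (support_of_edist_vertex hp hρ0.le hρ hu) h]
        exact support_of_edist_vertex hp hρ0.le hρ hv
      · rwa [hcol _ u.support_mem hz hwu h]
    have h3 := colourWeight_sub_sq_eq hcol hqj hqi hji v.support_mem hsub subset_rfl hρ0.le huv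
    rw [hui, huj, show colourWeight col u (col q) = 1 - ρ by linarith,
      show colourWeight col v (col q) = 1 - α - β by linarith] at h3
    change (1 - ρ - (1 - α - β)) ^ 2 + (ρ - α) ^ 2 + (0 - β) ^ 2 = _ at h3
    have h4 : ρ * (2 * α + β) = ρ * ρ := by nlinarith
    have h5 : 2 * α + β = ρ := mul_left_cancel₀ hρ0.ne' h4
    have h6 : 3 * (α * (α + β)) = 0 := by rw [← h5] at h2; nlinarith
    nlinarith
  · have h3 := colourWeight_sub_sq_le_of_reflect hcol hqi hqj hji.symm (w := w) rfl hρ0.le huv.le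
    rw [hui, huj, hww, Finsupp.notMem_support_iff.mp hwv,
      show colourWeight col u (col q) = 1 - ρ by linarith,
      show colourWeight col v (col q) = 1 - α - β by linarith] at h3
    change (1 - ρ + ρ - (1 - α - β + 0)) ^ 2 + (0 + ρ - (β + 0)) ^ 2 +
      (ρ - 2 * ρ - (α - 2 * 0)) ^ 2 ≤ _ at h3
    have h4 : 0 ≤ ρ * (β - α - ρ) := by nlinarith
    have h5 : 0 ≤ β - α - ρ := nonneg_of_mul_nonneg_right h4 hρ0
    nlinarith

end Local

end Realization

/-! ## The boundary of a coloured triangle -/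

/-- The barycentric coordinates of the point that moves around a triangle with unit speed, visiting
the vertices `0`, `1`, `2` periodically. -/
noncomputable def wave (x : ℝ) (l : ZMod 3) : ℝ :=
  max 0 (1 - ‖((x - (l.val : ℝ) : ℝ) : AddCircle (3 : ℝ))‖)

theorem continuous_wave (l : ZMod 3) : Continuous fun x => wave x l := by
  have : Continuous fun x : ℝ => (x : AddCircle (3 : ℝ)) := continuous_quotient_mk'
  unfold wave
  fun_prop

theorem wave_congr {x y : ℝ} (h : (x : AddCircle (3 : ℝ)) = y) : wave x = wave y := by
  ext l
  simp only [wave, AddCircle.coe_sub, h]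

theorem wave_intCast (x : ℝ) (n : ℤ) :
    wave x (n : ZMod 3) = max 0 (1 - ‖((x - n : ℝ) : AddCircle (3 : ℝ))‖) := by
  obtain ⟨m, hm⟩ : ∃ m : ℤ, (((n : ZMod 3).val : ℤ) : ℝ) = n - 3 * m := by
    refine ⟨n / 3, ?_⟩
    rw [ZMod.val_intCast]
    push_cast [Int.emod_def]
    ring
  have : ((x - ((n : ZMod 3).val : ℝ) : ℝ) : AddCircle (3 : ℝ)) = ((x - n : ℝ) : AddCircle (3 : ℝ)) := by
    rw [← sub_eq_zero, ← AddCircle.coe_sub, AddCircle.coe_eq_zero_iff]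
    refine ⟨m, ?_⟩
    rw [Int.cast_natCast] at hm
    rw [hm]
    simp [mul_comm]
  rw [wave, this]

theorem wave_add_one (x : ℝ) (l : ZMod 3) : wave (x + 1) (l + 1) = wave x l := by
  have h1 : l = ((l.val : ℤ) : ZMod 3) := by simp
  have h2 : l + 1 = ((l.val + 1 : ℤ) : ZMod 3) := by simp
  conv_rhs => rw [h1]
  rw [h2, wave_intCast, wave_intCast]
  simp

theorem wave_int_add (n : ℤ) {r : ℝ} (h0 : 0 ≤ r) (h1 : r ≤ 1) :
    wave (n + r) n = 1 - r ∧ wave (n + r) (n + 1) = r ∧ wave (n + r) (n + 2) = 0 := by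
  have hN : ∀ y : ℝ, |y| ≤ 3 / 2 → ‖(y : AddCircle (3 : ℝ))‖ = |y| := fun y hy =>
    (AddCircle.norm_coe_eq_abs_iff _ three_ne_zero).mpr (by simpa using hy)
  refine ⟨?_, ?_, ?_⟩
  · rw [wave_intCast, add_sub_cancel_left, hN r (by rw [abs_of_nonneg h0]; linarith),
      abs_of_nonneg h0, max_eq_right (by linarith)]
  · have e : (n : ZMod 3) + 1 = ((n + 1 : ℤ) : ZMod 3) := by simp
    have h : |r - 1| = 1 - r := by rw [abs_of_nonpos (by linarith)]; ring
    rw [e, wave_intCast, show (n : ℝ) + r - (n + 1 : ℤ) = r - 1 by push_cast; ring,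
      hN _ (by rw [h]; linarith), h, max_eq_right (by linarith)]
    ring
  · have e : (n : ZMod 3) + 2 = ((n + 2 : ℤ) : ZMod 3) := by simp
    rw [e, wave_intCast, show (n : ℝ) + r - (n + 2 : ℤ) = r - 2 by push_cast; ring]
    apply max_eq_left
    -- The norm on the circle is the absolute value only up to 3/2, so for small `r` the
    -- representative `r - 2` is replaced by `r + 1`.
    rcases le_total r (1 / 2) with h | h
    · have e : ((r - 2 : ℝ) : AddCircle (3 : ℝ)) = ((r + 1 : ℝ) : AddCircle (3 : ℝ)) := by
        rw [← sub_eq_zero, ← AddCircle.coe_sub, AddCircle.coe_eq_zero_iff]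
        exact ⟨-1, by rw [neg_smul, one_smul]; ring⟩
      rw [e, hN _ (by rw [abs_of_nonneg] <;> linarith), abs_of_nonneg] <;> linarith
    · rw [hN _ (by rw [abs_of_nonpos] <;> linarith), abs_of_nonpos] <;> linarith

/-- A point on the boundary of a triangle is determined by its barycentric coordinates. If the
integer parts differed modulo 3, one of the fractional parts would have to be 1. -/
theorem coe_eq_of_wave_eq {x y : ℝ} (h : wave x = wave y) : (x : AddCircle (3 : ℝ)) = y := by
  obtain ⟨a1, a2, a3⟩ := wave_int_add ⌊x⌋ (Int.fract_nonneg x) (Int.fract_lt_one x).le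
  obtain ⟨b1, b2, b3⟩ := wave_int_add ⌊y⌋ (Int.fract_nonneg y) (Int.fract_lt_one y).le
  rw [Int.floor_add_fract, h] at a1 a2 a3
  rw [Int.floor_add_fract] at b1 b2 b3
  have hx := Int.fract_lt_one x
  have hy := Int.fract_lt_one y
  have : ∀ a b : ZMod 3, a = b ∨ a = b + 1 ∨ a = b + 2 := by decide
  rcases this (⌊x⌋ : ZMod 3) (⌊y⌋ : ZMod 3) with e | e | e
  · rw [e, b1] at a1
    have e' : ((⌊x⌋ - ⌊y⌋ : ℤ) : ZMod 3) = 0 := by rw [Int.cast_sub, e, sub_self]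
    obtain ⟨m, hm⟩ := (ZMod.intCast_zmod_eq_zero_iff_dvd _ 3).mp e'
    rw [← sub_eq_zero, ← AddCircle.coe_sub, AddCircle.coe_eq_zero_iff]
    refine ⟨m, ?_⟩
    have hm' : (⌊x⌋ : ℝ) - ⌊y⌋ = 3 * m := by exact_mod_cast hm
    rw [zsmul_eq_mul, ← Int.floor_add_fract x, ← Int.floor_add_fract y]
    linarith
  · rw [e, b2] at a1
    rw [e, add_assoc, one_add_one_eq_two, b3] at a2
    linarith
  · rw [e, b3] at a1
    linarith

/-- A map of an interval that locally goes around the triangle with constant speed does so globally. -/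
theorem exists_eq_wave {c : ℝ} (hc : 0 < c) {Q : ℝ → ZMod 3 → ℝ}
    (h : ∀ t₀ ∈ Set.Ioo (0 : ℝ) 1, ∃ σ : ℝ, (σ = 1 ∨ σ = -1) ∧ ∃ θ : ℝ, ∃ ε > 0,
      ∀ t ∈ Set.Ioo (0 : ℝ) 1, |t - t₀| < ε → Q t = wave (θ + σ * c * t)) :
    ∃ σ : ℝ, (σ = 1 ∨ σ = -1) ∧ ∃ θ : ℝ, ∀ t ∈ Set.Ioo (0 : ℝ) 1, Q t = wave (θ + σ * c * t) := by
  let O : ℝ → Set ℝ := fun σ => {t₀ | ∃ θ : ℝ, ∃ ε > 0,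
      ∀ t ∈ Set.Ioo (0 : ℝ) 1, |t - t₀| < ε → Q t = wave (θ + σ * c * t)}
  have hO : ∀ σ, IsOpen (O σ) := by
    intro σ
    rw [Metric.isOpen_iff]
    rintro t₀ ⟨θ, ε, hε, h⟩
    refine ⟨ε / 2, by positivity, fun t₁ ht₁ => ⟨θ, ε / 2, by positivity, fun t ht htt => ?_⟩⟩
    rw [Metric.mem_ball, Real.dist_eq] at ht₁
    exact h t ht (by linarith [abs_sub_le t t₁ t₀])
  have hcover : Set.Ioo (0 : ℝ) 1 ⊆ O 1 ∪ O (-1) := by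
    intro t₀ ht₀
    obtain ⟨σ, rfl | rfl, h⟩ := h t₀ ht₀
    exacts [Or.inl h, Or.inr h]
  -- If both directions occurred near `t₀`, then `θ + ct` and `θ' - ct` would agree modulo 3 at `t₀`
  -- and at `t₀ + s`, so `2cs` would be a multiple of 3; but `s < 1/c` gives `0 < 2cs < 3`.
  have hdisj : Set.Ioo (0 : ℝ) 1 ∩ (O 1 ∩ O (-1)) = ∅ := by
    rw [Set.eq_empty_iff_forall_notMem]
    rintro t₀ ⟨ht₀, ⟨θ, ε, hε, h⟩, θ', ε', hε', h'⟩
    obtain ⟨s, hs, hsm⟩ := exists_between (show 0 < min (min ε ε') (min (1 - t₀) (1 / c)) from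
      lt_min (lt_min hε hε') (lt_min (by linarith [ht₀.2]) (by positivity)))
    simp only [lt_min_iff] at hsm
    obtain ⟨⟨hs1, hs2⟩, hs3, hs4⟩ := hsm
    rw [lt_div_iff₀ hc] at hs4
    have key : ∀ t ∈ Set.Ioo (0 : ℝ) 1, |t - t₀| < ε → |t - t₀| < ε' →
        ∃ m : ℤ, m • (3 : ℝ) = θ + 1 * c * t - (θ' + -1 * c * t) := fun t ht h1 h2 => by
      rw [← AddCircle.coe_eq_zero_iff, AddCircle.coe_sub, sub_eq_zero]
      exact coe_eq_of_wave_eq ((h t ht h1).symm.trans (h' t ht h2))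
    obtain ⟨m, hm⟩ := key t₀ ht₀ (by simpa using hε) (by simpa using hε')
    obtain ⟨m', hm'⟩ := key (t₀ + s) ⟨by linarith [ht₀.1], by linarith⟩
      (by rwa [add_sub_cancel_left, abs_of_pos hs]) (by rwa [add_sub_cancel_left, abs_of_pos hs])
    rw [zsmul_eq_mul] at hm hm'
    have e : ((m' - m : ℤ) : ℝ) * 3 = 2 * (s * c) := by push_cast; linarith
    have h1 : (0 : ℝ) < ((m' - m : ℤ) : ℝ) := by nlinarith [mul_pos hs hc]
    have h2 : ((m' - m : ℤ) : ℝ) < 1 := by linarith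
    have h3 : 0 < m' - m := by exact_mod_cast h1
    have h4 : m' - m < 1 := by exact_mod_cast h2
    omega
  have main : ∀ σ, Set.Ioo (0 : ℝ) 1 ⊆ O σ →
      ∃ θ : ℝ, ∀ t ∈ Set.Ioo (0 : ℝ) 1, Q t = wave (θ + σ * c * t) := by
    intro σ hσ
    have hx : ∀ t : Set.Ioo (0 : ℝ) 1, ∃ x : ℝ, Q t = wave x := fun t => by
      obtain ⟨θ, ε, hε, h⟩ := hσ t.2
      exact ⟨_, h t t.2 (by simpa using hε)⟩
    choose x hx using hx
    -- The phase makes sense only modulo 3. As an element of the circle it is locally constant,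
    -- hence constant on the interval.
    have hloc : IsLocallyConstant fun t : Set.Ioo (0 : ℝ) 1 =>
        ((x t - σ * c * t : ℝ) : AddCircle (3 : ℝ)) := by
      rw [IsLocallyConstant.iff_eventually_eq]
      intro t₀
      obtain ⟨θ, ε, hε, h⟩ := hσ t₀.2
      have hθ : ∀ t : Set.Ioo (0 : ℝ) 1, |(t : ℝ) - t₀| < ε →
          ((x t - σ * c * t : ℝ) : AddCircle (3 : ℝ)) = θ := fun t ht => by
        rw [AddCircle.coe_sub, coe_eq_of_wave_eq ((hx t).symm.trans (h t t.2 ht)),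
          ← AddCircle.coe_sub, add_sub_cancel_right]
      filter_upwards [Metric.ball_mem_nhds t₀ hε] with t ht
      rw [hθ t ht, hθ t₀ (by simpa using hε)]
    have : PreconnectedSpace (Set.Ioo (0 : ℝ) 1) :=
      Subtype.preconnectedSpace isPreconnected_Ioo
    let t₁ : Set.Ioo (0 : ℝ) 1 := ⟨1 / 2, by norm_num, by norm_num⟩
    refine ⟨x t₁ - σ * c * t₁, fun t ht => ?_⟩
    have e := hloc.apply_eq_of_preconnectedSpace ⟨t, ht⟩ t₁
    rw [hx ⟨t, ht⟩]
    apply wave_congr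
    rw [AddCircle.coe_add, ← e, ← AddCircle.coe_add, sub_add_cancel]
  rcases isPreconnected_iff_subset_of_disjoint.mp isPreconnected_Ioo _ _ (hO 1) (hO (-1)) hcover hdisj
    with h | h
  exacts [⟨1, Or.inl rfl, main 1 h⟩, ⟨-1, Or.inr rfl, main (-1) h⟩]

/-- A map between intervals that scales distances is affine. -/
theorem exists_eq_affine {c t₀ ε : ℝ} (hc : 0 < c) (hε : 0 < ε) {g : ℝ → ℝ}
    (h : ∀ t t', |t - t₀| < ε → |t' - t₀| < ε → (g t - g t') ^ 2 = (c * (t - t')) ^ 2) :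
    ∃ σ : ℝ, (σ = 1 ∨ σ = -1) ∧ ∀ t, |t - t₀| < ε → g t = g t₀ + σ * c * (t - t₀) := by
  have h0 : |t₀ - t₀| < ε := by simpa using hε
  have h1 : |t₀ + ε / 2 - t₀| < ε := by
    rw [add_sub_cancel_left, abs_of_pos] <;> linarith
  obtain ⟨σ, hσ, hg⟩ : ∃ σ : ℝ, (σ = 1 ∨ σ = -1) ∧ g (t₀ + ε / 2) - g t₀ = σ * (c * (ε / 2)) := by
    have := h _ _ h1 h0
    rw [add_sub_cancel_left] at this
    rcases sq_eq_sq_iff_eq_or_eq_neg.mp this with e | e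
    · exact ⟨1, Or.inl rfl, by linarith⟩
    · exact ⟨-1, Or.inr rfl, by linarith⟩
  refine ⟨σ, hσ, fun t ht => ?_⟩
  have e1 := h t t₀ ht h0
  have e2 := h t (t₀ + ε / 2) ht h1
  have hσ2 : σ * σ = 1 := by rcases hσ with rfl | rfl <;> norm_num
  rw [show g (t₀ + ε / 2) = g t₀ + σ * (c * (ε / 2)) by linarith] at e2
  have hB : 0 < c * ε := by positivity
  -- The squared distances to two reference points have a difference that is linear in `g t`; this
  -- fixes the sign that one distance leaves open.
  have e3 : (c * ε) * (σ * (g t - g t₀)) = (c * ε) * (c * (t - t₀)) := by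
    linear_combination e1 - e2 + (c * (ε / 2)) ^ 2 * hσ2
  have e4 := mul_left_cancel₀ hB.ne' e3
  linear_combination σ * e4 - (g t - g t₀) * hσ2

namespace Realization

/-! ### Images of edges that lie in at least three triangles. -/

section Edge

variable {V V' : Type} {K : AbstractSimplicialComplex V} {K' : AbstractSimplicialComplex V'}
  {col : V → ZMod 3} {col' : V' → ZMod 3}

/-- The path `γ` runs along the edge from `v₀` to `v₁` with unit speed. -/
def IsEdgePath (v₀ v₁ : V) (γ : ℝ → Realization K) : Prop :=
  ∀ t ∈ Set.Icc (0 : ℝ) 1, (γ t).weight = Finsupp.single v₀ (1 - t) + Finsupp.single v₁ t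

theorem IsEdgePath.isPoint {v₀ v₁ : V} {γ : ℝ → Realization K} (h : IsEdgePath v₀ v₁ γ) (v₂ : V)
    {t : ℝ} (ht : t ∈ Set.Icc (0 : ℝ) 1) : IsPoint v₀ v₁ v₂ (1 - t) t 0 (γ t) := by
  rw [IsPoint, h t ht, Finsupp.single_zero, add_zero]

theorem IsTriangle.exists_isEdgePath {v₀ v₁ v₂ : V} (h : IsTriangle K col v₀ v₁ v₂) :
    ∃ γ : ℝ → Realization K, IsEdgePath v₀ v₁ γ := by
  have : ∀ t : ℝ, ∃ p : Realization K, t ∈ Set.Icc (0 : ℝ) 1 →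
      p.weight = Finsupp.single v₀ (1 - t) + Finsupp.single v₁ t := by
    intro t
    by_cases ht : t ∈ Set.Icc (0 : ℝ) 1
    · obtain ⟨p, hp⟩ := h.exists_isPoint (sub_nonneg.mpr ht.2) ht.1 le_rfl (by ring)
      exact ⟨p, fun _ => by rw [hp, Finsupp.single_zero, add_zero]⟩
    · obtain ⟨p, -⟩ := h.exists_isPoint zero_le_one le_rfl le_rfl (by ring)
      exact ⟨p, fun h => absurd h ht⟩
  choose γ hγ using this
  exact ⟨γ, hγ⟩

/-- There are at least three triangles with the edge from `v₀` to `v₁`. -/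
def IsBranchEdge (K : AbstractSimplicialComplex V) (col : V → ZMod 3) (v₀ v₁ : V) : Prop :=
  ∃ u : Fin 3 → V, Function.Injective u ∧ ∀ i, IsTriangle K col v₀ v₁ (u i)

theorem exists_vertex_of_colourWeight (hcol : IsColouring K col) {k j i : ZMod 3} (hkj : k ≠ j)
    (hki : k ≠ i) (hji : j ≠ i) {p : Realization K} (hj : colourWeight col p j = 0)
    (hi : colourWeight col p i = 0) : ∃ q, col q = k ∧ p.weight = Finsupp.single q 1 := by
  classical
  have hs := sum_colourWeight hkj hki hji p (col := col)
  rw [hj, hi, add_zero, add_zero] at hs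
  obtain ⟨q, hq, rfl⟩ := exists_of_colourWeight_ne_zero (hs.trans_ne one_ne_zero)
  refine ⟨q, rfl, ?_⟩
  ext v
  rw [Finsupp.single_apply]
  split_ifs with h
  · rw [← h, ← colourWeight_of_mem hcol p.support_mem subset_rfl hq, hs]
  · by_contra hv
    have : ∀ a b d e : ZMod 3, a ≠ b → a ≠ d → b ≠ d → e = a ∨ e = b ∨ e = d := by decide
    rcases this _ _ _ (col v) hkj hki hji with e | e | e
    · exact h (hcol _ p.support_mem hq (Finsupp.mem_support_iff.mpr hv) e.symm)
    · exact hv (weight_eq_zero_of_colourWeight (e ▸ hj))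
    · exact hv (weight_eq_zero_of_colourWeight (e ▸ hi))

variable {f : Realization K → Realization K'} {c : ℝ} {v₀ v₁ : V} {γ : ℝ → Realization K}

theorem IsEdgePath.edist_eq (hcol : IsColouring K col) (hγ : IsEdgePath v₀ v₁ γ) {v₂ : V}
    (h : IsTriangle K col v₀ v₁ v₂) {t t' : ℝ} (ht : t ∈ Set.Icc (0 : ℝ) 1)
    (ht' : t' ∈ Set.Icc (0 : ℝ) 1) : edist (γ t) (γ t') = ENNReal.ofReal |t - t'| :=
  (hγ.isPoint v₂ ht).edist_eq hcol (hγ.isPoint v₂ ht') h (abs_nonneg _) (by rw [sq_abs]; ring)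

theorem IsEdgePath.exists_edist_map_eq (hcol : IsColouring K col) (hγ : IsEdgePath v₀ v₁ γ) {v₂ : V}
    (h : IsTriangle K col v₀ v₁ v₂) {t₀ : ℝ} (ht₀ : t₀ ∈ Set.Ioo (0 : ℝ) 1)
    (hf : ScaledAt f c (γ t₀)) : ∃ ε > 0, ∀ t t', |t - t₀| < ε → |t' - t₀| < ε →
      t ∈ Set.Ioo (0 : ℝ) 1 ∧ edist (f (γ t)) (f (γ t')) = ENNReal.ofReal (c * |t - t'|) := by
  obtain ⟨ε, hε, hf⟩ := hf
  have hI : ∀ t, |t - t₀| < min ε (min t₀ (1 - t₀)) → |t₀ - t| < ε ∧ t ∈ Set.Ioo (0 : ℝ) 1 := by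
    intro t ht
    rw [lt_min_iff, lt_min_iff] at ht
    obtain ⟨h1, h2, h3⟩ := ht
    rw [abs_lt] at h2 h3
    exact ⟨by rwa [abs_sub_comm], by linarith, by linarith⟩
  refine ⟨min ε (min t₀ (1 - t₀)), lt_min hε (lt_min ht₀.1 (by linarith [ht₀.2])),
    fun t t' ht ht' => ⟨(hI t ht).2, ?_⟩⟩
  have hd : ∀ {t t' : ℝ}, t ∈ Set.Ioo (0 : ℝ) 1 → t' ∈ Set.Ioo (0 : ℝ) 1 →
      edist (γ t) (γ t') = ENNReal.ofReal |t - t'| := fun ht ht' =>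
    hγ.edist_eq hcol h (Set.Ioo_subset_Icc_self ht) (Set.Ioo_subset_Icc_self ht')
  exact hf _ _ _ _ _ (hI t ht).1 (hI t' ht').1 (abs_nonneg _) (hd ht₀ (hI t ht).2)
    (hd ht₀ (hI t' ht').2) (hd (hI t ht).2 (hI t' ht').2)

/-- The image of a path along an edge with three triangles goes straight on inside an edge. -/
theorem exists_wave_of_pos (hcol : IsColouring K col) (hcol' : IsColouring K' col') (hc : 0 < c)
    (hγ : IsEdgePath v₀ v₁ γ) {v₂ : V} (h : IsTriangle K col v₀ v₁ v₂) {t₀ : ℝ}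
    (ht₀ : t₀ ∈ Set.Ioo (0 : ℝ) 1) (hf : ScaledAt f c (γ t₀))
    (hzero : ∀ t ∈ Set.Ioo (0 : ℝ) 1, ∃ l, colourWeight col' (f (γ t)) l = 0) {k j i : ZMod 3}
    (hj : j = k + 1) (hi : i = k + 2)
    (hk0 : colourWeight col' (f (γ t₀)) k ≠ 0) (hj0 : colourWeight col' (f (γ t₀)) j ≠ 0) :
    ∃ σ : ℝ, (σ = 1 ∨ σ = -1) ∧ ∃ θ : ℝ, ∃ ε > 0,
      ∀ t, |t - t₀| < ε → colourWeight col' (f (γ t)) = wave (θ + σ * c * t) := by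
  obtain ⟨ε, hε, hd⟩ := hγ.exists_edist_map_eq hcol h ht₀ hf
  have hne : ∀ k : ZMod 3, k ≠ k + 1 ∧ k ≠ k + 2 ∧ k + 1 ≠ k + 2 := by decide
  obtain ⟨hkj, hki, hji⟩ := hne k
  rw [← hj] at hkj hji
  rw [← hi] at hki hji
  have hall : ∀ l, l = k ∨ l = j ∨ l = i := by
    have : ∀ k l : ZMod 3, l = k ∨ l = k + 1 ∨ l = k + 2 := by decide
    rw [hj, hi]
    exact this k
  -- Weights change at a rate of at most `2c`, so a vertex with positive weight at `t₀` keeps it for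
  -- `|t - t₀| < weight / (2c)`.
  have key : ∀ l, colourWeight col' (f (γ t₀)) l ≠ 0 → ∃ δ > 0, δ ≤ ε ∧ ∃ q, col' q = l ∧
      q ∈ (f (γ t₀)).weight.support ∧
      ∀ t, |t - t₀| < δ → q ∈ (f (γ t)).weight.support := by
    intro l hl
    obtain ⟨q, hq, rfl⟩ := exists_of_colourWeight_ne_zero hl
    have hm : 0 < (f (γ t₀)).weight q :=
      lt_of_le_of_ne ((f (γ t₀)).nonneg q) (Finsupp.mem_support_iff.mp hq).symm
    refine ⟨min ε ((f (γ t₀)).weight q / (2 * c)), lt_min hε (by positivity), min_le_left _ _, q, rfl,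
      hq, fun t ht => ?_⟩
    rw [lt_min_iff, lt_div_iff₀ (by positivity)] at ht
    have := abs_weight_sub_le (by positivity) (hd t t₀ ht.1 (by simpa using hε)).2.le q
    rw [Finsupp.mem_support_iff]
    intro h0
    rw [h0, zero_sub, abs_neg, abs_of_pos hm] at this
    linarith
  obtain ⟨δ₀, hδ₀, hδε, q₀, hq₀, hm₀, h₀⟩ := key k hk0
  obtain ⟨δ₁, hδ₁, -, q₁, hq₁, hm₁, h₁⟩ := key j hj0
  have hnear : ∀ t, |t - t₀| < min δ₀ δ₁ → |t - t₀| < ε ∧ colourWeight col' (f (γ t)) i = 0 ∧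
      (f (γ t)).weight.support ⊆ (f (γ t₀)).weight.support := by
    intro t ht
    rw [lt_min_iff] at ht
    have htε := ht.1.trans_le hδε
    -- Some colour weight vanishes and those of `k` and `j` do not. So the image stays on one edge,
    -- where it is an isometry up to scale between intervals.
    have hi0 : colourWeight col' (f (γ t)) i = 0 := by
      obtain ⟨l, hl⟩ := hzero t (hd t t htε htε).1
      rcases hall l with rfl | rfl | rfl
      · exact absurd (weight_eq_zero_of_colourWeight (hq₀ ▸ hl))
          (Finsupp.mem_support_iff.mp (h₀ t ht.1))
      · exact absurd (weight_eq_zero_of_colourWeight (hq₁ ▸ hl))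
          (Finsupp.mem_support_iff.mp (h₁ t ht.2))
      · exact hl
    refine ⟨htε, hi0, fun v hv => ?_⟩
    rcases hall (col' v) with e | e | e
    · rwa [hcol' _ (f (γ t)).support_mem hv (h₀ t ht.1) (e.trans hq₀.symm)]
    · rwa [hcol' _ (f (γ t)).support_mem hv (h₁ t ht.2) (e.trans hq₁.symm)]
    · exact absurd (weight_eq_zero_of_colourWeight (e ▸ hi0)) (Finsupp.mem_support_iff.mp hv)
  have hsum : ∀ t, |t - t₀| < min δ₀ δ₁ →
      colourWeight col' (f (γ t)) k = 1 - colourWeight col' (f (γ t)) j := by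
    intro t ht
    have := sum_colourWeight hkj hki hji (f (γ t)) (col := col')
    rw [(hnear t ht).2.1] at this
    linarith
  have hδ : 0 < min δ₀ δ₁ := lt_min hδ₀ hδ₁
  obtain ⟨σ, hσ, hg⟩ := exists_eq_affine (g := fun t => colourWeight col' (f (γ t)) j) hc hδ (by
    intro t t' ht ht'
    have := colourWeight_sub_sq_eq hcol' hkj hki hji (f (γ t₀)).support_mem (hnear t ht).2.2
      (hnear t' ht').2.2 (by positivity) (hd t t' (hnear t ht).1 (hnear t' ht').1).2
    rw [(hnear t ht).2.1, (hnear t' ht').2.1, hsum t ht, hsum t' ht', mul_pow, sq_abs] at this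
    linarith)
  refine ⟨σ, hσ, k.val + colourWeight col' (f (γ t₀)) j - σ * c * t₀, _, hδ, fun t ht => ?_⟩
  have h1 := colourWeight_nonneg (f (γ t)) j (col := col')
  have h2 := colourWeight_nonneg (f (γ t)) k (col := col')
  have h3 := hsum t ht
  obtain ⟨w1, w2, w3⟩ := wave_int_add k.val h1 (by linarith)
  have e : ((k.val : ℤ) : ZMod 3) = k := by simp
  rw [e] at w1 w2 w3
  rw [← hj] at w2
  rw [← hi] at w3
  have harg : (k.val : ℝ) + colourWeight col' (f (γ t₀)) j - σ * c * t₀ + σ * c * t =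
      ((k.val : ℤ) : ℝ) + colourWeight col' (f (γ t)) j := by
    have := hg t ht
    rw [this]
    push_cast
    ring
  rw [harg]
  ext l
  rcases hall l with rfl | rfl | rfl
  · rw [w1, h3]
  · rw [w2]
  · rw [w3, (hnear t ht).2.1]

/-- The image of a path along an edge with three triangles goes straight on at a vertex. -/
theorem exists_wave_of_vertex (hcol : IsColouring K col) (hcol' : IsColouring K' col') (hc : 0 < c)
    (hγ : IsEdgePath v₀ v₁ γ) {v₂ : V} (h : IsTriangle K col v₀ v₁ v₂) {t₀ : ℝ}
    (ht₀ : t₀ ∈ Set.Ioo (0 : ℝ) 1) (hf : ScaledAt f c (γ t₀))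
    (hzero : ∀ t ∈ Set.Ioo (0 : ℝ) 1, ∃ l, colourWeight col' (f (γ t)) l = 0) {q : V'}
    (hq : (f (γ t₀)).weight = Finsupp.single q 1) :
    ∃ σ : ℝ, (σ = 1 ∨ σ = -1) ∧ ∃ θ : ℝ, ∃ ε > 0,
      ∀ t, |t - t₀| < ε → colourWeight col' (f (γ t)) = wave (θ + σ * c * t) := by
  obtain ⟨ε₁, hε₁, hd⟩ := hγ.exists_edist_map_eq hcol h ht₀ hf
  obtain ⟨ε₂, hε₂, hf⟩ := hf
  -- The bound `1 / (2c)` keeps the images within distance 1/2 of `q`, hence in its open star; the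
  -- last two keep `t₀ ± s` in the interval.
  obtain ⟨ε, hε, hεm⟩ := exists_between (show 0 < min (min ε₁ ε₂) (min (1 / (2 * c))
    (min t₀ (1 - t₀))) from lt_min (lt_min hε₁ hε₂) (lt_min (by positivity)
      (lt_min ht₀.1 (by linarith [ht₀.2]))))
  simp only [lt_min_iff] at hεm
  obtain ⟨⟨hm1, hm2⟩, hm3, hm4, hm5⟩ := hεm
  rw [lt_div_iff₀ (by positivity)] at hm3
  have hcs : ∀ s, s < ε → c * s < 1 / 2 := fun s hs => by nlinarith
  have h00 : |t₀ - t₀| < ε₁ := by simpa using hε₁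
  have hplus : ∀ s, 0 < s → s < ε → edist (f (γ t₀)) (f (γ (t₀ + s))) = ENNReal.ofReal (c * s) := by
    intro s hs hsε
    have := (hd t₀ (t₀ + s) h00 (by rw [add_sub_cancel_left, abs_of_pos hs]; linarith)).2
    rwa [sub_add_cancel_left, abs_neg, abs_of_pos hs] at this
  have hminus : ∀ s, 0 < s → s < ε → edist (f (γ t₀)) (f (γ (t₀ - s))) = ENNReal.ofReal (c * s) := by
    intro s hs hsε
    have := (hd t₀ (t₀ - s) h00 (by rw [sub_sub_cancel_left, abs_neg, abs_of_pos hs]; linarith)).2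
    rwa [sub_sub_cancel, abs_of_pos hs] at this
  have hIp : ∀ s, 0 < s → s < ε → t₀ + s ∈ Set.Ioo (0 : ℝ) 1 := fun s hs hsε =>
    ⟨by linarith [ht₀.1], by linarith⟩
  have hIm : ∀ s, 0 < s → s < ε → t₀ - s ∈ Set.Ioo (0 : ℝ) 1 := fun s hs hsε =>
    ⟨by linarith, by linarith [ht₀.2]⟩
  -- half a turn around the vertex exchanges the other two colours
  have hturn : ∀ s, 0 < s → s < ε → ∀ j i, col' q ≠ j → col' q ≠ i → j ≠ i →
      colourWeight col' (f (γ (t₀ + s))) i = 0 → colourWeight col' (f (γ (t₀ - s))) j = 0 := by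
    intro s hs hsε j i hqj hqi hji hzi
    have hp := hIp s hs hsε
    have hm := hIm s hs hsε
    -- The points `γ (t₀ + s)`, `m₁`, `m₂`, `γ (t₀ - s)` are consecutive corners of a regular
    -- hexagon of radius `s` around `γ t₀`. The three exchanges of colours are an odd number, so the
    -- vanishing colour changes from `i` to `j`.
    obtain ⟨m₁, hm₁⟩ := h.exists_isPoint (show 0 ≤ 1 - t₀ - s by linarith) ht₀.1.le hs.le (by ring)
    obtain ⟨m₂, hm₂⟩ := h.exists_isPoint (show 0 ≤ 1 - t₀ by linarith) (show 0 ≤ t₀ - s by linarith)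
      hs.le (by ring)
    have hpx := hγ.isPoint v₂ (Set.Ioo_subset_Icc_self ht₀)
    have hpp := hγ.isPoint v₂ (Set.Ioo_subset_Icc_self hp)
    have hpm := hγ.isPoint v₂ (Set.Ioo_subset_Icc_self hm)
    have d1 := hpx.edist_eq hcol hpp h hs.le (by ring)
    have d2 := hpx.edist_eq hcol hm₁ h hs.le (by ring)
    have d3 := hpx.edist_eq hcol hm₂ h hs.le (by ring)
    have d4 := hpx.edist_eq hcol hpm h hs.le (by ring)
    have d5 := hpp.edist_eq hcol hm₁ h hs.le (by ring)
    have d6 := hm₁.edist_eq hcol hm₂ h hs.le (by ring)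
    have d7 := hm₂.edist_eq hcol hpm h hs.le (by ring)
    have hsε₂ : s < ε₂ := hsε.trans hm2
    have hxx : edist (γ t₀) (γ t₀) = ENNReal.ofReal 0 := by simp
    have hρ := mul_pos hc hs
    have hf' : ∀ {a b}, edist (γ t₀) a = ENNReal.ofReal s → edist (γ t₀) b = ENNReal.ofReal s →
        edist a b = ENNReal.ofReal s → edist (f a) (f b) = ENNReal.ofReal (c * s) :=
      fun ha hb hab => hf _ _ _ _ _ hsε₂ hsε₂ hs.le ha hb hab
    have hf₀ : ∀ {a}, edist (γ t₀) a = ENNReal.ofReal s →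
        edist (f (γ t₀)) (f a) = ENNReal.ofReal (c * s) :=
      fun ha => hf _ _ _ _ _ hε₂ hsε₂ hs.le hxx ha ha
    have t1 := colourWeight_turn hcol' hq hqj hqi hji hρ (hcs s hsε) (hf₀ d1) (hf₀ d2)
      (hf' d1 d2 d5) hzi
    have t2 := colourWeight_turn hcol' hq hqi hqj hji.symm hρ (hcs s hsε) (hf₀ d2) (hf₀ d3)
      (hf' d2 d3 d6) t1
    exact colourWeight_turn hcol' hq hqj hqi hji hρ (hcs s hsε) (hf₀ d3) (hf₀ d4)
      (hf' d3 d4 d7) t2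
  -- at distance `c * s` from the vertex, one coordinate is `c * s` if the other one vanishes
  have hval : ∀ u, ∀ s, 0 < s → s < ε → edist (f (γ t₀)) u = ENNReal.ofReal (c * s) →
      ∀ j i, col' q ≠ j → col' q ≠ i → j ≠ i → colourWeight col' u i = 0 →
      colourWeight col' u j = c * s := by
    intro u s hs hsε hu j i hqj hqi hji hz
    have := colourWeight_of_edist_vertex hcol' hq hqj hqi hji (by positivity) (hcs s hsε) hu
    rw [hz] at this
    exact (pow_left_inj₀ (colourWeight_nonneg _ _) (by positivity) two_ne_zero).mp (by linarith)
  have hside : ∀ s, 0 < s → s < ε → ∃ j i, col' q ≠ j ∧ col' q ≠ i ∧ j ≠ i ∧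
      colourWeight col' (f (γ (t₀ + s))) i = 0 := by
    intro s hs hsε
    obtain ⟨l, hl⟩ := hzero _ (hIp s hs hsε)
    have hql : col' q ≠ l := by
      rintro rfl
      exact absurd (weight_eq_zero_of_colourWeight hl) (Finsupp.mem_support_iff.mp
        (support_of_edist_vertex hq (by positivity) (hcs s hsε) (hplus s hs hsε)))
    obtain ⟨j, hj1, hj2⟩ := exists_third hql
    exact ⟨j, l, hj1, hql, hj2.symm, hl⟩
  have hε2 : ε / 2 < ε := by linarith
  obtain ⟨j, i, hqj, hqi, hji, hz⟩ := hside (ε / 2) (by positivity) hε2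
  -- If the colour of the side changed, folding would put points at distances `A` and `B` from `q`
  -- on two sides with angle π/3, and their distance would exceed `|A - B|`.
  have hsame : ∀ s, 0 < s → s < ε → colourWeight col' (f (γ (t₀ + s))) i = 0 := by
    intro s hs hsε
    obtain ⟨j', i', hqj', hqi', hji', hz'⟩ := hside s hs hsε
    have hcases : ∀ q j i j' i' : ZMod 3, q ≠ j → q ≠ i → j ≠ i → q ≠ j' → q ≠ i' → j' ≠ i' →
        (i' = i ∧ j' = j) ∨ (i' = j ∧ j' = i) := by decide
    rcases hcases _ _ _ _ _ hqj hqi hji hqj' hqi' hji' with ⟨rfl, rfl⟩ | ⟨rfl, rfl⟩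
    · exact hz'
    · exfalso
      have e1 := hval _ _ (by positivity) hε2 (hplus _ (by positivity) hε2) _ _ hqj hqi hji hz
      have e2 := hval _ _ hs hsε (hplus s hs hsε) _ _ hqi hqj hji.symm hz'
      have s1 := sum_colourWeight hqj hqi hji (f (γ (t₀ + ε / 2))) (col := col')
      have s2 := sum_colourWeight hqj hqi hji (f (γ (t₀ + s))) (col := col')
      have hdist := (hd (t₀ + ε / 2) (t₀ + s)
        (by rw [add_sub_cancel_left, abs_of_pos] <;> linarith)
        (by rw [add_sub_cancel_left, abs_of_pos] <;> linarith)).2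
      have := colourWeight_sub_sq_le hcol' hqj hqi hji (by positivity) hdist.le
      rw [add_sub_add_left_eq_sub, mul_pow, sq_abs, hz, hz', e1, e2,
        show colourWeight col' (f (γ (t₀ + ε / 2))) (col' q) = 1 - c * (ε / 2) by linarith,
        show colourWeight col' (f (γ (t₀ + s))) (col' q) = 1 - c * s by linarith] at this
      nlinarith [mul_pos (mul_pos hc hs) (mul_pos hc hε)]
  have hcolours : ∀ s, 0 < s → s < ε →
      (colourWeight col' (f (γ (t₀ + s))) (col' q) = 1 - c * s ∧
        colourWeight col' (f (γ (t₀ + s))) j = c * s ∧ colourWeight col' (f (γ (t₀ + s))) i = 0) ∧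
      (colourWeight col' (f (γ (t₀ - s))) (col' q) = 1 - c * s ∧
        colourWeight col' (f (γ (t₀ - s))) i = c * s ∧ colourWeight col' (f (γ (t₀ - s))) j = 0) := by
    intro s hs hsε
    have z1 := hsame s hs hsε
    have z2 := hturn s hs hsε j i hqj hqi hji z1
    have v1 := hval _ s hs hsε (hplus s hs hsε) j i hqj hqi hji z1
    have v2 := hval _ s hs hsε (hminus s hs hsε) i j hqi hqj hji.symm z2
    have s1 := sum_colourWeight hqj hqi hji (f (γ (t₀ + s))) (col := col')
    have s2 := sum_colourWeight hqj hqi hji (f (γ (t₀ - s))) (col := col')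
    exact ⟨⟨by linarith, v1, z1⟩, by linarith, v2, z2⟩
  -- a wave that moves away from the vertex
  set k := col' q with hk
  have hkv : ((k.val : ℤ) : ZMod 3) = k := by simp
  have hup : ∀ ρ, 0 ≤ ρ → ρ ≤ 1 → wave (k.val + ρ) k = 1 - ρ ∧ wave (k.val + ρ) (k + 1) = ρ ∧
      wave (k.val + ρ) (k + 2) = 0 := by
    intro ρ h0 h1
    have := wave_int_add k.val h0 h1
    rwa [hkv, Int.cast_natCast] at this
  have hdown : ∀ ρ, 0 ≤ ρ → ρ ≤ 1 → wave (k.val - ρ) k = 1 - ρ ∧ wave (k.val - ρ) (k + 2) = ρ ∧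
      wave (k.val - ρ) (k + 1) = 0 := by
    intro ρ h0 h1
    have := wave_int_add (k.val - 1) (sub_nonneg.mpr h1) (sub_le_self 1 h0)
    rw [show ((k.val - 1 : ℤ) : ℝ) + (1 - ρ) = k.val - ρ by push_cast; ring, Int.cast_sub, hkv] at this
    have e : ∀ k : ZMod 3, k - (1 : ℤ) = k + 2 ∧ k + 2 + 1 = k ∧ k + 2 + 2 = k + 1 := by decide
    obtain ⟨e1, e2, e3⟩ := e k
    rw [e1, e2, e3, sub_sub_cancel] at this
    exact ⟨this.2.1, this.1, this.2.2⟩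
  have hall : ∀ k l : ZMod 3, l = k ∨ l = k + 1 ∨ l = k + 2 := by decide
  have hmid : ∀ l, colourWeight col' (f (γ t₀)) l = wave k.val l := by
    have := hup 0 le_rfl zero_le_one
    rw [add_zero, sub_zero] at this
    have hne : ∀ k : ZMod 3, k ≠ k + 1 ∧ k ≠ k + 2 := by decide
    intro l
    rw [colourWeight_vertex hq, ← hk]
    rcases hall k l with rfl | rfl | rfl
    · rw [if_pos rfl, this.1]
    · rw [if_neg (hne k).1, this.2.1]
    · rw [if_neg (hne k).2, this.2.2]
  have hji' : ∀ k j i : ZMod 3, k ≠ j → k ≠ i → j ≠ i →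
      (j = k + 1 ∧ i = k + 2) ∨ (j = k + 2 ∧ i = k + 1) := by decide
  have hb : ∀ s, 0 < s → s < ε → 0 ≤ c * s ∧ c * s ≤ 1 := fun s hs hsε =>
    ⟨by positivity, by linarith [hcs s hsε]⟩
  -- The position increases with `t` exactly if the path leaves `q` towards the colour `k + 1`.
  rcases hji' _ _ _ hqj hqi hji with ⟨rfl, rfl⟩ | ⟨rfl, rfl⟩
  · refine ⟨1, Or.inl rfl, k.val - 1 * c * t₀, ε, hε, fun t ht => ?_⟩
    ext l
    rcases lt_trichotomy t t₀ with hlt | rfl | hlt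
    · have hs : 0 < t₀ - t := by linarith
      have hsε : t₀ - t < ε := by rwa [abs_sub_comm, abs_of_pos hs] at ht
      obtain ⟨-, c1, c2, c3⟩ := hcolours _ hs hsε
      obtain ⟨w1, w2, w3⟩ := hdown _ (hb _ hs hsε).1 (hb _ hs hsε).2
      rw [sub_sub_cancel] at c1 c2 c3
      rw [show (k.val : ℝ) - 1 * c * t₀ + 1 * c * t = k.val - c * (t₀ - t) by ring]
      rcases hall k l with rfl | rfl | rfl
      · rw [c1, w1]
      · rw [c3, w3]
      · rw [c2, w2]
    · rw [hmid, sub_add_cancel]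
    · have hs : 0 < t - t₀ := by linarith
      have hsε : t - t₀ < ε := by rwa [abs_of_pos hs] at ht
      obtain ⟨⟨c1, c2, c3⟩, -⟩ := hcolours _ hs hsε
      obtain ⟨w1, w2, w3⟩ := hup _ (hb _ hs hsε).1 (hb _ hs hsε).2
      rw [add_sub_cancel] at c1 c2 c3
      rw [show (k.val : ℝ) - 1 * c * t₀ + 1 * c * t = k.val + c * (t - t₀) by ring]
      rcases hall k l with rfl | rfl | rfl
      · rw [c1, w1]
      · rw [c2, w2]
      · rw [c3, w3]
  · refine ⟨-1, Or.inr rfl, k.val - -1 * c * t₀, ε, hε, fun t ht => ?_⟩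
    ext l
    rcases lt_trichotomy t t₀ with hlt | rfl | hlt
    · have hs : 0 < t₀ - t := by linarith
      have hsε : t₀ - t < ε := by rwa [abs_sub_comm, abs_of_pos hs] at ht
      obtain ⟨-, c1, c2, c3⟩ := hcolours _ hs hsε
      obtain ⟨w1, w2, w3⟩ := hup _ (hb _ hs hsε).1 (hb _ hs hsε).2
      rw [sub_sub_cancel] at c1 c2 c3
      rw [show (k.val : ℝ) - -1 * c * t₀ + -1 * c * t = k.val + c * (t₀ - t) by ring]
      rcases hall k l with rfl | rfl | rfl
      · rw [c1, w1]
      · rw [c2, w2]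
      · rw [c3, w3]
    · rw [hmid, sub_add_cancel]
    · have hs : 0 < t - t₀ := by linarith
      have hsε : t - t₀ < ε := by rwa [abs_of_pos hs] at ht
      obtain ⟨⟨c1, c2, c3⟩, -⟩ := hcolours _ hs hsε
      obtain ⟨w1, w2, w3⟩ := hdown _ (hb _ hs hsε).1 (hb _ hs hsε).2
      rw [add_sub_cancel] at c1 c2 c3
      rw [show (k.val : ℝ) - -1 * c * t₀ + -1 * c * t = k.val - c * (t - t₀) by ring]
      rcases hall k l with rfl | rfl | rfl
      · rw [c1, w1]
      · rw [c3, w3]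
      · rw [c2, w2]

/-- In terms of colours, the image of an edge with three triangles goes around the triangle with
constant speed. -/
theorem IsBranchEdge.exists_wave (hcol : IsColouring K col) (hcol' : IsColouring K' col') (hc : 0 < c)
    (hf : ∀ p ∉ zeroSkeleton K, ScaledAt f c p) (hb : IsBranchEdge K col v₀ v₁)
    (hγ : IsEdgePath v₀ v₁ γ) : ∃ σ : ℝ, (σ = 1 ∨ σ = -1) ∧ ∃ θ : ℝ, ∀ t ∈ Set.Ioo (0 : ℝ) 1,
      colourWeight col' (f (γ t)) = wave (θ + σ * c * t) := by
  obtain ⟨u, hu, htri⟩ := hb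
  have hfγ : ∀ t ∈ Set.Ioo (0 : ℝ) 1, ScaledAt f c (γ t) := fun t ht =>
    hf _ ((hγ.isPoint (u 0) (Set.Ioo_subset_Icc_self ht)).notMem_zeroSkeleton hcol (htri 0)
      (Or.inl ⟨(sub_pos.mpr ht.2).ne', ht.1.ne'⟩))
  have hzero : ∀ t ∈ Set.Ioo (0 : ℝ) 1, ∃ l, colourWeight col' (f (γ t)) l = 0 := fun t ht =>
    exists_colourWeight_eq_zero hcol hcol' hc hu htri ht.1 ht.2
      (fun i => hγ.isPoint (u i) (Set.Ioo_subset_Icc_self ht)) (hfγ t ht)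
  refine exists_eq_wave hc fun t₀ ht₀ => ?_
  suffices h : ∃ σ : ℝ, (σ = 1 ∨ σ = -1) ∧ ∃ θ : ℝ, ∃ ε > 0,
      ∀ t, |t - t₀| < ε → colourWeight col' (f (γ t)) = wave (θ + σ * c * t) by
    obtain ⟨σ, hσ, θ, ε, hε, h⟩ := h
    exact ⟨σ, hσ, θ, ε, hε, fun t _ => h t⟩
  obtain ⟨i, hi⟩ := hzero t₀ ht₀
  have hne : ∀ i : ZMod 3, i + 1 ≠ i + 2 ∧ i + 1 ≠ i ∧ i + 2 ≠ i ∧ i + 2 = i + 1 + 1 ∧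
      i = i + 1 + 2 := by decide
  obtain ⟨h1, h2, h3, h4, h5⟩ := hne i
  by_cases hk : colourWeight col' (f (γ t₀)) (i + 1) = 0
  · obtain ⟨q, -, hq⟩ := exists_vertex_of_colourWeight hcol' h1.symm h3 h2 hk hi
    exact exists_wave_of_vertex hcol hcol' hc hγ (htri 0) ht₀ (hfγ t₀ ht₀) hzero hq
  by_cases hj : colourWeight col' (f (γ t₀)) (i + 2) = 0
  · obtain ⟨q, -, hq⟩ := exists_vertex_of_colourWeight hcol' h1 h2 h3 hj hi
    exact exists_wave_of_vertex hcol hcol' hc hγ (htri 0) ht₀ (hfγ t₀ ht₀) hzero hq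
  exact exists_wave_of_pos hcol hcol' hc hγ (htri 0) ht₀ (hfγ t₀ ht₀) hzero h4 h5 hk hj

end Edge

/-! ### Images of two sides of a triangle near their common corner. -/

section Corner

variable {V V' : Type} {K : AbstractSimplicialComplex V} {K' : AbstractSimplicialComplex V'}
  {col : V → ZMod 3} {col' : V' → ZMod 3} {f : Realization K → Realization K'} {c : ℝ}

/-- Near a common vertex, the images of two sides of a triangle are close to each other. -/
theorem IsTriangle.edist_map_le (hcol : IsColouring K col) (hc : 0 < c)
    (hf : ∀ p ∉ zeroSkeleton K, ScaledAt f c p) {v₀ v₁ v₂ : V} (h : IsTriangle K col v₀ v₁ v₂)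
    {γ γ' : ℝ → Realization K} (hγ : IsEdgePath v₀ v₁ γ) (hγ' : IsEdgePath v₀ v₂ γ') {s : ℝ}
    (hs : s ∈ Set.Ioo (0 : ℝ) 1) : edist (f (γ s)) (f (γ' s)) ≤ ENNReal.ofReal (c * s) := by
  have hs0 := hs.1
  -- The segment from `γ s` to `γ' s` is parallel to the third side, has length `s` and avoids the
  -- vertices. Outside the unit interval the value is arbitrary.
  have hex : ∀ τ : ℝ, ∃ p : Realization K, τ ∈ Set.Icc (0 : ℝ) 1 →
      IsPoint v₀ v₁ v₂ (1 - s) ((1 - τ) * s) (τ * s) p := by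
    intro τ
    by_cases hτ : τ ∈ Set.Icc (0 : ℝ) 1
    · obtain ⟨p, hp⟩ := h.exists_isPoint (show 0 ≤ 1 - s by linarith [hs.2])
        (mul_nonneg (sub_nonneg.mpr hτ.2) hs0.le) (mul_nonneg hτ.1 hs0.le) (by ring)
      exact ⟨p, fun _ => hp⟩
    · exact ⟨γ s, fun h => absurd h hτ⟩
  choose z hz using hex
  have hzd : ∀ τ ∈ Set.Icc (0 : ℝ) 1, ∀ τ' ∈ Set.Icc (0 : ℝ) 1,
      edist (z τ) (z τ') = ENNReal.ofReal (s * |τ - τ'|) := fun τ hτ τ' hτ' =>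
    (hz τ hτ).edist_eq hcol (hz τ' hτ') h (by positivity) (by rw [mul_pow, sq_abs]; ring)
  have hloc : ∀ τ ∈ Set.Icc (0 : ℝ) 1, ∃ δ > 0, ∀ τ' ∈ Set.Icc (0 : ℝ) 1, |τ' - τ| < δ →
      edist (f (z τ')) (f (z τ)) = ENNReal.ofReal (c * (s * |τ' - τ|)) := by
    intro τ hτ
    have hskel : z τ ∉ zeroSkeleton K := by
      apply (hz τ hτ).notMem_zeroSkeleton hcol h
      have h1 : 1 - s ≠ 0 := (sub_pos.mpr hs.2).ne'
      by_cases h0 : τ = 0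
      · exact Or.inl ⟨h1, by rw [h0]; simpa using hs0.ne'⟩
      · exact Or.inr ⟨h1, mul_ne_zero h0 hs0.ne'⟩
    obtain ⟨ε, hε, hf⟩ := hf _ hskel
    refine ⟨ε / s, by positivity, fun τ' hτ' hd => ?_⟩
    rw [lt_div_iff₀ hs0] at hd
    exact hf _ _ _ 0 _ (by rwa [abs_sub_comm, mul_comm]) hε (by positivity)
      (hzd τ hτ τ' hτ') (by simp) (hzd τ' hτ' τ hτ)
  have hcont : ContinuousOn (fun τ => f (z τ)) (Set.Icc 0 1) := by
    intro τ hτ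
    obtain ⟨δ, hδ, hd⟩ := hloc τ hτ
    rw [ContinuousWithinAt, tendsto_iff_edist_tendsto_0]
    have h1 : Filter.Tendsto (fun τ' => ENNReal.ofReal (c * (s * |τ' - τ|)))
        (𝓝[Set.Icc 0 1] τ) (𝓝 0) := by
      have : Continuous fun τ' => ENNReal.ofReal (c * (s * |τ' - τ|)) :=
        ENNReal.continuous_ofReal.comp (by fun_prop)
      simpa using (this.tendsto τ).mono_left nhdsWithin_le_nhds
    refine h1.congr' ?_
    filter_upwards [self_mem_nhdsWithin, mem_nhdsWithin_of_mem_nhds (Metric.ball_mem_nhds τ hδ)]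
      with τ' hτ' hb
    exact (hd τ' hτ' (by rwa [Metric.mem_ball, Real.dist_eq] at hb)).symm
  -- The map scales distances along the segment only locally. The bound holds on a closed set that
  -- can always be extended to the right, so it holds up to `τ = 1`.
  have hsub : Set.Icc (0 : ℝ) 1 ⊆
      {τ | edist (f (z 0)) (f (z τ)) ≤ ENNReal.ofReal (c * (s * τ))} := by
    apply IsClosed.Icc_subset_of_forall_mem_nhdsWithin
    · rw [Set.inter_comm]
      exact isClosed_Icc.isClosed_le (continuous_edist.comp_continuousOn (continuousOn_const.prodMk hcont))
        (ENNReal.continuous_ofReal.comp (by fun_prop : Continuous fun τ => c * (s * τ))).continuousOn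
    · simp
    · rintro τ ⟨hτS, hτ⟩
      obtain ⟨δ, hδ, hd⟩ := hloc τ (Set.Ico_subset_Icc_self hτ)
      filter_upwards [Ioo_mem_nhdsGT (show τ < min 1 (τ + δ) from lt_min hτ.2 (by linarith))]
        with τ' hτ'
      have hlt := lt_min_iff.mp hτ'.2
      have habs : |τ' - τ| = τ' - τ := abs_of_pos (sub_pos.mpr hτ'.1)
      have e := hd τ' ⟨hτ.1.trans hτ'.1.le, hlt.1.le⟩ (by rw [habs]; linarith)
      refine (edist_triangle _ (f (z τ)) _).trans ?_
      rw [edist_comm (f (z τ)), e, habs]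
      refine (add_le_add_left hτS _).trans_eq ?_
      rw [← ENNReal.ofReal_add (mul_nonneg hc.le (mul_nonneg hs0.le hτ.1))
        (mul_nonneg hc.le (mul_nonneg hs0.le (sub_nonneg.mpr hτ'.1.le)))]
      congr 1
      ring
  have h01 := hsub (Set.right_mem_Icc.mpr zero_le_one)
  have hsI := Set.Ioo_subset_Icc_self hs
  have e0 : z 0 = γ s := Realization.ext (by
    rw [hz 0 (Set.left_mem_Icc.mpr zero_le_one), hγ s hsI]
    simp)
  have e1 : z 1 = γ' s := Realization.ext (by
    rw [hz 1 (Set.right_mem_Icc.mpr zero_le_one), hγ' s hsI]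
    simp)
  simpa only [Set.mem_ofPred_eq, e0, e1, mul_one] using h01

/-- Nothing is known about `f` at the corner itself, so the two sides are compared at distance `s`
from it, with `s` tending to zero. -/
theorem IsTriangle.tendsto_colourWeight_sub (hcol : IsColouring K col) (hcol' : IsColouring K' col')
    (hc : 0 < c) (hf : ∀ p ∉ zeroSkeleton K, ScaledAt f c p) {v₀ v₁ v₂ : V}
    (h : IsTriangle K col v₀ v₁ v₂) {γ γ' : ℝ → Realization K} (hγ : IsEdgePath v₀ v₁ γ)
    (hγ' : IsEdgePath v₀ v₂ γ') (l : ZMod 3) :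
    Filter.Tendsto (fun s => colourWeight col' (f (γ s)) l - colourWeight col' (f (γ' s)) l)
      (𝓝[>] 0) (𝓝 0) := by
  have h1 : Filter.Tendsto (fun s => 2 * (c * s)) (𝓝[>] 0) (𝓝 0) := by
    have : Continuous fun s : ℝ => 2 * (c * s) := by fun_prop
    simpa using (this.tendsto 0).mono_left nhdsWithin_le_nhds
  refine squeeze_zero_norm' ?_ h1
  filter_upwards [Ioo_mem_nhdsGT (zero_lt_one (α := ℝ))] with s hs
  exact abs_colourWeight_sub_le hcol' (mul_nonneg hc.le hs.1.le) (h.edist_map_le hcol hc hf hγ hγ' hs) l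

end Corner

/-! ### Group actions and colours. -/

section Action

variable {V : Type} {K : AbstractSimplicialComplex V} {col : V → ZMod 3} {G : Type} [Group G]
  [MulAction G V] [SimplicialAction G K]

theorem smul_weight (g : G) (p : Realization K) :
    (g • p).weight = p.weight.embDomain (MulAction.toPerm g : Equiv.Perm V).toEmbedding := rfl

theorem colourWeight_smul (g : G) {δ : ZMod 3} (hg : ∀ v, col (g • v) = col v + δ)
    (p : Realization K) (l : ZMod 3) :
    colourWeight col (g • p) (l + δ) = colourWeight col p l := by
  rw [colourWeight_eq, colourWeight_eq, smul_weight]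
  change (Finsupp.sum _ fun v t => if col v = l + δ then t else 0) =
    p.weight.sum fun v t => if col v = l then t else 0
  rw [Finsupp.sum_embDomain]
  refine Finsupp.sum_congr fun v _ => ?_
  simp [hg]

/-- If `g` moves the end of an edge to its start, the reversed translate starts where the edge does,
and the two can be compared there. -/
theorem IsEdgePath.smul_reverse {v₀ v₁ : V} {γ : ℝ → Realization K} (h : IsEdgePath v₀ v₁ γ) (g : G) :
    IsEdgePath (g • v₁) (g • v₀) fun t => g • γ (1 - t) := by
  intro t ht
  rw [smul_weight, h (1 - t) ⟨by linarith [ht.2], by linarith [ht.1]⟩, Finsupp.embDomain_eq_mapDomain,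
    Finsupp.mapDomain_add, Finsupp.mapDomain_single, Finsupp.mapDomain_single, add_comm,
    sub_sub_cancel]
  rfl

end Action

/-! ### Colourings and triangles of complexes that are spanned by triangles. -/

theorem isColouring_spannedBy {V : Type} {T : Set (Set V)} (hT : ∀ v, ∃ t ∈ T, v ∈ t) {col : V → ZMod 3}
    (h : ∀ t ∈ T, Set.InjOn col t) : IsColouring (spannedBy T hT) col := by
  rintro s ⟨-, t, ht, hst⟩
  exact (h t ht).mono hst

theorem injOn_colour {V : Type} {col : V → ZMod 3} {v₀ v₁ v₂ : V} (h₁ : col v₁ = col v₀ + 1)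
    (h₂ : col v₂ = col v₀ + 2) : Set.InjOn col {v₀, v₁, v₂} := by
  have : ∀ k : ZMod 3, k ≠ k + 1 ∧ k ≠ k + 2 ∧ k + 1 ≠ k + 2 := by decide
  obtain ⟨e1, e2, e3⟩ := this (col v₀)
  rw [← h₁] at e1 e3
  rw [← h₂] at e2 e3
  rintro v (rfl | rfl | rfl) w (rfl | rfl | rfl) h <;>
    first | rfl | exact absurd h ‹_› | exact absurd h.symm ‹_›

theorem isTriangle_spannedBy {V : Type} {T : Set (Set V)} (hT : ∀ v, ∃ t ∈ T, v ∈ t) {col : V → ZMod 3}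
    {t : Set V} (ht : t ∈ T) {v₀ v₁ v₂ : V} (h₀ : v₀ ∈ t) (h₁ : v₁ ∈ t) (h₂ : v₂ ∈ t)
    (hne₀₁ : col v₀ ≠ col v₁) (hne₀₂ : col v₀ ≠ col v₂) (hne₁₂ : col v₁ ≠ col v₂) :
    IsTriangle (spannedBy T hT) col v₀ v₁ v₂ := by
  classical
  refine ⟨⟨{v₀, v₁, v₂}, ⟨by simp, t, ht, ?_⟩, by simp, by simp, by simp⟩, hne₀₁, hne₀₂, hne₁₂⟩
  intro v hv
  simp only [Finset.coe_insert, Finset.coe_singleton, Set.mem_insert_iff,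
    Set.mem_singleton_iff] at hv
  rcases hv with rfl | rfl | rfl <;> assumption

end Realization

/-! ## Colourings of the two complexes -/

namespace G0

/-- A homomorphism from `B₄` that is trivial on `(bac)⁴` induces one from `G₀`. -/
def lift {G : Type*} [Group G] (φ : B4 →* G) (h : φ ((B4.b * B4.a * B4.c) ^ 4) = 1) : G0 →* G :=
  QuotientGroup.lift _ φ fun g hg => by
    obtain ⟨k, rfl⟩ := center_le g hg
    change φ (_ ^ k) = 1
    rw [map_zpow, h, one_zpow]

/-- The exponent sum modulo three. -/
def expSum : G0 →* Multiplicative (ZMod 3) :=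
  lift (PresentedGroup.toGroup (b4_lift (fun _ => Multiplicative.ofAdd (1 : ZMod 3)) rfl rfl rfl)) (by
    have h : ∀ g : Gen, PresentedGroup.toGroup
        (b4_lift (fun _ => Multiplicative.ofAdd (1 : ZMod 3)) rfl rfl rfl) (PresentedGroup.of g) =
        Multiplicative.ofAdd (1 : ZMod 3) := fun g => PresentedGroup.toGroup.of _
    rw [map_pow, map_mul, map_mul, B4.a, B4.b, B4.c, h, h, h]
    decide)

theorem expSum_a : expSum a = Multiplicative.ofAdd 1 := rfl
theorem expSum_b : expSum b = Multiplicative.ofAdd 1 := rfl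
theorem expSum_c : expSum c = Multiplicative.ofAdd 1 := rfl
theorem expSum_d : expSum d = Multiplicative.ofAdd 1 := by
  simp only [d, map_mul, map_inv, expSum_a, expSum_b, expSum_c]; decide
theorem expSum_e : expSum e = Multiplicative.ofAdd 1 := by
  simp only [e, map_mul, map_inv, expSum_a, expSum_b]; decide
theorem expSum_f : expSum f = Multiplicative.ofAdd 1 := by
  simp only [f, map_mul, map_inv, expSum_b, expSum_c]; decide
theorem expSum_x : expSum x = 1 := by
  simp only [x, map_mul, expSum_a, expSum_b, expSum_c]; decide

/-- The permutations of the four strands. -/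
def perm : G0 →* Equiv.Perm (Fin 4) :=
  lift (PresentedGroup.toGroup (b4_lift
    (fun | .a => Equiv.swap 0 1 | .b => Equiv.swap 1 2 | .c => Equiv.swap 2 3)
    (by decide) (by decide) (by decide))) (by
    have h : ∀ g : Gen, PresentedGroup.toGroup (b4_lift
        (fun | .a => Equiv.swap 0 1 | .b => Equiv.swap 1 2 | .c => Equiv.swap (2 : Fin 4) 3)
        (by decide) (by decide) (by decide)) (PresentedGroup.of g) = _ :=
      fun g => PresentedGroup.toGroup.of _
    rw [map_pow, map_mul, map_mul, B4.a, B4.b, B4.c, h, h, h]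
    decide)

theorem perm_a : perm a = Equiv.swap 0 1 := rfl
theorem perm_b : perm b = Equiv.swap 1 2 := rfl
theorem perm_c : perm c = Equiv.swap 2 3 := rfl

theorem aba : a * b * a = b * a * b := congrArg QuotientGroup.mk B4.aba
theorem bcb : b * c * b = c * b * c := congrArg QuotientGroup.mk B4.bcb
theorem ac : a * c = c * a := congrArg QuotientGroup.mk B4.ac

theorem eb : e * b = a * e := calc
  e * b = a⁻¹ * (b * a * b) := by rw [e]; group
  _ = a * e := by rw [← aba, e]; group

/-- This shows that `y` moves the vertex `⟨x⟩` to its neighbour `f⟨x⟩`. -/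
theorem y_eq : y = f * x := calc
  y = b * (a * c) * c := by rw [y, x]; group
  _ = c⁻¹ * (c * b * c) * a * c := by rw [ac]; group
  _ = f * x := by rw [← bcb, f, x]; group

end G0

namespace X0

/-- The colour of a vertex: the exponent sum modulo three. -/
def colour : Vertex → ZMod 3 := fun v => Quotient.liftOn' v (fun g => (G0.expSum g).toAdd) (by
  intro g h hgh
  obtain ⟨k, hk⟩ := QuotientGroup.leftRel_apply.mp hgh
  have : h = g * G0.x ^ k := by
    rw [eq_comm, ← eq_inv_mul_iff_mul_eq]; exact hk
  simp [this, G0.expSum_x])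

theorem colour_vertex (g : G0) : colour (vertex g) = (G0.expSum g).toAdd := rfl

theorem vertex_mul_x (g : G0) : vertex (g * G0.x) = vertex g :=
  QuotientGroup.eq.mpr ⟨-1, by simp⟩

/-- The conjugate of `x` by `g` depends only on the coset `g⟨x⟩`, so its permutation is a computable
invariant that can tell vertices apart. -/
theorem perm_conj_x_eq {g h : G0} (hgh : vertex g = vertex h) :
    G0.perm (g * G0.x * g⁻¹) = G0.perm (h * G0.x * h⁻¹) := by
  obtain ⟨k, hk⟩ := QuotientGroup.eq.mp hgh
  have : h = g * G0.x ^ k := by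
    rw [eq_comm, ← eq_inv_mul_iff_mul_eq]; exact hk
  rw [this]
  congr 1
  group

theorem expSum_pairs {p : G0 × G0} (hp : p ∈ pairs) :
    G0.expSum p.1 = Multiplicative.ofAdd 1 ∧ G0.expSum p.2 = Multiplicative.ofAdd 1 := by
  simp only [pairs, Set.mem_insert_iff, Set.mem_singleton_iff] at hp
  rcases hp with rfl | rfl | rfl | rfl | rfl | rfl | rfl | rfl | rfl | rfl | rfl | rfl | rfl | rfl |
    rfl | rfl <;>
  simp only [G0.expSum_a, G0.expSum_b, G0.expSum_c, G0.expSum_d, G0.expSum_e, G0.expSum_f, and_self]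

theorem colour_pairs {p : G0 × G0} (hp : p ∈ pairs) (g : G0) :
    colour (vertex (g * p.1)) = colour (vertex g) + 1 ∧
      colour (vertex (g * p.1 * p.2)) = colour (vertex g) + 2 := by
  obtain ⟨h1, h2⟩ := expSum_pairs hp
  simp only [colour_vertex, map_mul, h1, h2, toAdd_mul, toAdd_ofAdd, add_assoc, one_add_one_eq_two,
    and_self]

theorem isColouring : Realization.IsColouring complex colour :=
  Realization.isColouring_spannedBy _ (by
    rintro _ ⟨g, p, hp, rfl⟩
    exact Realization.injOn_colour (colour_pairs hp g).1 (colour_pairs hp g).2)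

theorem isTriangle {p : G0 × G0} (hp : p ∈ pairs) (g : G0) : Realization.IsTriangle complex colour
    (vertex g) (vertex (g * p.1)) (vertex (g * p.1 * p.2)) := by
  have : ∀ k : ZMod 3, k ≠ k + 1 ∧ k ≠ k + 2 ∧ k + 1 ≠ k + 2 := by decide
  obtain ⟨e1, e2, e3⟩ := this (colour (vertex g))
  obtain ⟨h1, h2⟩ := colour_pairs hp g
  have ht : {vertex g, vertex (g * p.1), vertex (g * p.1 * p.2)} ∈ triangles := ⟨g, p, hp, rfl⟩
  refine Realization.isTriangle_spannedBy _ ht (by simp) (by simp) (by simp) ?_ ?_ ?_ <;>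
    simpa only [h1, h2]

theorem isBranchEdge {u : G0} {w : Fin 3 → G0} (hp : ∀ i, (u, w i) ∈ pairs)
    (hw : Function.Injective fun i => G0.perm (u * w i * G0.x * (u * w i)⁻¹)) :
    Realization.IsBranchEdge complex colour (vertex 1) (vertex u) := by
  refine ⟨fun i => vertex (u * w i), fun i j hij => hw (perm_conj_x_eq hij), fun i => ?_⟩
  have := isTriangle (hp i) 1
  simpa only [one_mul] using this

theorem isBranchEdge_a : Realization.IsBranchEdge complex colour (vertex 1) (vertex G0.a) := by
  apply isBranchEdge (w := ![G0.e, G0.d, G0.c])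
  · intro i; fin_cases i <;> simp [pairs]
  · have : (fun i => G0.perm (G0.a * ![G0.e, G0.d, G0.c] i * G0.x *
        (G0.a * ![G0.e, G0.d, G0.c] i)⁻¹)) = fun i : Fin 3 =>
        let a : Equiv.Perm (Fin 4) := Equiv.swap 0 1
        let b : Equiv.Perm (Fin 4) := Equiv.swap 1 2
        let c : Equiv.Perm (Fin 4) := Equiv.swap 2 3
        let w : Equiv.Perm (Fin 4) := ![a⁻¹ * b * a, (a * c)⁻¹ * b * (a * c), c] i
        a * w * (b * a * c) * (a * w)⁻¹ := by
      funext i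
      fin_cases i <;> simp [G0.e, G0.d, G0.x, G0.perm_a, G0.perm_b, G0.perm_c]
    rw [this]
    decide

theorem isBranchEdge_f : Realization.IsBranchEdge complex colour (vertex 1) (vertex G0.f) := by
  apply isBranchEdge (w := ![G0.b, G0.a, G0.e])
  · intro i; fin_cases i <;> simp [pairs]
  · have : (fun i => G0.perm (G0.f * ![G0.b, G0.a, G0.e] i * G0.x *
        (G0.f * ![G0.b, G0.a, G0.e] i)⁻¹)) = fun i : Fin 3 =>
        let a : Equiv.Perm (Fin 4) := Equiv.swap 0 1
        let b : Equiv.Perm (Fin 4) := Equiv.swap 1 2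
        let c : Equiv.Perm (Fin 4) := Equiv.swap 2 3
        let w : Equiv.Perm (Fin 4) := ![b, a, a⁻¹ * b * a] i
        c⁻¹ * b * c * w * (b * a * c) * (c⁻¹ * b * c * w)⁻¹ := by
      funext i
      fin_cases i <;> simp [G0.e, G0.f, G0.x, G0.perm_a, G0.perm_b, G0.perm_c]
    rw [this]
    decide

end X0

namespace X1

/-- The exponent sum modulo three, where the loop `t` counts twice. -/
def expSum : Pi1 →* Multiplicative (ZMod 3) :=
  PresentedGroup.toGroup (f := fun p => Multiplicative.ofAdd (match p.1 with
    | .first => (1 : ZMod 3) | .third => 1 | .prod => 2)) (by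
    rintro _ ⟨i, rfl | rfl | rfl⟩ <;> simp <;> decide)

theorem expSum_loop (l : Loop) (i j : ZMod 3) : expSum (loop l i) = expSum (loop l j) := by
  rw [expSum, loop, loop, PresentedGroup.toGroup.of, PresentedGroup.toGroup.of]

theorem expSum_first (i : ZMod 3) : expSum (loop .first i) = Multiplicative.ofAdd 1 :=
  PresentedGroup.toGroup.of _

theorem expSum_third (i : ZMod 3) : expSum (loop .third i) = Multiplicative.ofAdd 1 :=
  PresentedGroup.toGroup.of _

theorem expSum_shift (r : ZMod 3) : expSum.comp (shift r) = expSum := by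
  refine PresentedGroup.ext fun p => ?_
  change expSum (shift r (loop p.1 p.2)) = expSum (loop p.1 p.2)
  rw [shift_loop, expSum_loop _ _ p.2]

/-- The colour of a vertex: the exponent sum modulo three. -/
def colour (g : Vertex) : ZMod 3 := (expSum g).toAdd

theorem colour_smul (k : G1) (g : Vertex) : colour (k • g) = colour g + (expSum (hom k).left).toAdd := by
  change (expSum ((hom k).left * shift (hom k).right.toAdd g)).toAdd = _
  rw [map_mul, toAdd_mul, add_comm]
  congr 2
  exact DFunLike.congr_fun (expSum_shift _) (g : Pi1)

theorem colour_a_smul (g : Vertex) : colour (G1.a • g) = colour g + 1 := by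
  rw [colour_smul, hom_a, α, SemidirectProduct.left_inl, expSum_first, toAdd_ofAdd]

/-- The symmetry permutes loops of the same kind, which have equal exponent sums. The form `+ 0` is
the one that `colourWeight_smul` expects. -/
theorem colour_y_smul (g : Vertex) : colour (G1.y • g) = colour g + 0 := by
  rw [colour_smul, hom_y, η, SemidirectProduct.left_inr, map_one, toAdd_one]

theorem isColouring : Realization.IsColouring complex colour :=
  Realization.isColouring_spannedBy _ (by
    rintro _ ⟨g, p, hp, rfl⟩
    have h : expSum p.1 = Multiplicative.ofAdd 1 ∧ expSum p.2 = Multiplicative.ofAdd 1 := by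
      obtain ⟨i, rfl | rfl | rfl⟩ := hp <;> simp only [expSum_first, expSum_third, and_self]
    apply Realization.injOn_colour
    · change (expSum (g * p.1)).toAdd = (expSum g).toAdd + 1
      rw [map_mul, h.1, toAdd_mul, toAdd_ofAdd]
    · change (expSum (g * p.1 * p.2)).toAdd = (expSum g).toAdd + 2
      rw [map_mul expSum, map_mul expSum, h.1, h.2, toAdd_mul, toAdd_mul, toAdd_ofAdd, add_assoc,
        one_add_one_eq_two])

end X1

/-! ### The two congruences for the scaling factor. -/

open Realization

/-- Waves extend continuously to time zero, so two edges whose images come together at a vertex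
start from the same position on the circle. -/
theorem wave_eq_of_limits {Q Q' : ℝ → ZMod 3 → ℝ} {θ θ' v v' : ℝ}
    (hQ : ∀ t ∈ Set.Ioo (0 : ℝ) 1, Q t = wave (θ + v * t))
    (hQ' : ∀ t ∈ Set.Ioo (0 : ℝ) 1, Q' t = wave (θ' + v' * t))
    (h : ∀ l, Filter.Tendsto (fun s => Q s l - Q' s l) (𝓝[>] 0) (𝓝 0)) :
    (θ : AddCircle (3 : ℝ)) = θ' := by
  apply coe_eq_of_wave_eq
  ext l
  have hlim : ∀ a b : ℝ, Filter.Tendsto (fun s => wave (a + b * s) l) (𝓝[>] 0) (𝓝 (wave a l)) := by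
    intro a b
    have : Continuous fun s : ℝ => wave (a + b * s) l := (continuous_wave l).comp (by fun_prop)
    simpa using (this.tendsto 0).mono_left nhdsWithin_le_nhds
  have h1 := (hlim θ v).sub (hlim θ' v')
  have h2 := (h l).congr' (f₂ := fun s => wave (θ + v * s) l - wave (θ' + v' * s) l) (by
    filter_upwards [Ioo_mem_nhdsGT (zero_lt_one (α := ℝ))] with s hs
    rw [hQ s hs, hQ' s hs])
  exact sub_eq_zero.mp (tendsto_nhds_unique h1 h2)

section Equivariant

variable {f : X0.Space → X1.Space} {c : ℝ}

/-- The factor is a multiple of three, since `y` preserves the colours of the vertices of `X₁` and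
permutes the vertices of a triangle of `X₀`. -/
theorem exists_scale_eq_of_y (hc : 0 < c) (hf : ∀ p ∉ zeroSkeleton X0.complex, ScaledAt f c p)
    (heq : ∀ (g : G1) (p : X0.Space), f (g • p) = g • f p) : ∃ m : ℤ, c = 3 * m := by
  have hb := X0.isBranchEdge_f
  obtain ⟨γ, hγ⟩ : ∃ γ : ℝ → X0.Space, IsEdgePath (X0.vertex 1) (X0.vertex G0.f) γ := by
    obtain ⟨u, -, hu⟩ := hb
    exact (hu 0).exists_isEdgePath
  obtain ⟨σ, hσ, θ, hw⟩ := hb.exists_wave X0.isColouring X1.isColouring hc hf hγ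
  have hγ' : IsEdgePath (G1.y⁻¹ • X0.vertex G0.f) (G1.y⁻¹ • X0.vertex 1)
      fun t => G1.y⁻¹ • γ (1 - t) := hγ.smul_reverse (G1.y⁻¹ : G1).1
  have e1 : G1.y⁻¹ • X0.vertex G0.f = X0.vertex 1 := by
    rw [inv_smul_eq_iff]
    change X0.vertex G0.f = X0.vertex (G0.y * 1)
    rw [mul_one, G0.y_eq, X0.vertex_mul_x]
  have e2 : G1.y⁻¹ • X0.vertex 1 = X0.vertex G0.c⁻¹ := by
    rw [inv_smul_eq_iff]
    change X0.vertex 1 = X0.vertex (G0.y * G0.c⁻¹)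
    rw [G0.y, mul_inv_cancel_right, ← one_mul G0.x, X0.vertex_mul_x]
  rw [e1, e2] at hγ'
  -- The edge and its reversed translate by `y⁻¹` are two sides of the triangle that the relation
  -- word `cf` spans at `c⁻¹`.
  have htri : IsTriangle X0.complex X0.colour (X0.vertex 1) (X0.vertex G0.f)
      (X0.vertex G0.c⁻¹) := by
    have := X0.isTriangle (p := (G0.c, G0.f)) (by simp [X0.pairs]) G0.c⁻¹
    simp only [inv_mul_cancel, one_mul] at this
    obtain ⟨⟨s, hs, h1, h2, h3⟩, n1, n2, n3⟩ := this
    exact ⟨⟨s, hs, h2, h3, h1⟩, n3, n1.symm, n2.symm⟩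
  have hlim := htri.tendsto_colourWeight_sub X0.isColouring X1.isColouring hc hf hγ hγ'
  have hw' : ∀ t ∈ Set.Ioo (0 : ℝ) 1, colourWeight X1.colour (f (G1.y⁻¹ • γ (1 - t))) =
      wave (θ + σ * c + -(σ * c) * t) := by
    intro t ht
    have h1 : colourWeight X1.colour (f (G1.y⁻¹ • γ (1 - t))) =
        colourWeight X1.colour (f (γ (1 - t))) := by
      ext l
      rw [heq, ← colourWeight_smul G1.y X1.colour_y_smul, smul_inv_smul, add_zero]
    rw [h1, hw (1 - t) ⟨by linarith [ht.2], by linarith [ht.1]⟩]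
    congr 1
    ring
  have key := wave_eq_of_limits hw hw' hlim
  rw [eq_comm, ← sub_eq_zero, ← AddCircle.coe_sub, AddCircle.coe_eq_zero_iff] at key
  obtain ⟨m, hm⟩ := key
  rw [zsmul_eq_mul, add_sub_cancel_left] at hm
  rcases hσ with rfl | rfl
  · exact ⟨m, by linarith⟩
  · exact ⟨-m, by push_cast; linarith⟩

/-- Up to sign, the factor is congruent to one modulo three, since `a` changes the colours of the
vertices of `X₁` by one. -/
theorem exists_scale_eq_of_a (hc : 0 < c) (hf : ∀ p ∉ zeroSkeleton X0.complex, ScaledAt f c p)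
    (heq : ∀ (g : G1) (p : X0.Space), f (g • p) = g • f p) :
    ∃ σ : ℝ, (σ = 1 ∨ σ = -1) ∧ ∃ m : ℤ, σ * c = 3 * m + 1 := by
  have hb := X0.isBranchEdge_a
  obtain ⟨γ, hγ⟩ : ∃ γ : ℝ → X0.Space, IsEdgePath (X0.vertex 1) (X0.vertex G0.a) γ := by
    obtain ⟨u, -, hu⟩ := hb
    exact (hu 0).exists_isEdgePath
  obtain ⟨σ, hσ, θ, hw⟩ := hb.exists_wave X0.isColouring X1.isColouring hc hf hγ
  have hγ' : IsEdgePath (G1.a⁻¹ • X0.vertex G0.a) (G1.a⁻¹ • X0.vertex 1)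
      fun t => G1.a⁻¹ • γ (1 - t) := hγ.smul_reverse (G1.a⁻¹ : G1).1
  have e1 : G1.a⁻¹ • X0.vertex G0.a = X0.vertex 1 := by
    rw [inv_smul_eq_iff]
    change X0.vertex G0.a = X0.vertex (G0.a * 1)
    rw [mul_one]
  have e2 : G1.a⁻¹ • X0.vertex 1 = X0.vertex G0.a⁻¹ := by
    rw [inv_smul_eq_iff]
    change X0.vertex 1 = X0.vertex (G0.a * G0.a⁻¹)
    rw [mul_inv_cancel]
  rw [e1, e2] at hγ'
  -- Three triangles form a fan around `⟨x⟩` that leads from `a⟨x⟩` through `ae⟨x⟩ = eb⟨x⟩` and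
  -- `e⟨x⟩` to `a⁻¹⟨x⟩`.
  have htri₁ : IsTriangle X0.complex X0.colour (X0.vertex 1) (X0.vertex G0.a)
      (X0.vertex (G0.a * G0.e)) := by
    have := X0.isTriangle (p := (G0.a, G0.e)) (by simp [X0.pairs]) 1
    simpa only [one_mul] using this
  have htri₂ : IsTriangle X0.complex X0.colour (X0.vertex 1) (X0.vertex (G0.a * G0.e))
      (X0.vertex G0.e) := by
    have := X0.isTriangle (p := (G0.e, G0.b)) (by simp [X0.pairs]) 1
    simp only [one_mul, G0.eb] at this
    obtain ⟨⟨s, hs, h1, h2, h3⟩, n1, n2, n3⟩ := this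
    exact ⟨⟨s, hs, h1, h3, h2⟩, n2, n1, n3.symm⟩
  have htri₃ : IsTriangle X0.complex X0.colour (X0.vertex 1) (X0.vertex G0.e)
      (X0.vertex G0.a⁻¹) := by
    have := X0.isTriangle (p := (G0.a, G0.e)) (by simp [X0.pairs]) G0.a⁻¹
    simp only [inv_mul_cancel, one_mul] at this
    obtain ⟨⟨s, hs, h1, h2, h3⟩, n1, n2, n3⟩ := this
    exact ⟨⟨s, hs, h2, h3, h1⟩, n3, n1.symm, n2.symm⟩
  obtain ⟨γ₂, hγ₂⟩ := htri₂.exists_isEdgePath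
  obtain ⟨γ₃, hγ₃⟩ := htri₃.exists_isEdgePath
  have hlim : ∀ l, Filter.Tendsto (fun s => colourWeight X1.colour (f (γ s)) l -
      colourWeight X1.colour (f (G1.a⁻¹ • γ (1 - s))) l) (𝓝[>] 0) (𝓝 0) := by
    intro l
    have h1 := htri₁.tendsto_colourWeight_sub X0.isColouring X1.isColouring hc hf hγ hγ₂ l
    have h2 := htri₂.tendsto_colourWeight_sub X0.isColouring X1.isColouring hc hf hγ₂ hγ₃ l
    have h3 := htri₃.tendsto_colourWeight_sub X0.isColouring X1.isColouring hc hf hγ₃ hγ' l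
    simpa only [sub_add_sub_cancel, add_zero] using (h1.add h2).add h3
  -- The summand `-1` appears because `a⁻¹` lowers the colours of `X₁`, and with them the position
  -- on the circle, by one.
  have hw' : ∀ t ∈ Set.Ioo (0 : ℝ) 1, colourWeight X1.colour (f (G1.a⁻¹ • γ (1 - t))) =
      wave (θ + σ * c - 1 + -(σ * c) * t) := by
    intro t ht
    ext l
    rw [heq, ← colourWeight_smul G1.a X1.colour_a_smul, smul_inv_smul,
      hw (1 - t) ⟨by linarith [ht.2], by linarith [ht.1]⟩, ← wave_add_one _ l]
    congr 1
    ring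
  have key := wave_eq_of_limits hw hw' hlim
  rw [eq_comm, ← sub_eq_zero, ← AddCircle.coe_sub, AddCircle.coe_eq_zero_iff] at key
  obtain ⟨m, hm⟩ := key
  rw [zsmul_eq_mul] at hm
  exact ⟨σ, hσ, m, by linarith⟩

end Equivariant

end BradyRigidity

theorem theorem2 :
    ¬ ∃ f : BradyRigidity.X0.Space → BradyRigidity.X1.Space,
      (∀ (g : BradyRigidity.G1) (p : BradyRigidity.X0.Space), f (g • p) = g • f p) ∧
      (∀ p : BradyRigidity.X0.Space, ∃ U ∈ 𝓝 p, Set.InjOn f U) ∧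
      ∃ c : ℝ≥0, 0 < c ∧
        ∀ p : BradyRigidity.X0.Space,
          p ∉ BradyRigidity.Realization.zeroSkeleton BradyRigidity.X0.complex →
          ∃ U ∈ 𝓝 p, ∀ q ∈ U, ∀ r ∈ U, edist (f q) (f r) = c * edist q r := by
  rintro ⟨f, heq, -, c, hc, hf⟩
  have hf' := fun p hp => BradyRigidity.Realization.scaledAt_of_nhds (hf p hp)
  obtain ⟨m, hm⟩ := BradyRigidity.exists_scale_eq_of_y hc hf' heq
  obtain ⟨σ, hσ, n, hn⟩ := BradyRigidity.exists_scale_eq_of_a hc hf' heq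
  -- Now `±3m = 3n + 1` in the integers, which is impossible modulo 3.
  rw [hm] at hn
  rcases hσ with rfl | rfl
  · have : 1 * (3 * m) = 3 * n + 1 := by exact_mod_cast hn
    omega
  · have : -1 * (3 * m) = 3 * n + 1 := by exact_mod_cast hn
    omega
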